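/- Let $q:\mathbb R\to\mathbb C$ be a measurable function with $\int_{\mathbb R}(1+|x|)\,|q(x)|\,dx<\infty$. Let $H=-\frac{d^2}{dx^2}+q$ be the Schrödinger operator in $L^2(\mathbb R)$ with its maximal domain: all $y\in L^2(\mathbb R)$ such that $y$ and $y'$ are locally absolutely continuous and $-y''+qy\in L^2(\mathbb R)$. The algebraic multiplicity of an eigenvalue $E$ of $H$ is $\dim\bigcup_{n\ge1}\ker(H-E)^n$. Let $k_1,k_2,\dots$ ($N\le\infty$ of them) be the points $k$ of $\mathbb C_+=\{k\in\mathbb C:\operatorname{Im}k>0\}$ for which $k^2$ is an eigenvalue of $H$, each repeated according to the algebraic multiplicity of $k^2$, and let $$B(k)=\prod_{j=1}^{N}\frac{k-k_j}{k-\overline{k_j}},\qquad k\in\mathbb C_+ .$$ Put $q_0=\int_{\mathbb R}q(x)\,dx$, $\|q\|=\int_{\mathbb R}|q(x)|\,dx$, $\|q\|_1=\int_{\mathbb R}|x\,q(x)|\,dx$ and $A=\|q\|\,\|q\|_1\,e^{\|q\|_1}$. Then: (i) These eigenvalues have finite algebraic multiplicity, the product $B(k)$ converges absolutely for every $k\in\mathbb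 C_+$, and $B$ belongs to the Hardy space $H^\infty(\mathbb C_+)$ of bounded holomorphic functions on $\mathbb C_+$, with $\|B\|_{H^\infty}=\sup_{k\in\mathbb C_+}|B(k)|\le1$. (ii) If $A<\operatorname{Re}q_0$, then $H$ has no eigenvalues. If $A<-\operatorname{Re}q_0$, then $H$ has exactly one eigenvalue; it has algebraic multiplicity one and lies in $\mathbb C\setminus[0,\infty)$. -/

import Mathlib

open MeasureTheory
open scoped ENNReal ComplexConjugate

/-! ### Eigenvalues and root spaces of unbounded operators -/

namespace LinearPMap

variable {X : Type*} [AddCommGroup X] [Module ℂ X]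

/-- `E` is an eigenvalue of the unbounded operator `T`: there is a nonzero vector `y` in the
domain of `T` such that `T y = E y`. -/
def IsEigenvalue (T : X →ₗ.[ℂ] X) (E : ℂ) : Prop :=
  ∃ y : T.domain, (y : X) ≠ 0 ∧ T y = E • (y : X)

/-- The kernel of `(T - E)ⁿ` for an unbounded operator `T`, with its natural domain:
`y` belongs to the kernel of `(T - E)ⁿ⁺¹` if and only if `y` belongs to the domain of `T`
and `T y - E y` belongs to the kernel of `(T - E)ⁿ`. -/
def kerPow (T : X →ₗ.[ℂ] X) (E : ℂ) : ℕ → Submodule ℂ X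
  | 0 => ⊥
  | n + 1 => ((kerPow T E n).comap (T.toFun - E • T.domain.subtype)).map T.domain.subtype

/-- The root space (generalized eigenspace) of `T` at `E`: the union of the increasing sequence
of the kernels of `(T - E)ⁿ`. -/
def rootSpace (T : X →ₗ.[ℂ] X) (E : ℂ) : Submodule ℂ X := ⨆ n : ℕ, kerPow T E n

/-- The algebraic multiplicity of `E`: the dimension of the root space
(by convention `0` if that dimension is infinite). -/
noncomputable def algMult (T : X →ₗ.[ℂ] X) (E : ℂ) : ℕ := Module.finrank ℂ (rootSpace T E)

theorem mem_kerPow_succ (T : X →ₗ.[ℂ] X) (E : ℂ) (n : ℕ) (y : X) :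
    y ∈ kerPow T E (n + 1) ↔ ∃ z : T.domain, (z : X) = y ∧ T z - E • (z : X) ∈ kerPow T E n := by
  simp only [kerPow, Submodule.mem_map, Submodule.mem_comap]
  constructor
  · rintro ⟨z, hz, rfl⟩
    exact ⟨z, rfl, hz⟩
  · rintro ⟨z, rfl, hz⟩
    exact ⟨z, hz, rfl⟩

end LinearPMap

/-! ### The Schrödinger operator on the line -/

namespace Schrodinger

/-- The Hilbert space `L²(ℝ)` of complex-valued functions. -/
abbrev L2 : Type := Lp ℂ 2 (volume : Measure ℝ)

/-- `-y'' + q y = g` for `y, g ∈ L²(ℝ)`: the class `y` has a differentiable representative `u`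
whose derivative `v` is locally absolutely continuous with `v' = q u - g` almost everywhere.
(Local absolute continuity of `v` together with `v' = q u - g` a.e. is written as: `q u - g` is
integrable on bounded intervals and `v` is a primitive of it.) -/
def IsPair (q : ℝ → ℂ) (y g : L2) : Prop :=
  ∃ u v : ℝ → ℂ, (y : ℝ → ℂ) =ᵐ[volume] u ∧
    (∀ x, HasDerivAt u (v x) x) ∧
    (∀ a b : ℝ, IntervalIntegrable (fun t => q t * u t - g t) volume a b) ∧
    ∀ a b : ℝ, v b - v a = ∫ t in a..b, (q t * u t - g t)

/-- The graph of the Schrödinger operator `-d²/dx² + q` on its maximal domain. -/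
def graph (q : ℝ → ℂ) : Submodule ℂ (L2 × L2) where
  carrier := {p | IsPair q p.1 p.2}
  zero_mem' := by
    have h0 : ((0 : L2) : ℝ → ℂ) =ᵐ[volume] 0 := Lp.coeFn_zero ℂ 2 volume
    have h1 : (fun t => q t * (0 : ℂ) - ((0 : L2) : ℝ → ℂ) t) =ᵐ[volume] fun _ => (0 : ℂ) := by
      filter_upwards with t
      simp
    refine ⟨fun _ => 0, fun _ => 0, h0, fun x => hasDerivAt_const x 0, fun a b => ?_,
      fun a b => ?_⟩
    · exact (intervalIntegrable_const (c := (0 : ℂ))).congr_ae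
        (ae_restrict_of_ae h1.symm)
    · have := intervalIntegral.integral_congr_ae (a := a) (b := b) (h1.mono fun t ht _ => ht)
      simp only [Prod.snd_zero]
      rw [this]
      simp
  add_mem' := by
    rintro ⟨y₁, g₁⟩ ⟨y₂, g₂⟩ ⟨u₁, v₁, hy₁, hu₁, hi₁, hv₁⟩ ⟨u₂, v₂, hy₂, hu₂, hi₂, hv₂⟩
    have h1 : (fun t => (q t * u₁ t - g₁ t) + (q t * u₂ t - g₂ t)) =ᵐ[volume]
        fun t => q t * (u₁ t + u₂ t) - ((g₁ + g₂ : L2) : ℝ → ℂ) t := by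
      filter_upwards [Lp.coeFn_add g₁ g₂] with t ht
      rw [ht, Pi.add_apply]
      ring
    refine ⟨fun t => u₁ t + u₂ t, fun t => v₁ t + v₂ t, ?_, fun x => (hu₁ x).add (hu₂ x),
      fun a b => ?_, fun a b => ?_⟩
    · filter_upwards [Lp.coeFn_add y₁ y₂, hy₁, hy₂] with t ht ht₁ ht₂
      change ((y₁ + y₂ : L2) : ℝ → ℂ) t = _
      rw [ht, Pi.add_apply, ht₁, ht₂]
    · exact ((hi₁ a b).add (hi₂ a b)).congr_ae (ae_restrict_of_ae h1)
    · have := intervalIntegral.integral_congr_ae (a := a) (b := b) (h1.mono fun t ht _ => ht)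
      change _ = ∫ t in a..b, (q t * (u₁ t + u₂ t) - ((g₁ + g₂ : L2) : ℝ → ℂ) t)
      rw [← this, intervalIntegral.integral_add (hi₁ a b) (hi₂ a b)]
      have e₁ := hv₁ a b
      have e₂ := hv₂ a b
      simp only at e₁ e₂
      rw [← e₁, ← e₂]
      ring
  smul_mem' := by
    rintro c ⟨y, g⟩ ⟨u, v, hy, hu, hi, hv⟩
    have h1 : (fun t => c * (q t * u t - g t)) =ᵐ[volume]
        fun t => q t * (c * u t) - ((c • g : L2) : ℝ → ℂ) t := by
      filter_upwards [Lp.coeFn_smul c g] with t ht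
      rw [ht, Pi.smul_apply, smul_eq_mul]
      ring
    refine ⟨fun t => c * u t, fun t => c * v t, ?_, fun x => (hu x).const_mul c,
      fun a b => ?_, fun a b => ?_⟩
    · filter_upwards [Lp.coeFn_smul c y, hy] with t ht ht₁
      change ((c • y : L2) : ℝ → ℂ) t = _
      rw [ht, Pi.smul_apply, ht₁, smul_eq_mul]
    · exact ((hi a b).const_mul c).congr_ae (ae_restrict_of_ae h1)
    · have := intervalIntegral.integral_congr_ae (a := a) (b := b) (h1.mono fun t ht _ => ht)
      change _ = ∫ t in a..b, (q t * (c * u t) - ((c • g : L2) : ℝ → ℂ) t)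
      rw [← this, intervalIntegral.integral_const_mul]
      have e := hv a b
      simp only at e
      rw [← e]
      ring

/-- The Schrödinger operator `H = -d²/dx² + q` in `L²(ℝ)`, on its maximal domain: the functions
`y ∈ L²(ℝ)` such that `y` and `y'` are locally absolutely continuous and `-y'' + q y ∈ L²(ℝ)`. -/
noncomputable def H (q : ℝ → ℂ) : L2 →ₗ.[ℂ] L2 := (graph q).toLinearPMap

theorem graph_functional (q : ℝ → ℂ) (p : L2 × L2) (hp : p ∈ graph q) (h0 : p.1 = 0) :
    p.2 = 0 := by
  obtain ⟨y, g⟩ := p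
  obtain ⟨u, v, hy, hu, hi, hv⟩ := hp
  simp only at h0 hy hi hv ⊢
  subst h0
  have hu0 : u = fun _ => 0 := by
    have hc : Continuous u := continuous_iff_continuousAt.2 fun x => (hu x).continuousAt
    have h1 : u =ᵐ[volume] fun _ => (0 : ℂ) := hy.symm.trans (Lp.coeFn_zero ℂ 2 volume)
    exact (hc.ae_eq_iff_eq volume continuous_const).1 h1
  have hv0 : ∀ x, v x = 0 := fun x => by
    have := hu x
    rw [hu0] at this
    exact this.unique (hasDerivAt_const x 0)
  have hloc : LocallyIntegrable (fun t => g t) volume :=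
    (Lp.memLp g).locallyIntegrable (by norm_num)
  have hint : ∀ b : ℝ, ∫ t in (0 : ℝ)..b, g t = 0 := fun b => by
    have := hv 0 b
    simp only [hu0, hv0, mul_zero, zero_sub, sub_zero, intervalIntegral.integral_neg] at this
    simpa using this.symm
  rw [Lp.eq_zero_iff_ae_eq_zero]
  filter_upwards [_root_.LocallyIntegrable.ae_hasDerivAt_integral hloc] with x hx
  have h2 := hx 0
  have h3 : (fun b => ∫ t in (0 : ℝ)..b, g t) = fun _ => (0 : ℂ) := funext hint
  rw [h3] at h2
  exact h2.unique (hasDerivAt_const x 0)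

/-- The graph of the operator `H` is the one it was built from. -/
theorem H_graph (q : ℝ → ℂ) : (H q).graph = graph q :=
  Submodule.toLinearPMap_graph_eq _ fun p hp h0 => graph_functional q p hp h0

/-- `k` in the open upper half-plane is an eigenvalue of `H` in the momentum variable if `k ^ 2`
is an eigenvalue of `H`. (The map `k ↦ k ^ 2` is a bijection of the open upper half-plane onto
`ℂ ∖ [0, ∞)`.) -/
def momenta (q : ℝ → ℂ) : Set ℂ := {k | 0 < k.im ∧ (H q).IsEigenvalue (k ^ 2)}

/-- Index set of the eigenvalues `k_j`, each repeated according to its algebraic multiplicity. -/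
abbrev Index (q : ℝ → ℂ) : Type := Σ κ : momenta q, Fin ((H q).algMult ((κ : ℂ) ^ 2))

/-- The factor `(k - k_j) / (k - conj k_j)` of the Blaschke product. -/
noncomputable def factor (q : ℝ → ℂ) (k : ℂ) (j : Index q) : ℂ :=
  (k - (j.1 : ℂ)) / (k - conj (j.1 : ℂ))

/-- The Blaschke product over the eigenvalues, counted with algebraic multiplicity. -/
noncomputable def blaschke (q : ℝ → ℂ) (k : ℂ) : ℂ := ∏' j : Index q, factor q k j

/-- The norm of the Hardy space `H^∞` of the upper half-plane. -/
noncomputable def hardyNorm (F : ℂ → ℂ) : ℝ≥0∞ := ⨆ k ∈ {z : ℂ | 0 < z.im}, ‖F k‖ₑ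

/-- Membership in the Hardy space `H^∞` of the upper half-plane: holomorphic and bounded. -/
def MemHardy (F : ℂ → ℂ) : Prop :=
  DifferentiableOn ℂ F {z : ℂ | 0 < z.im} ∧ hardyNorm F < ∞

/-- `‖q‖ = ∫ |q(x)| dx`. -/
noncomputable def norm0 (q : ℝ → ℂ) : ℝ := ∫ x, ‖q x‖

/-- `‖q‖₁ = ∫ |x q(x)| dx`. -/
noncomputable def norm1 (q : ℝ → ℂ) : ℝ := ∫ x, |x| * ‖q x‖

/-- `A = ‖q‖ ‖q‖₁ exp ‖q‖₁`. -/
noncomputable def constA (q : ℝ → ℂ) : ℝ := norm0 q * norm1 q * Real.exp (norm1 q)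

end Schrodinger

/-! Everything is read off from the Jost solutions. For `0 ≤ k.im` the equation `-f'' + q f = k² f`
on `[0, ∞)` has a solution `f = exp (i k x) m(x)` with `m → 1`. The function `m` solves a Volterra
equation with kernel `kern k (t - x)`, of modulus at most `t` for `0 ≤ x ≤ t`. Its Neumann series is
therefore dominated by `exp (gam q x)`, uniformly in `k` and including `k = 0`. The left half-line
is treated by reflecting the potential, and the Wronskian `jostW q k` at `0` of the two Jost
solutions is holomorphic in the open upper half-plane. The central estimate is `norm_jostW_sub_le`:
`|W(k) - 2ik + q₀| ≤ A`.

An `L²` solution at energy `k²` has no Wronskian with the Jost solutions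
(`wronskian_zero_eq_integral`). Hence eigenvalues come from zeros of `W`, and there are none on `[0,
∞)`, where a nonzero multiple of `f` keeps a positive modulus at infinity. Conversely, at a zero of
`W` the two Jost solutions glue to an eigenfunction. A chain of `m + 1` root vectors at `κ²` can be
summed into an approximate solution at energy `k²` with error of order `(k - κ)^(m+1)`, which forces
a zero of `W` of that order (`IsChain.le_analyticOrderAt`). Since geometric eigenspaces are at most
one-dimensional, algebraic multiplicity is at most the order of the zero.

For (i), `W(k) / (k + i)` is bounded. Dividing out Blaschke factors at its zeros does not increase
the bound, so at a point where `W ≠ 0` all finite Blaschke products are bounded below. As the zeros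
lie in a fixed disc, `∑ Im k_j` converges, and with it the product.

For (ii), a zero satisfies `|q₀ - 2ik| ≤ A`, where `Re (-2ik) = 2 Im k > 0`; this excludes `A < Re
q₀`. If `A < -Re q₀`, the zeros are the fixed points of `φ(z) = z - W(z)/(2i)`, which sends the
upper half-plane into a disc of radius `A/2` about `q₀/(2i)`, a disc inside the half-plane. Such a
map has exactly one fixed point and it is simple, by a Rouché type argument based on the maximum
principle. -/

open Set Filter Topology

/-! ### Primitives of locally integrable functions, tails and a Gronwall lemma. -/

namespace Schrodinger

section Primitive

variable {𝕜 : Type*} [RCLike 𝕜]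

/-- `F` is on `[0, ∞)` a primitive of the locally integrable function `f`. -/
def HasPrim (F f : ℝ → 𝕜) : Prop :=
  ∀ x, 0 ≤ x → IntervalIntegrable f volume 0 x ∧ F x = F 0 + ∫ t in (0 : ℝ)..x, f t

namespace HasPrim

variable {F G f g : ℝ → 𝕜}

theorem congr_ae (h : HasPrim F f) (hfg : ∀ᵐ t, 0 < t → f t = g t) : HasPrim F g := by
  intro x hx
  have h1 : ∀ᵐ t, t ∈ uIoc 0 x → f t = g t := by
    filter_upwards [hfg] with t ht h2
    rw [uIoc_of_le hx] at h2
    exact ht h2.1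
  refine ⟨(h x hx).1.congr_ae ((ae_restrict_iff' measurableSet_uIoc).2 h1), ?_⟩
  rw [(h x hx).2, intervalIntegral.integral_congr_ae h1]

theorem congr (h : HasPrim F f) (hfg : ∀ t, 0 < t → f t = g t) : HasPrim F g :=
  h.congr_ae (Eventually.of_forall hfg)

theorem congr_left (h : HasPrim F f) (hFG : ∀ t, 0 ≤ t → F t = G t) : HasPrim G f := by
  intro x hx
  rw [← hFG x hx, ← hFG 0 le_rfl]
  exact h x hx

theorem sub_eq (h : HasPrim F f) {a b : ℝ} (ha : 0 ≤ a) (hb : 0 ≤ b) :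
    F b - F a = ∫ t in a..b, f t := by
  rw [(h a ha).2, (h b hb).2,
    ← intervalIntegral.integral_interval_sub_left (h b hb).1 (h a ha).1]
  ring

theorem add (hF : HasPrim F f) (hG : HasPrim G g) :
    HasPrim (fun x => F x + G x) (fun x => f x + g x) := by
  intro x hx
  refine ⟨(hF x hx).1.add (hG x hx).1, ?_⟩
  beta_reduce
  rw [intervalIntegral.integral_add (hF x hx).1 (hG x hx).1, (hF x hx).2, (hG x hx).2]
  ring

theorem const_mul (c : 𝕜) (hF : HasPrim F f) : HasPrim (fun x => c * F x) (fun x => c * f x) := by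
  intro x hx
  refine ⟨(hF x hx).1.const_mul c, ?_⟩
  beta_reduce
  rw [intervalIntegral.integral_const_mul, (hF x hx).2]
  ring

theorem sub (hF : HasPrim F f) (hG : HasPrim G g) :
    HasPrim (fun x => F x - G x) (fun x => f x - g x) := by
  simpa [sub_eq_add_neg] using hF.add (hG.const_mul (-1))

theorem of_hasDerivAt (h : ∀ x, HasDerivAt F (f x) x) (hf : Continuous f) : HasPrim F f := by
  intro x _
  refine ⟨hf.intervalIntegrable _ _, ?_⟩
  rw [intervalIntegral.integral_eq_sub_of_hasDerivAt (fun t _ => h t) (hf.intervalIntegrable _ _)]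
  ring

theorem continuousOn (h : HasPrim F f) : ContinuousOn F (Ici 0) := by
  have key : ∀ X, 0 ≤ X → ContinuousOn F (Icc 0 X) := by
    intro X hX
    have h1 : ContinuousOn (fun x => F 0 + ∫ t in (0 : ℝ)..x, f t) (Icc 0 X) :=
      continuousOn_const.add (by
        have := intervalIntegral.continuousOn_primitive_interval (a := 0) (b := X) (f := f)
          (μ := volume) (by
            rw [uIcc_of_le hX]
            exact (intervalIntegrable_iff_integrableOn_Icc_of_le hX).1 (h X hX).1)
        rwa [uIcc_of_le hX] at this)
    exact h1.congr fun x hx => (h x hx.1).2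
  intro x hx
  have hx0 : (0 : ℝ) ≤ x := hx
  have h2 := key (x + 1) (by linarith) x ⟨hx0, by linarith⟩
  refine h2.mono_of_mem_nhdsWithin ?_
  have : Iio (x + 1) ∈ 𝓝[Ici 0] x := mem_nhdsWithin_of_mem_nhds (Iio_mem_nhds (by linarith))
  filter_upwards [this, self_mem_nhdsWithin] with t ht ht0
  exact ⟨ht0, ht.le⟩

theorem continuousOn_uIcc (h : HasPrim F f) {a b : ℝ} (ha : 0 ≤ a) (hb : 0 ≤ b) :
    ContinuousOn F (uIcc a b) :=
  h.continuousOn.mono fun t ht => by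
    rcases le_total a b with hab | hab
    · rw [uIcc_of_le hab] at ht; exact ha.trans ht.1
    · rw [uIcc_of_ge hab] at ht; exact hb.trans ht.1

/-- Increments of the primitive of `f` are dominated by those of the real primitive of `‖f‖`, so the
real case suffices. -/
theorem absolutelyContinuousOnInterval_integral {x : ℝ} (hf : IntervalIntegrable f volume 0 x) :
    AbsolutelyContinuousOnInterval (fun y => ∫ t in (0 : ℝ)..y, f t) 0 x := by
  have h1 := hf.norm.absolutelyContinuousOnInterval_intervalIntegral (c := 0) (by simp)
  rw [absolutelyContinuousOnInterval_iff] at h1 ⊢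
  intro ε hε
  obtain ⟨δ, hδ, h⟩ := h1 ε hε
  refine ⟨δ, hδ, fun E hE hlt => lt_of_le_of_lt (Finset.sum_le_sum fun i hi => ?_) (h E hE hlt)⟩
  obtain ⟨ha, hb⟩ := hE.1 i (by simpa using hi)
  have sub1 : ∀ {y}, y ∈ uIcc 0 x → IntervalIntegrable f volume 0 y := fun hy =>
    hf.mono_set (uIcc_subset_uIcc (by simp) hy)
  rw [dist_eq_norm, dist_eq_norm, intervalIntegral.integral_interval_sub_left (sub1 ha) (sub1 hb),
    intervalIntegral.integral_interval_sub_left (sub1 ha).norm (sub1 hb).norm]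
  exact intervalIntegral.norm_integral_le_abs_integral_norm

/-- The product minus the primitive of `f G + F g` is absolutely continuous with derivative zero
almost everywhere, hence constant. This product rule replaces classical differentiation, which is
not available when the potential is merely integrable. -/
theorem mul (hF : HasPrim F f) (hG : HasPrim G g) :
    HasPrim (fun x => F x * G x) (fun x => f x * G x + F x * g x) := by
  intro x hx
  have hi : IntervalIntegrable (fun t => f t * G t + F t * g t) volume 0 x :=
    ((hF x hx).1.mul_continuousOn (hG.continuousOn_uIcc le_rfl hx)).add
      ((hG x hx).1.continuousOn_mul (hF.continuousOn_uIcc le_rfl hx))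
  refine ⟨hi, ?_⟩
  have acF := absolutelyContinuousOnInterval_integral (hF x hx).1
  have acG := absolutelyContinuousOnInterval_integral (hG x hx).1
  have acH := absolutelyContinuousOnInterval_integral hi
  have acc : ∀ c : 𝕜, AbsolutelyContinuousOnInterval (fun _ : ℝ => c) 0 x := fun c =>
    (LipschitzWith.const c).lipschitzOnWith.absolutelyContinuousOnInterval
  -- `F` and `G` are controlled only on `[0, ∞)`, so they are replaced by `F 0 + ∫ f` and `G 0 + ∫
  -- g`, which agree with them there.
  have acZ := (((acc (F 0)).add acF).smul ((acc (G 0)).add acG)).sub acH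
  have hd : ∀ᵐ t, t ∈ uIcc 0 x → HasDerivAt
      (((fun _ => F 0) + fun y => ∫ t in (0 : ℝ)..y, f t) •
        ((fun _ => G 0) + fun y => ∫ t in (0 : ℝ)..y, g t) -
        fun y => ∫ t in (0 : ℝ)..y, (f t * G t + F t * g t)) 0 t := by
    filter_upwards [(hF x hx).1.ae_hasDerivAt_integral, (hG x hx).1.ae_hasDerivAt_integral,
      hi.ae_hasDerivAt_integral] with t h1 h2 h3 ht
    have e1 := ((hasDerivAt_const t (F 0)).add (h1 ht 0 (by simp)))
    have e2 := ((hasDerivAt_const t (G 0)).add (h2 ht 0 (by simp)))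
    have e3 := (e1.mul e2).sub (h3 ht 0 (by simp))
    have ht0 : 0 ≤ t := by rw [uIcc_of_le hx] at ht; exact ht.1
    have a1 := (hF t ht0).2
    have a2 := (hG t ht0).2
    refine HasDerivAt.congr_deriv (f' := (0 + f t) * G t + F t * (0 + g t)
      - (f t * G t + F t * g t)) ?_ (by ring)
    simp only [Pi.add_apply, ← a1, ← a2] at e3
    exact e3
  obtain ⟨C, hC⟩ := acZ.const_of_ae_hasDerivAt_zero hd
  have c0 := hC 0 (by simp)
  have cx := hC x (by simp)
  simp only [Pi.sub_apply, Pi.smul_apply', Pi.add_apply,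
    intervalIntegral.integral_same, add_zero, sub_zero] at c0 cx
  rw [← (hF x hx).2, ← (hG x hx).2] at cx
  rw [smul_eq_mul] at c0 cx
  beta_reduce
  rw [c0, ← cx]
  ring

theorem pow (hF : HasPrim F f) (n : ℕ) :
    HasPrim (fun x => F x ^ (n + 1)) (fun x => ((n : 𝕜) + 1) * (f x * F x ^ n)) := by
  induction n with
  | zero => simpa using hF
  | succ n ih =>
    have h := ih.mul hF
    simp only [← pow_succ] at h
    refine h.congr fun t _ => ?_
    push_cast
    ring

end HasPrim

theorem setIntegral_Ioi_eq_sub {f : ℝ → 𝕜} (hf : IntegrableOn f (Ioi 0)) {x : ℝ} (hx : 0 ≤ x) :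
    ∫ t in Ioi x, f t = (∫ t in Ioi 0, f t) - ∫ t in (0 : ℝ)..x, f t := by
  rw [← intervalIntegral.integral_Ioi_sub_Ioi hf hx]
  ring

theorem HasPrim.tail {f : ℝ → 𝕜} (hf : IntegrableOn f (Ioi 0)) :
    HasPrim (fun x => ∫ t in Ioi x, f t) (fun x => -f x) := by
  intro x hx
  refine ⟨((intervalIntegrable_iff_integrableOn_Ioc_of_le hx).2
    (hf.mono_set Ioc_subset_Ioi_self)).neg, ?_⟩
  beta_reduce
  rw [intervalIntegral.integral_neg, setIntegral_Ioi_eq_sub hf hx]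
  ring

theorem tendsto_tail {f : ℝ → 𝕜} (hf : IntegrableOn f (Ioi 0)) :
    Tendsto (fun x => ∫ t in Ioi x, f t) atTop (𝓝 0) := by
  have h1 := intervalIntegral_tendsto_integral_Ioi 0 hf tendsto_id
  have h2 := h1.const_sub (∫ t in Ioi 0, f t)
  rw [sub_self] at h2
  refine h2.congr' ?_
  filter_upwards [eventually_ge_atTop 0] with x hx
  rw [setIntegral_Ioi_eq_sub hf hx]
  rfl

end Primitive

section Tail

variable {p : ℝ → ℝ}

theorem tail_nonneg (hp0 : ∀ t, 0 ≤ p t) (x : ℝ) : 0 ≤ ∫ t in Ioi x, p t :=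
  setIntegral_nonneg measurableSet_Ioi fun t _ => hp0 t

theorem tail_anti (hp : IntegrableOn p (Ioi 0)) (hp0 : ∀ t, 0 ≤ p t) {x y : ℝ} (hx : 0 ≤ x)
    (hxy : x ≤ y) : ∫ t in Ioi y, p t ≤ ∫ t in Ioi x, p t :=
  setIntegral_mono_set (hp.mono_set (Ioi_subset_Ioi hx))
    (Eventually.of_forall fun t => hp0 t) (Ioi_subset_Ioi hxy).eventuallyLE

theorem integrableOn_mul_tail_pow (hp : IntegrableOn p (Ioi 0)) (hp0 : ∀ t, 0 ≤ p t) (n : ℕ) :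
    IntegrableOn (fun t => p t * (∫ s in Ioi t, p s) ^ n) (Ioi 0) := by
  refine Integrable.mul_bdd (c := (∫ s in Ioi 0, p s) ^ n) hp ?_ ?_
  · exact (((HasPrim.tail hp).continuousOn.mono Ioi_subset_Ici_self).pow n).aestronglyMeasurable
      measurableSet_Ioi
  · refine (ae_restrict_iff' measurableSet_Ioi).2 (Eventually.of_forall fun t ht => ?_)
    have := tail_nonneg hp0 t
    rw [norm_pow, Real.norm_of_nonneg this]
    exact pow_le_pow_left₀ this (tail_anti hp hp0 le_rfl (le_of_lt ht)) n

/-- With `P` the tail of `p`, the integrand is `-(P ^ (n + 1))' / (n + 1)` and `P` vanishes at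
infinity. Iterating this produces the factorials in the Neumann series. -/
theorem integral_mul_tail_pow (hp : IntegrableOn p (Ioi 0)) (hp0 : ∀ t, 0 ≤ p t) (n : ℕ)
    {x : ℝ} (hx : 0 ≤ x) :
    ∫ t in Ioi x, p t * (∫ s in Ioi t, p s) ^ n = (∫ s in Ioi x, p s) ^ (n + 1) / (n + 1) := by
  have hP := (HasPrim.tail hp).pow n
  have hint := integrableOn_mul_tail_pow hp hp0 n
  have h1 := intervalIntegral_tendsto_integral_Ioi x (hint.mono_set (Ioi_subset_Ioi hx)) tendsto_id
  have h2 : Tendsto (fun X => ((∫ s in Ioi x, p s) ^ (n + 1) - (∫ s in Ioi X, p s) ^ (n + 1))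
      / ((n : ℝ) + 1)) atTop (𝓝 (((∫ s in Ioi x, p s) ^ (n + 1) - 0 ^ (n + 1)) / (n + 1))) :=
    (((tendsto_tail hp).pow (n + 1)).const_sub _).div_const _
  have hn : (n : ℝ) + 1 ≠ 0 := by positivity
  simp only [ne_eq, Nat.add_eq_zero_iff, one_ne_zero, and_false, not_false_eq_true, zero_pow,
    sub_zero] at h2
  refine tendsto_nhds_unique h1 (h2.congr' ?_)
  filter_upwards [eventually_ge_atTop x] with X hX
  have h3 := hP.sub_eq hx (hx.trans hX)
  rw [intervalIntegral.integral_const_mul] at h3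
  simp only [neg_mul, intervalIntegral.integral_neg] at h3
  rw [div_eq_iff hn]
  simp only [id]
  linarith

end Tail

/-- A continuous function dominated by the integral of itself against a locally integrable weight
vanishes. -/
theorem eq_zero_of_le_integral {s P : ℝ → ℝ} (hs : ContinuousOn s (Ici 0))
    (hP : ∀ x, 0 ≤ x → IntervalIntegrable P volume 0 x) (hP0 : ∀ t, 0 ≤ P t)
    (hle : ∀ x, 0 ≤ x → s x ≤ ∫ t in (0 : ℝ)..x, P t * s t) (hs0 : ∀ x, 0 ≤ s x)
    {x : ℝ} (hx : 0 ≤ x) : s x = 0 := by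
  obtain ⟨M, hM⟩ := (isCompact_Icc (a := (0 : ℝ)) (b := x)).exists_bound_of_continuousOn
    (hs.mono Icc_subset_Ici_self)
  have hΦ : HasPrim (fun x => ∫ t in (0 : ℝ)..x, P t) P := fun y hy => ⟨hP y hy, by simp⟩
  -- Feeding the inequality into itself `n` times gains a factor `1 / n!`, which beats the powers of
  -- the integral of `P`.
  have key : ∀ n : ℕ, ∀ y ∈ Icc 0 x,
      s y ≤ M * ((∫ t in (0 : ℝ)..y, P t) ^ n / (n.factorial : ℝ)) := by
    intro n
    induction n with
    | zero => intro y hy; simpa using (le_abs_self _).trans (hM y hy)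
    | succ n ih =>
      intro y hy
      have hpw := hΦ.pow n y hy.1
      have hi1 : IntervalIntegrable (fun t => P t * (∫ r in (0 : ℝ)..t, P r) ^ n) volume 0 y :=
        (hP y hy.1).mul_continuousOn ((hΦ.continuousOn_uIcc le_rfl hy.1).pow n)
      calc s y ≤ ∫ t in (0 : ℝ)..y, P t * s t := hle y hy.1
        _ ≤ ∫ t in (0 : ℝ)..y, (M / (n.factorial : ℝ)) * (P t * (∫ r in (0 : ℝ)..t, P r) ^ n) := by
          refine intervalIntegral.integral_mono_on hy.1 ?_ (hi1.const_mul _) fun t ht => ?_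
          · exact (hP y hy.1).mul_continuousOn (hs.mono fun t ht => by
              rw [uIcc_of_le hy.1] at ht; exact ht.1)
          · have h1 := mul_le_mul_of_nonneg_left (ih t ⟨ht.1, ht.2.trans hy.2⟩) (hP0 t)
            refine h1.trans (le_of_eq ?_)
            ring
        _ = M * ((∫ t in (0 : ℝ)..y, P t) ^ (n + 1) / ((n + 1).factorial : ℝ)) := by
          have h2 := hpw.2
          rw [intervalIntegral.integral_const_mul] at h2
          simp only [intervalIntegral.integral_same, ne_eq, Nat.add_eq_zero_iff, one_ne_zero,
            and_false, not_false_eq_true, zero_pow, zero_add] at h2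
          rw [intervalIntegral.integral_const_mul, h2, Nat.factorial_succ]
          push_cast
          field_simp
  have hlim : Tendsto (fun n : ℕ => M * ((∫ t in (0 : ℝ)..x, P t) ^ n / (n.factorial : ℝ))) atTop
      (𝓝 (M * 0)) := (FloorSemiring.tendsto_pow_div_factorial_atTop _).const_mul M
  rw [mul_zero] at hlim
  exact le_antisymm (ge_of_tendsto' hlim fun n => key n x ⟨hx, le_rfl⟩) (hs0 x)

end Schrodinger

/-! ### Holomorphic dependence of integrals on a parameter. -/

/-- A dominated integral of holomorphic functions is holomorphic in the parameter. -/
theorem differentiableOn_integral_of_norm_le {α : Type*} [MeasurableSpace α] {μ : Measure α}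
    {U : Set ℂ} (hU : IsOpen U) {F : ℂ → α → ℂ} {b : α → ℝ} (hb : Integrable b μ)
    (hm : ∀ k ∈ U, AEStronglyMeasurable (F k) μ)
    (hd : ∀ᵐ t ∂μ, DifferentiableOn ℂ (fun k => F k t) U)
    (hF : ∀ᵐ t ∂μ, ∀ k ∈ U, ‖F k t‖ ≤ b t) :
    DifferentiableOn ℂ (fun k => ∫ t, F k t ∂μ) U := by
  intro k₀ hk₀
  obtain ⟨ε, hε, hball⟩ := Metric.isOpen_iff.1 hU k₀ hk₀
  set r := ε / 3 with hr
  have hr0 : 0 < r := by positivity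
  have hsub : ∀ k ∈ Metric.ball k₀ r, Metric.closedBall k r ⊆ U := by
    intro k hk z hz
    apply hball
    rw [Metric.mem_ball] at hk ⊢
    rw [Metric.mem_closedBall] at hz
    have := dist_triangle z k k₀
    linarith
  have hmem : ∀ k ∈ Metric.ball k₀ r, k ∈ U := fun k hk =>
    hsub k hk (Metric.mem_closedBall_self hr0.le)
  have hderiv : ∀ᵐ t ∂μ, ∀ k ∈ Metric.ball k₀ r,
      HasDerivAt (fun k => F k t) (deriv (fun k => F k t) k) k := by
    filter_upwards [hd] with t ht k hk
    exact (ht.differentiableAt (hU.mem_nhds (hmem k hk))).hasDerivAt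
  -- The derivative is measurable in `t` as a limit of difference quotients. The denominator `n + 2`
  -- keeps every increment, including the first, strictly shorter than `r`.
  have hmeas' : AEStronglyMeasurable (fun t => deriv (fun k => F k t) k₀) μ := by
    set h : ℕ → ℂ := fun n => ((r / (n + 2) : ℝ) : ℂ) with hh
    have hhn : ∀ n, ‖h n‖ < r := by
      intro n
      rw [hh, Complex.norm_of_nonneg (by positivity)]
      exact div_lt_self hr0 (by linarith [n.cast_nonneg (α := ℝ)])
    have hh0 : Tendsto h atTop (𝓝[≠] 0) := by
      rw [tendsto_nhdsWithin_iff]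
      constructor
      · have : Tendsto (fun n : ℕ => r / ((n : ℝ) + 2)) atTop (𝓝 0) :=
          (tendsto_atTop_add_const_right atTop (2 : ℝ) tendsto_natCast_atTop_atTop).const_div_atTop r
        have h2 := (Complex.continuous_ofReal.tendsto 0).comp this
        simpa [Function.comp_def, hh] using h2
      · refine Eventually.of_forall fun n => ?_
        have : (0 : ℝ) < r / (n + 2) := by positivity
        simpa only [hh, mem_compl_iff, mem_singleton_iff, Complex.ofReal_eq_zero] using this.ne'
    refine aestronglyMeasurable_of_tendsto_ae atTop
      (f := fun n t => (h n)⁻¹ * (F (k₀ + h n) t - F k₀ t)) (fun n => ?_) ?_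
    · refine ((hm _ (hmem _ ?_)).sub (hm _ hk₀)).const_mul _
      simpa using hhn n
    · filter_upwards [hderiv] with t ht
      have h1 := (ht k₀ (Metric.mem_ball_self hr0)).tendsto_slope_zero
      exact h1.comp hh0
  -- Cauchy's estimate on a circle of radius `r`: a bound for `F` alone dominates its derivative.
  -- The choice `r = ε / 3` keeps these circles inside `U`.
  have hbound : ∀ᵐ t ∂μ, ∀ k ∈ Metric.ball k₀ r, ‖deriv (fun k => F k t) k‖ ≤ b t / r := by
    filter_upwards [hd, hF] with t ht hFt k hk
    refine Complex.norm_deriv_le_of_forall_mem_sphere_norm_le hr0 ?_ fun z hz =>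
      hFt z (hsub k hk (Metric.sphere_subset_closedBall hz))
    refine (ht.mono ?_).diffContOnCl
    exact (Metric.closure_ball_subset_closedBall).trans (hsub k hk)
  have hint : Integrable (F k₀) μ := hb.mono' (hm k₀ hk₀) (hF.mono fun t ht => ht k₀ hk₀)
  have := (hasDerivAt_integral_of_dominated_loc_of_deriv_le (Metric.ball_mem_nhds k₀ hr0)
    ((hU.eventually_mem hk₀).mono hm) hint hmeas' hbound (hb.div_const r) hderiv).2
  exact this.differentiableAt.differentiableWithinAt

/-! ### The Volterra kernel and the Neumann series of the reduced Jost solution. -/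

namespace Schrodinger

/-- The integral of `exp (2 i k r)` over `[0, s]`. -/
noncomputable def kern (k : ℂ) (s : ℝ) : ℂ :=
  ∫ r in (0 : ℝ)..s, Complex.exp (2 * Complex.I * k * r)

theorem continuous_expKernel (k : ℂ) :
    Continuous fun r : ℝ => Complex.exp (2 * Complex.I * k * r) := by fun_prop

theorem norm_exp_I_mul (k : ℂ) (r : ℝ) :
    ‖Complex.exp (Complex.I * k * r)‖ = Real.exp (-k.im * r) := by
  rw [Complex.norm_exp]
  simp

theorem norm_exp_two_I_mul (k : ℂ) (r : ℝ) :
    ‖Complex.exp (2 * Complex.I * k * r)‖ = Real.exp (-2 * k.im * r) := by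
  rw [Complex.norm_exp]
  simp

theorem norm_exp_two_I_mul_le {k : ℂ} (hk : 0 ≤ k.im) {r : ℝ} (hr : 0 ≤ r) :
    ‖Complex.exp (2 * Complex.I * k * r)‖ ≤ 1 := by
  rw [norm_exp_two_I_mul, Real.exp_le_one_iff]
  nlinarith [mul_nonneg hk hr]

@[simp] theorem kern_zero_right (k : ℂ) : kern k 0 = 0 := by simp [kern]

/-- The exponential has modulus at most one on `[0, s]`. Unlike the quotient formula for `kern`, the
bound does not degenerate as `k → 0`; its price is the first moment of `q`. -/
theorem norm_kern_le {k : ℂ} (hk : 0 ≤ k.im) {s : ℝ} (hs : 0 ≤ s) : ‖kern k s‖ ≤ s := by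
  have h := intervalIntegral.norm_integral_le_of_norm_le_const (a := 0) (b := s) (C := 1)
    (f := fun r : ℝ => Complex.exp (2 * Complex.I * k * r)) fun r hr => by
      rw [uIoc_of_le hs] at hr
      exact norm_exp_two_I_mul_le hk hr.1.le
  simpa [kern, abs_of_nonneg hs] using h

theorem hasDerivAt_kern (k : ℂ) (s : ℝ) :
    HasDerivAt (kern k) (Complex.exp (2 * Complex.I * k * s)) s :=
  intervalIntegral.integral_hasDerivAt_right ((continuous_expKernel k).intervalIntegrable _ _)
    ((continuous_expKernel k).stronglyMeasurableAtFilter _ _) (continuous_expKernel k).continuousAt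

theorem continuous_kern (k : ℂ) : Continuous (kern k) :=
  continuous_iff_continuousAt.2 fun s => (hasDerivAt_kern k s).continuousAt

theorem kern_zero_left (s : ℝ) : kern 0 s = s := by simp [kern]

theorem kern_eq_div {k : ℂ} (hk : k ≠ 0) (s : ℝ) :
    kern k s = (Complex.exp (2 * Complex.I * k * s) - 1) / (2 * Complex.I * k) := by
  rw [kern, integral_exp_mul_complex (by simp [hk])]
  simp

theorem two_I_mul_kern (k : ℂ) (s : ℝ) :
    2 * Complex.I * k * kern k s = Complex.exp (2 * Complex.I * k * s) - 1 := by
  rcases eq_or_ne k 0 with rfl | hk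
  · simp
  · rw [kern_eq_div hk, mul_div_cancel₀]
    simp [hk]

/-- Splitting the integral at `-x` and translating separates `t` from `x`. The Volterra integral
then becomes a combination of tails, which can be differentiated in `x`. -/
theorem kern_sub (k : ℂ) (t x : ℝ) :
    kern k (t - x) = Complex.exp (-(2 * Complex.I * k * x)) * kern k t + kern k (-x) := by
  rcases eq_or_ne k 0 with rfl | hk
  · simp [kern_zero_left]; ring
  · have h : (2 * Complex.I * k) ≠ 0 := by simp [hk]
    apply mul_left_cancel₀ h
    rw [mul_add, mul_left_comm, two_I_mul_kern, two_I_mul_kern, two_I_mul_kern, mul_sub,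
      ← Complex.exp_add]
    push_cast
    rw [show -(2 * Complex.I * k * x) + 2 * Complex.I * k * t = 2 * Complex.I * k * (t - x) by ring,
      show 2 * Complex.I * k * -(x : ℂ) = -(2 * Complex.I * k * x) by ring]
    ring

theorem isOpen_upper : IsOpen {z : ℂ | 0 < z.im} := isOpen_lt continuous_const Complex.continuous_im

theorem differentiableOn_kern (s : ℝ) : DifferentiableOn ℂ (fun k => kern k s) {z : ℂ | 0 < z.im} := by
  have hne : ∀ k ∈ {z : ℂ | 0 < z.im}, k ≠ 0 := by
    rintro k hk rfl
    simp at hk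
  refine DifferentiableOn.congr (f := fun k : ℂ =>
    (Complex.exp (2 * Complex.I * k * s) - 1) / (2 * Complex.I * k)) ?_ fun k hk =>
      kern_eq_div (hne k hk) s
  refine DifferentiableOn.div (by fun_prop) (by fun_prop) fun k hk => ?_
  simp [hne k hk]

/-- Integrability of `q` on the half-line, with weight `1 + |x|`. -/
structure HalfLine (q : ℝ → ℂ) : Prop where
  int0 : IntegrableOn q (Ioi 0)
  int1 : IntegrableOn (fun t => |t| * ‖q t‖) (Ioi 0)

/-- The tail of the first moment of `q`. -/
noncomputable def gam (q : ℝ → ℂ) (x : ℝ) : ℝ := ∫ t in Ioi x, |t| * ‖q t‖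

/-- The terms of the Neumann series of the Volterra equation for the Jost solution. -/
noncomputable def jostIter (q : ℝ → ℂ) (k : ℂ) : ℕ → ℝ → ℂ
  | 0 => fun _ => 1
  | n + 1 => fun x => ∫ t in Ioi 0, kern k (max (t - x) 0) * (q t * jostIter q k n t)

/-- The Jost solution divided by `exp (i k x)`. -/
noncomputable def jostM (q : ℝ → ℂ) (k : ℂ) (x : ℝ) : ℂ := ∑' n, jostIter q k n x

variable {q : ℝ → ℂ} {k : ℂ}

theorem weight_nonneg (t : ℝ) : 0 ≤ |t| * ‖q t‖ := by positivity

theorem gam_nonneg (x : ℝ) : 0 ≤ gam q x := tail_nonneg weight_nonneg x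

theorem HalfLine.gam_anti (hq : HalfLine q) {x y : ℝ} (hx : 0 ≤ x) (hxy : x ≤ y) :
    gam q y ≤ gam q x := tail_anti hq.int1 weight_nonneg hx hxy

theorem norm_kern_max_le (hk : 0 ≤ k.im) {x t : ℝ} (hx : 0 ≤ x) (ht : 0 ≤ t) :
    ‖kern k (max (t - x) 0)‖ ≤ |t| :=
  (norm_kern_le hk (le_max_right _ _)).trans (by
    rw [abs_of_nonneg ht]; exact max_le (by linarith) ht)

theorem norm_kern_mul_le (hk : 0 ≤ k.im) {x t : ℝ} (hx : 0 ≤ x) (ht : 0 ≤ t) {z : ℂ} {c : ℝ}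
    (hz : ‖z‖ ≤ c) : ‖kern k (max (t - x) 0) * (q t * z)‖ ≤ |t| * ‖q t‖ * c := by
  rw [norm_mul, norm_mul, ← mul_assoc]
  have := norm_kern_max_le hk hx ht
  gcongr

theorem aestronglyMeasurable_kern_mul (hq : HalfLine q) {m : ℝ → ℂ} (hm : ContinuousOn m (Ici 0))
    (x : ℝ) : AEStronglyMeasurable (fun t => kern k (max (t - x) 0) * (q t * m t))
      (volume.restrict (Ioi 0)) := by
  refine AEStronglyMeasurable.mul ?_ (hq.int0.aestronglyMeasurable.mul
    ((hm.mono Ioi_subset_Ici_self).aestronglyMeasurable measurableSet_Ioi))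
  exact ((continuous_kern k).comp (by fun_prop)).aestronglyMeasurable

/-- Because `kern k 0 = 0`, the truncation `max (t - x) 0` makes the integral over `(0, ∞)` equal to
one over `(x, ∞)`. The fixed domain gives continuity by dominated convergence; returning to `(x, ∞)`
gives the bound through `integral_mul_tail_pow`. -/
theorem jostIter_spec (hq : HalfLine q) (hk : 0 ≤ k.im) (n : ℕ) :
    ContinuousOn (jostIter q k n) (Ici 0) ∧
      ∀ x, 0 ≤ x → ‖jostIter q k n x‖ ≤ gam q x ^ n / (n.factorial : ℝ) := by
  induction n with
  | zero =>
    refine ⟨continuousOn_const, fun x _ => ?_⟩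
    simp [jostIter]
  | succ n ih =>
    obtain ⟨hc, hb⟩ := ih
    have hint : IntegrableOn (fun t => |t| * ‖q t‖ * (gam q t ^ n / (n.factorial : ℝ))) (Ioi 0) := by
      have := (integrableOn_mul_tail_pow hq.int1 weight_nonneg n).div_const (n.factorial : ℝ)
      simpa only [mul_div_assoc] using! this
    have hle : ∀ x, 0 ≤ x → ∀ t ∈ Ioi (0 : ℝ), ‖kern k (max (t - x) 0) * (q t * jostIter q k n t)‖
        ≤ |t| * ‖q t‖ * (gam q t ^ n / (n.factorial : ℝ)) := fun x hx t ht =>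
      norm_kern_mul_le hk hx (le_of_lt ht) (hb t (le_of_lt ht))
    refine ⟨?_, fun x hx => ?_⟩
    · refine continuousOn_of_dominated
        (F := fun x t => kern k (max (t - x) 0) * (q t * jostIter q k n t))
        (fun x _ => aestronglyMeasurable_kern_mul hq hc x)
        (fun x hx => (ae_restrict_iff' measurableSet_Ioi).2 (Eventually.of_forall (hle x hx))) hint
        (Eventually.of_forall fun t => ?_)
      exact (((continuous_kern k).comp (by fun_prop)).mul continuous_const).continuousOn
    · calc ‖jostIter q k (n + 1) x‖
          ≤ ∫ t in Ioi 0, (Ioi x).indicator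
              (fun t => |t| * ‖q t‖ * (gam q t ^ n / (n.factorial : ℝ))) t := by
            refine norm_integral_le_of_norm_le (hint.indicator measurableSet_Ioi) ?_
            refine (ae_restrict_iff' measurableSet_Ioi).2 (Eventually.of_forall fun t ht => ?_)
            by_cases htx : x < t
            · rw [indicator_of_mem (show t ∈ Ioi x from htx)]
              exact hle x hx t ht
            · rw [indicator_of_notMem (show t ∉ Ioi x from htx),
                max_eq_right (by linarith), kern_zero_right, zero_mul, norm_zero]
        _ = gam q x ^ (n + 1) / ((n + 1).factorial : ℝ) := by
            rw [setIntegral_indicator measurableSet_Ioi, Ioi_inter_Ioi, max_eq_right hx]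
            simp only [← mul_div_assoc]
            rw [integral_div]
            have := integral_mul_tail_pow hq.int1 weight_nonneg n hx
            unfold gam
            rw [this, Nat.factorial_succ]
            push_cast
            rw [div_div, mul_comm ((n : ℝ) + 1)]

theorem differentiableOn_jostIter (hq : HalfLine q) (n : ℕ) {x : ℝ} (hx : 0 ≤ x) :
    DifferentiableOn ℂ (fun k => jostIter q k n x) {z : ℂ | 0 < z.im} := by
  induction n generalizing x with
  | zero => exact differentiableOn_const _
  | succ n ih =>
    refine differentiableOn_integral_of_norm_le isOpen_upper
      (b := fun t => |t| * ‖q t‖ * (gam q 0 ^ n / (n.factorial : ℝ))) (hq.int1.mul_const _)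
      (fun k hk => ?_) ?_ ?_
    · exact aestronglyMeasurable_kern_mul hq (jostIter_spec hq (le_of_lt hk) n).1 x
    · refine (ae_restrict_iff' measurableSet_Ioi).2 (Eventually.of_forall fun t ht => ?_)
      exact (differentiableOn_kern _).mul ((ih (le_of_lt ht)).const_mul _)
    · refine (ae_restrict_iff' measurableSet_Ioi).2 (Eventually.of_forall fun t ht k hk => ?_)
      refine norm_kern_mul_le (le_of_lt hk) hx (le_of_lt ht) ?_
      refine ((jostIter_spec hq (le_of_lt hk) n).2 t (le_of_lt ht)).trans ?_
      have := hq.gam_anti le_rfl (le_of_lt ht)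
      have h0 := gam_nonneg (q := q) t
      gcongr

theorem hasSum_exp (y : ℝ) : HasSum (fun n : ℕ => y ^ n / (n.factorial : ℝ)) (Real.exp y) := by
  rw [Real.exp_eq_exp_ℝ]
  exact NormedSpace.expSeries_div_hasSum_exp y

theorem summable_jostIter (hq : HalfLine q) (hk : 0 ≤ k.im) {x : ℝ} (hx : 0 ≤ x) :
    Summable fun n => ‖jostIter q k n x‖ :=
  Summable.of_nonneg_of_le (fun _ => norm_nonneg _) (fun n => (jostIter_spec hq hk n).2 x hx)
    (hasSum_exp (gam q x)).summable

theorem norm_jostM_le (hq : HalfLine q) (hk : 0 ≤ k.im) {x : ℝ} (hx : 0 ≤ x) :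
    ‖jostM q k x‖ ≤ Real.exp (gam q x) :=
  tsum_of_norm_bounded (hasSum_exp (gam q x)) fun n => (jostIter_spec hq hk n).2 x hx

theorem norm_jostM_sub_one_le (hq : HalfLine q) (hk : 0 ≤ k.im) {x : ℝ} (hx : 0 ≤ x) :
    ‖jostM q k x - 1‖ ≤ Real.exp (gam q x) - 1 := by
  have h1 : jostM q k x - 1 = ∑' n, jostIter q k (n + 1) x := by
    rw [jostM, (summable_jostIter hq hk hx).of_norm.tsum_eq_zero_add]
    simp [jostIter]
  have h2 := (hasSum_nat_add_iff' 1).2 (hasSum_exp (gam q x))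
  simp only [Finset.range_one, Finset.sum_singleton, pow_zero, Nat.factorial_zero, Nat.cast_one,
    div_one] at h2
  rw [h1]
  exact tsum_of_norm_bounded h2 fun n => (jostIter_spec hq hk (n + 1)).2 x hx

theorem continuousOn_jostM (hq : HalfLine q) (hk : 0 ≤ k.im) :
    ContinuousOn (jostM q k) (Ici 0) := by
  refine continuousOn_tsum (fun n => (jostIter_spec hq hk n).1) (hasSum_exp (gam q 0)).summable
    fun n x hx => ((jostIter_spec hq hk n).2 x hx).trans ?_
  have := hq.gam_anti le_rfl hx
  have h0 := gam_nonneg (q := q) x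
  gcongr

theorem differentiableOn_jostM (hq : HalfLine q) {x : ℝ} (hx : 0 ≤ x) :
    DifferentiableOn ℂ (fun k => jostM q k x) {z : ℂ | 0 < z.im} :=
  Complex.differentiableOn_tsum_of_summable_norm (hasSum_exp (gam q x)).summable
    (fun n => differentiableOn_jostIter hq n hx) isOpen_upper
    fun n _ hk => (jostIter_spec hq (le_of_lt hk) n).2 x hx

/-- The defining recursion of the iterates is summed under the integral sign, with the exponential
series as majorant. -/
theorem jostM_eq (hq : HalfLine q) (hk : 0 ≤ k.im) {x : ℝ} (hx : 0 ≤ x) :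
    jostM q k x = 1 + ∫ t in Ioi x, kern k (t - x) * (q t * jostM q k t) := by
  have h1 : jostM q k x = 1 + ∑' n, jostIter q k (n + 1) x := by
    rw [jostM, (summable_jostIter hq hk hx).of_norm.tsum_eq_zero_add]
    simp [jostIter]
  have h2 : HasSum (fun n => jostIter q k (n + 1) x)
      (∫ t in Ioi 0, kern k (max (t - x) 0) * (q t * jostM q k t)) := by
    refine hasSum_integral_of_dominated_convergence
      (fun n t => |t| * ‖q t‖ * (gam q 0 ^ n / (n.factorial : ℝ)))
      (fun n => aestronglyMeasurable_kern_mul hq (jostIter_spec hq hk n).1 x) (fun n => ?_)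
      (Eventually.of_forall fun t => (hasSum_exp (gam q 0)).summable.mul_left _) ?_ ?_
    · refine (ae_restrict_iff' measurableSet_Ioi).2 (Eventually.of_forall fun t ht => ?_)
      refine norm_kern_mul_le hk hx (le_of_lt ht) ?_
      refine ((jostIter_spec hq hk n).2 t (le_of_lt ht)).trans ?_
      have := hq.gam_anti le_rfl (le_of_lt ht)
      have h0 := gam_nonneg (q := q) t
      gcongr
    · simp only [tsum_mul_left]
      exact hq.int1.mul_const _
    · refine (ae_restrict_iff' measurableSet_Ioi).2 (Eventually.of_forall fun t ht => ?_)
      exact ((summable_jostIter hq hk (le_of_lt ht)).of_norm.hasSum.mul_left _).mul_left _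
  rw [h1, h2.tsum_eq]
  congr 1
  have h3 : ∫ t in Ioi 0, kern k (max (t - x) 0) * (q t * jostM q k t)
      = ∫ t in Ioi 0, (Ioi x).indicator (fun t => kern k (t - x) * (q t * jostM q k t)) t := by
    refine setIntegral_congr_fun measurableSet_Ioi fun t _ => ?_
    by_cases htx : x < t
    · rw [indicator_of_mem (show t ∈ Ioi x from htx), max_eq_left (by linarith)]
    · rw [indicator_of_notMem (show t ∉ Ioi x from htx), max_eq_right (by linarith),
        kern_zero_right, zero_mul]
  rw [h3, setIntegral_indicator measurableSet_Ioi, Ioi_inter_Ioi, max_eq_right hx]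

end Schrodinger

/-! ### Uniqueness for the Cauchy problem, then the Jost solution and its derivative. -/

namespace Schrodinger

variable {q : ℝ → ℂ} {k : ℂ}

/-- The Cauchy problem on the half-line for a linear second-order equation with locally integrable
coefficient has at most one solution. -/
theorem eq_zero_of_cauchy_data {u v r : ℝ → ℂ} (hu : HasPrim u v)
    (hv : HasPrim v fun t => r t * u t) (hr : ∀ x, 0 ≤ x → IntervalIntegrable r volume 0 x)
    (hu0 : u 0 = 0) (hv0 : v 0 = 0) {x : ℝ} (hx : 0 ≤ x) : u x = 0 ∧ v x = 0 := by
  have hP : ∀ x, 0 ≤ x → IntervalIntegrable (fun t => 1 + ‖r t‖) volume 0 x := fun x hx =>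
    intervalIntegrable_const.add (hr x hx).norm
  have hs : ContinuousOn (fun t => ‖u t‖ + ‖v t‖) (Ici 0) :=
    hu.continuousOn.norm.add hv.continuousOn.norm
  have h := eq_zero_of_le_integral (s := fun t => ‖u t‖ + ‖v t‖) (P := fun t => 1 + ‖r t‖)
    hs hP (fun t => by positivity) (fun x hx => ?_) (fun x => by positivity) hx
  · constructor
    · exact norm_le_zero_iff.1 (by linarith [norm_nonneg (v x)])
    · exact norm_le_zero_iff.1 (by linarith [norm_nonneg (u x)])
  · have h1 : ‖u x‖ ≤ ∫ t in (0 : ℝ)..x, ‖v t‖ := by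
      rw [(hu x hx).2, hu0, zero_add]
      exact intervalIntegral.norm_integral_le_integral_norm hx
    have h2 : ‖v x‖ ≤ ∫ t in (0 : ℝ)..x, ‖r t * u t‖ := by
      rw [(hv x hx).2, hv0, zero_add]
      exact intervalIntegral.norm_integral_le_integral_norm hx
    have hsub : uIcc 0 x ⊆ Ici 0 := by
      rw [uIcc_of_le hx]; exact Icc_subset_Ici_self
    calc ‖u x‖ + ‖v x‖ ≤ (∫ t in (0 : ℝ)..x, ‖v t‖) + ∫ t in (0 : ℝ)..x, ‖r t * u t‖ :=
          add_le_add h1 h2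
      _ = ∫ t in (0 : ℝ)..x, (‖v t‖ + ‖r t * u t‖) :=
          (intervalIntegral.integral_add (hu x hx).1.norm (hv x hx).1.norm).symm
      _ ≤ ∫ t in (0 : ℝ)..x, (1 + ‖r t‖) * (‖u t‖ + ‖v t‖) := by
          refine intervalIntegral.integral_mono_on hx ((hu x hx).1.norm.add (hv x hx).1.norm)
            ((hP x hx).mul_continuousOn (hs.mono hsub)) fun t _ => ?_
          rw [norm_mul]
          nlinarith [norm_nonneg (u t), norm_nonneg (v t), norm_nonneg (r t),
            mul_nonneg (norm_nonneg (r t)) (norm_nonneg (v t))]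

/-! ### The Jost solution -/

/-- The product of the potential with the reduced Jost solution. -/
noncomputable def jostN (q : ℝ → ℂ) (k : ℂ) (t : ℝ) : ℂ := q t * jostM q k t

/-- The tail of the Fourier integral of `jostN`. -/
noncomputable def jostR (q : ℝ → ℂ) (k : ℂ) (x : ℝ) : ℂ :=
  ∫ t in Ioi x, Complex.exp (2 * Complex.I * k * t) * jostN q k t

/-- The Jost solution of `-f'' + q f = k² f` on the half-line, asymptotic to `exp (i k x)`. -/
noncomputable def jostF (q : ℝ → ℂ) (k : ℂ) (x : ℝ) : ℂ :=
  Complex.exp (Complex.I * k * x) * jostM q k x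

/-- The derivative of the Jost solution. -/
noncomputable def jostG (q : ℝ → ℂ) (k : ℂ) (x : ℝ) : ℂ :=
  Complex.I * k * jostF q k x - Complex.exp (-(Complex.I * k * x)) * jostR q k x

theorem norm_jostM_le_exp_gam_zero (hq : HalfLine q) (hk : 0 ≤ k.im) {x : ℝ} (hx : 0 ≤ x) :
    ‖jostM q k x‖ ≤ Real.exp (gam q 0) :=
  (norm_jostM_le hq hk hx).trans (Real.exp_le_exp.2 (hq.gam_anti le_rfl hx))

theorem aestronglyMeasurable_jostN (hq : HalfLine q) (hk : 0 ≤ k.im) :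
    AEStronglyMeasurable (jostN q k) (volume.restrict (Ioi 0)) :=
  hq.int0.aestronglyMeasurable.mul (((continuousOn_jostM hq hk).mono
    Ioi_subset_Ici_self).aestronglyMeasurable measurableSet_Ioi)

theorem norm_jostN_le (hq : HalfLine q) (hk : 0 ≤ k.im) {t : ℝ} (ht : 0 ≤ t) :
    ‖jostN q k t‖ ≤ ‖q t‖ * Real.exp (gam q 0) := by
  rw [jostN, norm_mul]
  have := norm_jostM_le_exp_gam_zero hq hk ht
  gcongr

theorem integrableOn_jostN (hq : HalfLine q) (hk : 0 ≤ k.im) :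
    IntegrableOn (jostN q k) (Ioi 0) :=
  (hq.int0.norm.mul_const _).mono' (aestronglyMeasurable_jostN hq hk)
    ((ae_restrict_iff' measurableSet_Ioi).2 (Eventually.of_forall fun _ ht =>
      norm_jostN_le hq hk (le_of_lt ht)))

theorem integrableOn_exp_mul_jostN (hq : HalfLine q) (hk : 0 ≤ k.im) :
    IntegrableOn (fun t : ℝ => Complex.exp (2 * Complex.I * k * t) * jostN q k t) (Ioi 0) :=
  (integrableOn_jostN hq hk).bdd_mul (c := 1)
    (continuous_expKernel k).aestronglyMeasurable
    ((ae_restrict_iff' measurableSet_Ioi).2 (Eventually.of_forall fun _ ht =>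
      norm_exp_two_I_mul_le hk (le_of_lt ht)))

theorem integrableOn_kern_mul_jostN (hq : HalfLine q) (hk : 0 ≤ k.im) :
    IntegrableOn (fun t : ℝ => kern k t * jostN q k t) (Ioi 0) := by
  refine (hq.int1.mul_const (Real.exp (gam q 0))).mono'
    ((continuous_kern k).aestronglyMeasurable.mul (aestronglyMeasurable_jostN hq hk))
    ((ae_restrict_iff' measurableSet_Ioi).2 (Eventually.of_forall fun t ht => ?_))
  rw [norm_mul, mul_assoc]
  have h1 := norm_kern_le hk (le_of_lt ht)
  have h2 := norm_jostN_le hq hk (le_of_lt ht)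
  rw [abs_of_pos ht]
  exact mul_le_mul h1 h2 (norm_nonneg _) (le_of_lt ht)

theorem norm_integral_jostN_le (hq : HalfLine q) (hk : 0 ≤ k.im) :
    ∫ t in Ioi 0, ‖jostN q k t‖ ≤ (∫ t in Ioi 0, ‖q t‖) * Real.exp (gam q 0) := by
  rw [← integral_mul_const]
  exact setIntegral_mono_on (integrableOn_jostN hq hk).norm (hq.int0.norm.mul_const _)
    measurableSet_Ioi fun t ht => norm_jostN_le hq hk (le_of_lt ht)

/-- `kern_sub` turns the Volterra equation into an expression in two tails whose integrands do not
depend on `x`. -/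
theorem jostM_eq_tails (hq : HalfLine q) (hk : 0 ≤ k.im) {x : ℝ} (hx : 0 ≤ x) :
    jostM q k x = 1 + (Complex.exp (-(2 * Complex.I * k * x)) *
      (∫ t in Ioi x, kern k t * jostN q k t) + kern k (-x) * ∫ t in Ioi x, jostN q k t) := by
  rw [jostM_eq hq hk hx, ← integral_const_mul, ← integral_const_mul, ← integral_add]
  · congr 2
    ext t
    rw [kern_sub, jostN]
    ring
  · exact ((integrableOn_kern_mul_jostN hq hk).mono_set (Ioi_subset_Ioi hx)).const_mul _
  · exact ((integrableOn_jostN hq hk).mono_set (Ioi_subset_Ioi hx)).const_mul _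

theorem jostR_eq_tails (hq : HalfLine q) (hk : 0 ≤ k.im) {x : ℝ} (hx : 0 ≤ x) :
    jostR q k x = (∫ t in Ioi x, jostN q k t) +
      2 * Complex.I * k * ∫ t in Ioi x, kern k t * jostN q k t := by
  rw [jostR, ← integral_const_mul, ← integral_add]
  · congr 1
    ext t
    rw [← mul_assoc, two_I_mul_kern]
    ring
  · exact (integrableOn_jostN hq hk).mono_set (Ioi_subset_Ioi hx)
  · exact ((integrableOn_kern_mul_jostN hq hk).mono_set (Ioi_subset_Ioi hx)).const_mul _

theorem hasDerivAt_exp_mul (c : ℂ) (x : ℝ) :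
    HasDerivAt (fun x : ℝ => Complex.exp (c * x)) (c * Complex.exp (c * x)) x := by
  have h := ((hasDerivAt_id (x : ℂ)).const_mul c).cexp.comp_ofReal
  simpa [mul_comm] using h

theorem hasPrim_exp_mul (c : ℂ) :
    HasPrim (fun x : ℝ => Complex.exp (c * x)) (fun x => c * Complex.exp (c * x)) :=
  HasPrim.of_hasDerivAt (hasDerivAt_exp_mul c) (by fun_prop)

theorem hasPrim_kern_neg (k : ℂ) :
    HasPrim (fun x : ℝ => kern k (-x)) (fun x => -Complex.exp (-(2 * Complex.I * k) * x)) := by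
  refine HasPrim.of_hasDerivAt (fun x => ?_) (by fun_prop)
  have h := (hasDerivAt_kern k (-x)).scomp x (hasDerivAt_neg x)
  simpa [Function.comp_def] using h

/-- The product rule is applied to `jostM_eq_tails`. The two contributions containing the integrand
`jostN q k x` itself cancel, since `kern k (x - x) = 0`; what remains is `jostG` once `jostR` is
written in tails. -/
theorem hasPrim_jostF (hq : HalfLine q) (hk : 0 ≤ k.im) :
    HasPrim (jostF q k) (jostG q k) := by
  have hP := HasPrim.tail (integrableOn_kern_mul_jostN hq hk)
  have hQ := HasPrim.tail (integrableOn_jostN hq hk)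
  have hE := hasPrim_exp_mul (Complex.I * k)
  have hE' := hasPrim_exp_mul (-(Complex.I * k))
  have h := (hE.add (hE'.mul hP)).add ((hE.mul (hasPrim_kern_neg k)).mul hQ)
  have hee : ∀ x : ℝ, Complex.exp (Complex.I * k * x) * Complex.exp (-(2 * Complex.I * k) * x)
      = Complex.exp (-(Complex.I * k) * x) := fun x => by
    rw [← Complex.exp_add]; congr 1; ring
  have hF : ∀ x : ℝ, 0 ≤ x → jostF q k x = Complex.exp (Complex.I * k * x)
      + Complex.exp (-(Complex.I * k) * x) * (∫ t in Ioi x, kern k t * jostN q k t)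
      + Complex.exp (Complex.I * k * x) * kern k (-x) * ∫ t in Ioi x, jostN q k t := by
    intro x hx
    rw [jostF, jostM_eq_tails hq hk hx, ← hee x]
    rw [show -(2 * Complex.I * k) * (x : ℂ) = -(2 * Complex.I * k * x) by ring]
    ring
  refine (h.congr_left fun x hx => (hF x hx).symm).congr fun x hx => ?_
  -- This is `kern_sub` at `t = x`.
  have hk0 : kern k (-x) = -(Complex.exp (-(2 * Complex.I * k) * x) * kern k x) := by
    have := kern_sub k x x
    rw [sub_self, kern_zero_right] at this
    rw [show -(2 * Complex.I * k) * (x : ℂ) = -(2 * Complex.I * k * x) by ring]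
    linear_combination -this
  rw [jostG, hF x hx.le, jostR_eq_tails hq hk hx.le,
    show -(Complex.I * k * (x : ℂ)) = -(Complex.I * k) * x by ring, ← hee x, hk0]
  ring

theorem hasPrim_jostG (hq : HalfLine q) (hk : 0 ≤ k.im) :
    HasPrim (jostG q k) (fun t => (q t - k ^ 2) * jostF q k t) := by
  have hR := HasPrim.tail (integrableOn_exp_mul_jostN hq hk)
  have hE' := hasPrim_exp_mul (-(Complex.I * k))
  have h := ((hasPrim_jostF hq hk).const_mul (Complex.I * k)).sub (hE'.mul hR)
  refine (h.congr_left fun x _ => ?_).congr fun x _ => ?_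
  · rw [jostG, jostR, neg_mul]
  · have hee : Complex.exp (Complex.I * k * x) =
        Complex.exp (-(Complex.I * k) * x) * Complex.exp (2 * Complex.I * k * x) := by
      rw [← Complex.exp_add]; congr 1; ring
    have e1 : jostG q k x = Complex.I * k * jostF q k x -
      Complex.exp (-(Complex.I * k) * x) *
        ∫ t in Ioi x, Complex.exp (2 * Complex.I * k * t) * jostN q k t := by
      rw [jostG, jostR, neg_mul]
    rw [e1, jostN, jostF, hee]
    linear_combination (Complex.exp (-(Complex.I * k) * x) * Complex.exp (2 * Complex.I * k * x)
      * jostM q k x * k ^ 2) * Complex.I_sq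

theorem norm_jostF_le (hq : HalfLine q) (hk : 0 ≤ k.im) {x : ℝ} (hx : 0 ≤ x) :
    ‖jostF q k x‖ ≤ Real.exp (gam q 0) * Real.exp (-k.im * x) := by
  rw [jostF, norm_mul, norm_exp_I_mul, mul_comm]
  have := norm_jostM_le_exp_gam_zero hq hk hx
  gcongr

/-- On `(x, ∞)` the exponential is at most its value at `x`. The resulting decay at twice the rate
compensates the growing factor in front of `jostR` in `jostG`. -/
theorem norm_jostR_le (hq : HalfLine q) (hk : 0 ≤ k.im) {x : ℝ} (hx : 0 ≤ x) :
    ‖jostR q k x‖ ≤ Real.exp (-2 * k.im * x) * ((∫ t in Ioi 0, ‖q t‖) * Real.exp (gam q 0)) := by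
  have hN : IntegrableOn (fun t => ‖jostN q k t‖) (Ioi 0) := (integrableOn_jostN hq hk).norm
  have hNx : IntegrableOn (fun t => ‖jostN q k t‖) (Ioi x) := hN.mono_set (Ioi_subset_Ioi hx)
  calc ‖jostR q k x‖ ≤ ∫ t in Ioi x, Real.exp (-2 * k.im * x) * ‖jostN q k t‖ := by
        refine norm_integral_le_of_norm_le (hNx.const_mul _) ((ae_restrict_iff'
          measurableSet_Ioi).2 (Eventually.of_forall fun t ht => ?_))
        rw [norm_mul, norm_exp_two_I_mul]
        have h1 : -2 * k.im * t ≤ -2 * k.im * x := by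
          have : x < t := ht
          nlinarith
        gcongr
    _ ≤ Real.exp (-2 * k.im * x) * ((∫ t in Ioi 0, ‖q t‖) * Real.exp (gam q 0)) := by
        rw [integral_const_mul]
        refine mul_le_mul_of_nonneg_left ?_ (Real.exp_nonneg _)
        refine le_trans ?_ (norm_integral_jostN_le hq hk)
        exact setIntegral_mono_set hN (Eventually.of_forall fun _ => norm_nonneg _)
          (Ioi_subset_Ioi hx).eventuallyLE

theorem norm_jostG_le (hq : HalfLine q) (hk : 0 ≤ k.im) {x : ℝ} (hx : 0 ≤ x) :
    ‖jostG q k x‖ ≤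
      (‖k‖ + ∫ t in Ioi 0, ‖q t‖) * Real.exp (gam q 0) * Real.exp (-k.im * x) := by
  have h1 := norm_jostF_le hq hk hx
  have h2 := norm_jostR_le hq hk hx
  have h3 : ‖Complex.exp (-(Complex.I * k * x))‖ = Real.exp (k.im * x) := by
    rw [Complex.norm_exp]; simp
  have h4 : Real.exp (k.im * x) * Real.exp (-2 * k.im * x) = Real.exp (-k.im * x) := by
    rw [← Real.exp_add]; congr 1; ring
  calc ‖jostG q k x‖ ≤ ‖k‖ * ‖jostF q k x‖ + Real.exp (k.im * x) * ‖jostR q k x‖ := by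
        rw [jostG]
        refine (norm_sub_le _ _).trans (le_of_eq ?_)
        rw [norm_mul, norm_mul, norm_mul, Complex.norm_I, one_mul, h3]
    _ ≤ ‖k‖ * (Real.exp (gam q 0) * Real.exp (-k.im * x)) + Real.exp (k.im * x) *
          (Real.exp (-2 * k.im * x) * ((∫ t in Ioi 0, ‖q t‖) * Real.exp (gam q 0))) := by
        gcongr
    _ = _ := by
        rw [← mul_assoc (Real.exp (k.im * x)), h4]
        ring

theorem HalfLine.intervalIntegrable (hq : HalfLine q) {x : ℝ} (hx : 0 ≤ x) :
    IntervalIntegrable q volume 0 x :=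
  (intervalIntegrable_iff_integrableOn_Ioc_of_le hx).2 (hq.int0.mono_set Ioc_subset_Ioi_self)

theorem tendsto_norm_jostM (hq : HalfLine q) (hk : 0 ≤ k.im) :
    Tendsto (fun x => ‖jostM q k x‖) atTop (𝓝 1) := by
  have h1 : Tendsto (fun x => Real.exp (gam q x) - 1) atTop (𝓝 0) := by
    have := (Real.continuous_exp.tendsto 0).comp (tendsto_tail hq.int1)
    simpa [gam, Function.comp_def] using this.sub_const 1
  have h2 : Tendsto (fun x => jostM q k x - 1) atTop (𝓝 0) :=
    squeeze_zero_norm' ((eventually_ge_atTop 0).mono fun x hx =>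
      norm_jostM_sub_one_le hq hk hx) h1
  have h3 : Tendsto (fun x => jostM q k x) atTop (𝓝 1) := by simpa using h2.add_const 1
  simpa using h3.norm

/-- Zero data would make the Jost solution vanish identically, contradicting `|jostM| → 1`. -/
theorem jost_cauchy_data_ne_zero (hq : HalfLine q) (hk : 0 ≤ k.im) :
    ¬ (jostF q k 0 = 0 ∧ jostG q k 0 = 0) := by
  rintro ⟨h1, h2⟩
  have h0 : ∀ x, 0 ≤ x → jostM q k x = 0 := by
    intro x hx
    have := (eq_zero_of_cauchy_data (hasPrim_jostF hq hk) (hasPrim_jostG hq hk)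
      (fun x hx => (hq.intervalIntegrable hx).sub intervalIntegrable_const) h1 h2 hx).1
    rw [jostF] at this
    exact (mul_eq_zero.1 this).resolve_left (Complex.exp_ne_zero _)
  have h3 := tendsto_norm_jostM hq hk
  have h4 : Tendsto (fun x => ‖jostM q k x‖) atTop (𝓝 0) :=
    tendsto_const_nhds.congr' ((eventually_ge_atTop 0).mono fun x hx => by simp [h0 x hx])
  exact one_ne_zero (tendsto_nhds_unique h3 h4)

theorem jostF_zero : jostF q k 0 = jostM q k 0 := by simp [jostF]

theorem jostG_zero : jostG q k 0 = Complex.I * k * jostM q k 0 - jostR q k 0 := by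
  simp [jostG, jostF]

theorem differentiableOn_jostR_zero (hq : HalfLine q) :
    DifferentiableOn ℂ (fun k => jostR q k 0) {z : ℂ | 0 < z.im} := by
  refine differentiableOn_integral_of_norm_le isOpen_upper
    (b := fun t => ‖q t‖ * Real.exp (gam q 0)) (hq.int0.norm.mul_const _)
    (fun k hk => (integrableOn_exp_mul_jostN hq (le_of_lt hk)).aestronglyMeasurable) ?_ ?_
  · refine (ae_restrict_iff' measurableSet_Ioi).2 (Eventually.of_forall fun t ht => ?_)
    refine DifferentiableOn.mul (by fun_prop) ?_
    exact (differentiableOn_jostM hq (le_of_lt ht)).const_mul _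
  · refine (ae_restrict_iff' measurableSet_Ioi).2 (Eventually.of_forall fun t ht k hk => ?_)
    rw [norm_mul]
    refine (mul_le_of_le_one_left (norm_nonneg _)
      (norm_exp_two_I_mul_le (le_of_lt hk) (le_of_lt ht))).trans ?_
    exact norm_jostN_le hq (le_of_lt hk) (le_of_lt ht)

/-- The data at `0` that enter the Wronskian of two Jost solutions. -/
theorem two_I_mul_jostM_zero (hq : HalfLine q) (hk : 0 ≤ k.im) :
    2 * Complex.I * k * (jostM q k 0 - 1) = jostR q k 0 - ∫ t in Ioi 0, jostN q k t := by
  rw [jostR_eq_tails hq hk le_rfl, jostM_eq_tails hq hk le_rfl]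
  simp

theorem norm_integral_jostN_sub_le (hq : HalfLine q) (hk : 0 ≤ k.im) :
    ‖(∫ t in Ioi 0, jostN q k t) - ∫ t in Ioi 0, q t‖ ≤
      (∫ t in Ioi 0, ‖q t‖) * (Real.exp (gam q 0) - 1) := by
  rw [← integral_sub (integrableOn_jostN hq hk) hq.int0, ← integral_mul_const]
  refine norm_integral_le_of_norm_le (hq.int0.norm.mul_const _) ((ae_restrict_iff'
    measurableSet_Ioi).2 (Eventually.of_forall fun t ht => ?_))
  rw [jostN, ← mul_sub_one, norm_mul]
  refine mul_le_mul_of_nonneg_left ?_ (norm_nonneg _)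
  refine (norm_jostM_sub_one_le hq hk (le_of_lt ht)).trans ?_
  have := hq.gam_anti le_rfl (le_of_lt ht)
  gcongr

end Schrodinger

/-! ### Vanishing of the Wronskian of a square integrable function at infinity. -/

namespace Schrodinger

variable {q : ℝ → ℂ} {k : ℂ}

/-- This polynomial vanishes at `X` and `X + 1` and has integral one between them. Averaging the
Wronskian against it allows an integration by parts without boundary terms. -/
theorem hasPrim_cutoff (X : ℝ) :
    HasPrim (fun t : ℝ => (6 * (t - X) * (X + 1 - t) : ℂ)) (fun t => (6 * (2 * X + 1 - 2 * t) : ℂ)) := by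
  refine HasPrim.of_hasDerivAt (fun x => ?_) (by fun_prop)
  have h1 : HasDerivAt (fun t : ℝ => (t : ℂ)) 1 x := Complex.ofRealCLM.hasDerivAt
  have h2 := ((h1.sub_const (X : ℂ)).const_mul 6).mul (h1.const_sub ((X : ℂ) + 1))
  refine h2.congr_deriv ?_
  ring

theorem integral_cutoff (X : ℝ) :
    ∫ t in X..X + 1, (6 * (t - X) * (X + 1 - t) : ℂ) = 1 := by
  have hd : ∀ x : ℝ, HasDerivAt (fun t : ℝ => (3 * (t - X) ^ 2 - 2 * (t - X) ^ 3 : ℂ))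
      (6 * (x - X) * (X + 1 - x) : ℂ) x := by
    intro x
    have h1 : HasDerivAt (fun t : ℝ => (t : ℂ) - X) 1 x :=
      (Complex.ofRealCLM.hasDerivAt (x := x)).sub_const _
    refine (((h1.pow 2).const_mul 3).sub ((h1.pow 3).const_mul 2)).congr_deriv ?_
    norm_num
    ring
  rw [intervalIntegral.integral_eq_sub_of_hasDerivAt (fun x _ => hd x)
    (Continuous.intervalIntegrable (by fun_prop) _ _)]
  push_cast
  ring

/-- The Wronskian `u g - v f` of a square integrable function `u` and a function `f` that is
bounded together with its derivative has no boundary term at infinity. -/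
theorem wronskian_zero_eq_integral {u v v' f g r : ℝ → ℂ} {C : ℝ} (hu : HasPrim u v)
    (hv : HasPrim v v') (hu2 : IntegrableOn (fun t => ‖u t‖ ^ 2) (Ioi 0)) (hf : HasPrim f g)
    (hgc : ContinuousOn g (Ici 0)) (hfC : ∀ t, 0 ≤ t → ‖f t‖ ≤ C) (hgC : ∀ t, 0 ≤ t → ‖g t‖ ≤ C)
    (hW : HasPrim (fun t => u t * g t - v t * f t) fun t => -r t) (hr : IntegrableOn r (Ioi 0)) :
    u 0 * g 0 - v 0 * f 0 = ∫ t in Ioi 0, r t := by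
  -- `L` is the limit of the Wronskian at infinity; the claim is `L = 0`.
  set L := u 0 * g 0 - v 0 * f 0 - ∫ t in Ioi 0, r t with hL
  have hC : 0 ≤ C := (norm_nonneg _).trans (hfC 0 le_rfl)
  have hWL : ∀ t, 0 ≤ t → u t * g t - v t * f t = L + ∫ s in Ioi t, r s := by
    intro t ht
    have h := (hW t ht).2
    rw [intervalIntegral.integral_neg] at h
    rw [setIntegral_Ioi_eq_sub hr ht, hL]
    linear_combination h
  have hrn : IntegrableOn (fun t => ‖r t‖) (Ioi 0) := hr.norm
  have key : ∀ δ : ℝ, 0 < δ → ∀ X : ℝ, 0 ≤ X → ‖L‖ ≤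
      30 * C * (δ + (∫ t in Ioi X, ‖u t‖ ^ 2) / δ) + 6 * ∫ t in Ioi X, ‖r t‖ := by
    intro δ hδ X hX
    have hX1 : 0 ≤ X + 1 := by linarith
    have hXX : X ≤ X + 1 := by linarith
    have hsub : Icc X (X + 1) ⊆ Ici 0 := fun t ht => hX.trans ht.1
    set χ : ℝ → ℂ := fun t => 6 * (t - X) * (X + 1 - t) with hχ
    set χ' : ℝ → ℂ := fun t => 6 * (2 * X + 1 - 2 * t) with hχ'
    have hχn : ∀ t ∈ Icc X (X + 1), ‖χ t‖ ≤ 6 := by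
      intro t ht
      have : χ t = ((6 * (t - X) * (X + 1 - t) : ℝ) : ℂ) := by simp [hχ]
      rw [this, Complex.norm_real, Real.norm_eq_abs, abs_le]
      constructor <;> nlinarith [ht.1, ht.2, mul_nonneg (sub_nonneg.2 ht.1) (sub_nonneg.2 ht.2)]
    have hχn' : ∀ t ∈ Icc X (X + 1), ‖χ' t‖ ≤ 6 := by
      intro t ht
      have : χ' t = ((6 * (2 * X + 1 - 2 * t) : ℝ) : ℂ) := by simp [hχ']
      rw [this, Complex.norm_real, Real.norm_eq_abs, abs_le]
      constructor <;> linarith [ht.1, ht.2]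
    have hci : ∀ {F : ℝ → ℂ}, ContinuousOn F (Ici 0) →
        IntervalIntegrable F volume X (X + 1) := fun hF =>
      (hF.mono (by rw [uIcc_of_le hXX]; exact hsub)).intervalIntegrable
    have hcχ : ContinuousOn χ (Ici 0) := (hasPrim_cutoff X).continuousOn
    have hcχ' : ContinuousOn χ' (Ici 0) := by fun_prop
    have hcu := hu.continuousOn
    have hcv := hv.continuousOn
    have hcf := hf.continuousOn
    -- The derivative `v` is not known to decay. Integrating by parts against the cutoff replaces `χ
    -- v f` by terms that contain only `u`.
    have hparts := ((hasPrim_cutoff X).mul (hu.mul hf)).sub_eq hX hX1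
    have hzero : ∫ t in X..X + 1, (χ' t * (u t * f t) + χ t * (v t * f t + u t * g t)) = 0 := by
      rw [← hparts]; simp
    have hsplit : ∫ t in X..X + 1, χ t * (u t * g t - v t * f t) =
        ∫ t in X..X + 1, u t * (2 * (χ t * g t) + χ' t * f t) := by
      rw [← sub_eq_zero, ← neg_eq_zero, ← hzero, ← intervalIntegral.integral_sub,
        ← intervalIntegral.integral_neg]
      · congr 1
        ext t
        ring
      · exact hci (by fun_prop)
      · exact hci (by fun_prop)
    have hbound1 : ‖∫ t in X..X + 1, u t * (2 * (χ t * g t) + χ' t * f t)‖ ≤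
        30 * C * (δ + (∫ t in Ioi X, ‖u t‖ ^ 2) / δ) := by
      have hptw : ∀ t ∈ Icc X (X + 1), ‖u t * (2 * (χ t * g t) + χ' t * f t)‖ ≤
          30 * C * (δ + ‖u t‖ ^ 2 / δ) := by
        intro t ht
        have ht0 : 0 ≤ t := hX.trans ht.1
        have h1 : ‖2 * (χ t * g t) + χ' t * f t‖ ≤ 18 * C := by
          refine (norm_add_le _ _).trans ?_
          rw [norm_mul, norm_mul (χ t), norm_mul (χ' t), Complex.norm_ofNat]
          have a1 := mul_le_mul (hχn t ht) (hgC t ht0) (norm_nonneg _) (by norm_num)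
          have a2 := mul_le_mul (hχn' t ht) (hfC t ht0) (norm_nonneg _) (by norm_num)
          linarith
        -- This trades the modulus of `u` for its square, the quantity with small tails. Later `X →
        -- ∞` is taken first and `δ → 0` second; the constant `30` is not sharp.
        have h2 : ‖u t‖ ≤ δ + ‖u t‖ ^ 2 / δ := by
          rcases le_total ‖u t‖ δ with h | h
          · have : 0 ≤ ‖u t‖ ^ 2 / δ := by positivity
            linarith
          · have : ‖u t‖ ≤ ‖u t‖ ^ 2 / δ := by
              rw [le_div_iff₀ hδ]; nlinarith [norm_nonneg (u t)]
            linarith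
        rw [norm_mul]
        calc ‖u t‖ * ‖2 * (χ t * g t) + χ' t * f t‖ ≤ (δ + ‖u t‖ ^ 2 / δ) * (18 * C) := by
              gcongr
          _ ≤ 30 * C * (δ + ‖u t‖ ^ 2 / δ) := by
              have : 0 ≤ C * (δ + ‖u t‖ ^ 2 / δ) := by positivity
              nlinarith
      have hu2i : IntervalIntegrable (fun t => ‖u t‖ ^ 2) volume X (X + 1) :=
        ((hcu.norm.pow 2).mono (by rw [uIcc_of_le hXX]; exact hsub)).intervalIntegrable
      calc _ ≤ ∫ t in X..X + 1, 30 * C * (δ + ‖u t‖ ^ 2 / δ) := by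
            refine intervalIntegral.norm_integral_le_of_norm_le hXX ?_ ?_
            · exact Eventually.of_forall fun t ht => hptw t (Ioc_subset_Icc_self ht)
            · exact (intervalIntegrable_const.add (hu2i.div_const δ)).const_mul _
        _ = 30 * C * (δ + (∫ t in X..X + 1, ‖u t‖ ^ 2) / δ) := by
            rw [intervalIntegral.integral_const_mul,
              intervalIntegral.integral_add intervalIntegrable_const (hu2i.div_const δ),
              intervalIntegral.integral_div, intervalIntegral.integral_const]
            simp
        _ ≤ _ := by
            have : ∫ t in X..X + 1, ‖u t‖ ^ 2 ≤ ∫ t in Ioi X, ‖u t‖ ^ 2 := by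
              rw [intervalIntegral.integral_of_le hXX]
              exact setIntegral_mono_set (hu2.mono_set (Ioi_subset_Ioi hX))
                (Eventually.of_forall fun _ => by positivity) Ioc_subset_Ioi_self.eventuallyLE
            gcongr
    have hcr : ContinuousOn (fun t => ∫ s in Ioi t, r s) (Ici 0) := (HasPrim.tail hr).continuousOn
    have hLeq : L = (∫ t in X..X + 1, χ t * (u t * g t - v t * f t)) -
        ∫ t in X..X + 1, χ t * ∫ s in Ioi t, r s := by
      rw [← intervalIntegral.integral_sub (hci (by fun_prop)) (hci (by fun_prop))]
      have : ∫ t in X..X + 1, (χ t * (u t * g t - v t * f t) - χ t * ∫ s in Ioi t, r s) =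
          ∫ t in X..X + 1, χ t * L := by
        refine intervalIntegral.integral_congr fun t ht => ?_
        rw [uIcc_of_le hXX] at ht
        simp only [hWL t (hX.trans ht.1)]
        ring
      rw [this, intervalIntegral.integral_mul_const, integral_cutoff, one_mul]
    have hbound2 : ‖∫ t in X..X + 1, χ t * ∫ s in Ioi t, r s‖ ≤ 6 * ∫ t in Ioi X, ‖r t‖ := by
      have := intervalIntegral.norm_integral_le_of_norm_le_const (a := X) (b := X + 1)
        (C := 6 * ∫ t in Ioi X, ‖r t‖) (f := fun t => χ t * ∫ s in Ioi t, r s) fun t ht => by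
          rw [uIoc_of_le hXX] at ht
          have ht' := Ioc_subset_Icc_self ht
          rw [norm_mul]
          refine mul_le_mul (hχn t ht') ?_ (norm_nonneg _) (by norm_num)
          exact (norm_integral_le_integral_norm _).trans
            (tail_anti hrn (fun _ => norm_nonneg _) hX ht.1.le)
      simpa using this
    rw [hLeq, hsplit]
    exact (norm_sub_le _ _).trans (add_le_add hbound1 hbound2)
  have hlim : ∀ δ : ℝ, 0 < δ → ‖L‖ ≤ 30 * C * δ := by
    intro δ hδ
    have h1 : Tendsto (fun X : ℝ => 30 * C * (δ + (∫ t in Ioi X, ‖u t‖ ^ 2) / δ) +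
        6 * ∫ t in Ioi X, ‖r t‖) atTop (𝓝 (30 * C * (δ + 0 / δ) + 6 * 0)) :=
      ((((tendsto_tail hu2).div_const δ).const_add δ).const_mul _).add
        ((tendsto_tail hrn).const_mul 6)
    simp only [zero_div, add_zero, mul_zero] at h1
    exact ge_of_tendsto h1 ((eventually_ge_atTop 0).mono fun X hX => key δ hδ X hX)
  have hL0 : ‖L‖ ≤ 0 := by
    have h1 : Tendsto (fun δ : ℝ => 30 * C * δ) (𝓝[>] 0) (𝓝 (30 * C * 0)) :=
      (tendsto_id.const_mul (30 * C)).mono_left nhdsWithin_le_nhds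
    rw [mul_zero] at h1
    refine ge_of_tendsto h1 ?_
    filter_upwards [self_mem_nhdsWithin] with δ hδ using hlim δ hδ
  exact sub_eq_zero.1 (norm_le_zero_iff.1 hL0)

/-! ### The Wronskian of the Jost solutions of the two half-lines -/

/-- The reflection of a potential. -/
def refl (q : ℝ → ℂ) (x : ℝ) : ℂ := q (-x)

/-- The Wronskian at `0` of the Jost solutions at `-∞` and `+∞`. -/
noncomputable def jostW (q : ℝ → ℂ) (k : ℂ) : ℂ :=
  jostF (refl q) k 0 * jostG q k 0 + jostG (refl q) k 0 * jostF q k 0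

/-- Terms in which `k` multiplies `jostM - 1` are eliminated by `two_I_mul_jostM_zero`. After that
only `2ik` is unbounded in `k`. -/
theorem jostW_eq {p : ℝ → ℂ} (hq : HalfLine q) (hp : HalfLine p) (hk : 0 ≤ k.im) :
    jostF p k 0 * jostG q k 0 + jostG p k 0 * jostF q k 0 = 2 * Complex.I * k
      - (∫ t in Ioi 0, jostN q k t) - (∫ t in Ioi 0, jostN p k t)
      - (jostM p k 0 - 1) * (∫ t in Ioi 0, jostN q k t)
      - (jostM q k 0 - 1) * jostR p k 0 := by
  have h1 := two_I_mul_jostM_zero hq hk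
  have h2 := two_I_mul_jostM_zero hp hk
  rw [jostF_zero, jostF_zero, jostG_zero, jostG_zero]
  linear_combination h1 * jostM p k 0 + h2

/-- With `a, b` the norms of `q, p` and `α, β` their first moments, the four errors are `a(e^α -
1)`, `b(e^β - 1)`, `(e^β - 1) a e^α` and `(e^α - 1) b e^β`. Their sum is exactly `(a + b)(e^(α+β) -
1)`, so the moments of the two half-lines recombine into that of the whole line. -/
theorem norm_wronskian_sub_le {p : ℝ → ℂ} (hq : HalfLine q) (hp : HalfLine p) (hk : 0 ≤ k.im) :
    ‖jostF p k 0 * jostG q k 0 + jostG p k 0 * jostF q k 0 - 2 * Complex.I * k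
      + ((∫ t in Ioi 0, q t) + ∫ t in Ioi 0, p t)‖ ≤
      ((∫ t in Ioi 0, ‖q t‖) + ∫ t in Ioi 0, ‖p t‖) * (Real.exp (gam q 0 + gam p 0) - 1) := by
  have e : jostF p k 0 * jostG q k 0 + jostG p k 0 * jostF q k 0 - 2 * Complex.I * k
      + ((∫ t in Ioi 0, q t) + ∫ t in Ioi 0, p t) =
      -((∫ t in Ioi 0, jostN q k t) - ∫ t in Ioi 0, q t)
      - ((∫ t in Ioi 0, jostN p k t) - ∫ t in Ioi 0, p t)
      - (jostM p k 0 - 1) * (∫ t in Ioi 0, jostN q k t)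
      - (jostM q k 0 - 1) * jostR p k 0 := by
    rw [jostW_eq hq hp hk]; ring
  have b1 := norm_integral_jostN_sub_le hq hk
  have b2 := norm_integral_jostN_sub_le hp hk
  have b3 : ‖∫ t in Ioi 0, jostN q k t‖ ≤ (∫ t in Ioi 0, ‖q t‖) * Real.exp (gam q 0) :=
    (norm_integral_le_integral_norm _).trans (norm_integral_jostN_le hq hk)
  have b4 : ‖jostR p k 0‖ ≤ (∫ t in Ioi 0, ‖p t‖) * Real.exp (gam p 0) := by
    simpa using norm_jostR_le hp hk le_rfl
  have b5 := norm_jostM_sub_one_le hp hk le_rfl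
  have b6 := norm_jostM_sub_one_le hq hk le_rfl
  have c1 := mul_le_mul b5 b3 (norm_nonneg _) ((norm_nonneg _).trans b5)
  have c2 := mul_le_mul b6 b4 (norm_nonneg _) ((norm_nonneg _).trans b6)
  rw [← norm_mul] at c1 c2
  rw [e, Real.exp_add]
  refine (norm_sub_le _ _).trans ?_
  refine (add_le_add_left ((norm_sub_le _ _).trans (add_le_add_left (norm_sub_le _ _) _)) _).trans ?_
  rw [norm_neg]
  linarith

theorem differentiableOn_jostF_zero (hq : HalfLine q) :
    DifferentiableOn ℂ (fun k => jostF q k 0) {z : ℂ | 0 < z.im} := by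
  simpa only [jostF_zero] using differentiableOn_jostM hq le_rfl

theorem differentiableOn_jostG_zero (hq : HalfLine q) :
    DifferentiableOn ℂ (fun k => jostG q k 0) {z : ℂ | 0 < z.im} := by
  simp only [jostG_zero]
  exact (DifferentiableOn.mul (by fun_prop) (differentiableOn_jostM hq le_rfl)).sub
    (differentiableOn_jostR_zero hq)

/-- The hypothesis on the potential on the whole line. -/
structure FullLine (q : ℝ → ℂ) : Prop where
  int0 : Integrable q
  int1 : Integrable fun t => |t| * ‖q t‖

theorem FullLine.of_weight (hq : AEStronglyMeasurable q volume)
    (hint : Integrable (fun x : ℝ => (1 + |x|) * ‖q x‖) volume) : FullLine q := by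
  constructor
  · refine hint.mono' hq (Eventually.of_forall fun x => ?_)
    nlinarith [norm_nonneg (q x), abs_nonneg x, mul_nonneg (abs_nonneg x) (norm_nonneg (q x))]
  · refine hint.mono' (continuous_abs.aestronglyMeasurable.mul hq.norm)
      (Eventually.of_forall fun x => ?_)
    rw [Real.norm_of_nonneg (by positivity)]
    nlinarith [norm_nonneg (q x)]

theorem FullLine.refl (hq : FullLine q) : FullLine (refl q) := by
  constructor
  · exact hq.int0.comp_neg
  · have := hq.int1.comp_neg
    simpa [Schrodinger.refl] using this

theorem FullLine.halfLine (hq : FullLine q) : HalfLine q :=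
  ⟨hq.int0.integrableOn, hq.int1.integrableOn⟩

theorem setIntegral_Ioi_add_comp_neg {E : Type*} [NormedAddCommGroup E] [NormedSpace ℝ E]
    {f : ℝ → E} (hf : Integrable f) :
    (∫ t in Ioi (0 : ℝ), f t) + ∫ t in Ioi (0 : ℝ), f (-t) = ∫ t, f t := by
  rw [integral_comp_neg_Ioi, neg_zero, add_comm, ← compl_Iic,
    integral_add_compl measurableSet_Iic hf]

theorem differentiableOn_jostW (hq : FullLine q) :
    DifferentiableOn ℂ (jostW q) {z : ℂ | 0 < z.im} :=
  ((differentiableOn_jostF_zero hq.refl.halfLine).mul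
    (differentiableOn_jostG_zero hq.halfLine)).add
    ((differentiableOn_jostG_zero hq.refl.halfLine).mul (differentiableOn_jostF_zero hq.halfLine))

/-- The two half-line bounds combine into `‖q‖ (exp ‖q‖₁ - 1)`, and `e^y - 1 ≤ y e^y` turns this
into `A`. Both statements of (ii) and the boundedness of the set of zeros rest on this estimate. -/
theorem norm_jostW_sub_le (hq : FullLine q) (hk : 0 ≤ k.im) :
    ‖jostW q k - 2 * Complex.I * k + ∫ t, q t‖ ≤ constA q := by
  have h := norm_wronskian_sub_le hq.halfLine hq.refl.halfLine hk
  have e1 := setIntegral_Ioi_add_comp_neg hq.int0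
  have e2 := setIntegral_Ioi_add_comp_neg hq.int0.norm
  have e3 : gam q 0 + gam (refl q) 0 = norm1 q := by
    have := setIntegral_Ioi_add_comp_neg hq.int1
    simpa [gam, norm1, refl] using this
  simp only [refl] at h
  rw [e1, e2] at h
  refine h.trans ?_
  rw [e3, constA, norm0, mul_assoc]
  refine mul_le_mul_of_nonneg_left ?_ (integral_nonneg fun _ => norm_nonneg _)
  -- Multiplying `1 - y ≤ e^(-y)` by `e^y` gives `e^y - 1 ≤ y e^y`.
  have h2 := Real.add_one_le_exp (-norm1 q)
  have h3 : Real.exp (-norm1 q) * Real.exp (norm1 q) = 1 := by rw [← Real.exp_add]; simp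
  nlinarith [Real.exp_pos (norm1 q)]

end Schrodinger

/-! ### Removing Blaschke factors from a bounded holomorphic function. -/

section BlaschkeBound

theorem sub_conj_ne_zero {z κ : ℂ} (hz : 0 < z.im) (hκ : 0 < κ.im) : z - conj κ ≠ 0 := by
  intro h
  have := congrArg Complex.im h
  simp at this
  linarith

theorem norm_sub_sq_eq_norm_sub_conj_sq (z κ : ℂ) :
    ‖z - κ‖ ^ 2 = ‖z - conj κ‖ ^ 2 - 4 * z.im * κ.im := by
  rw [← Complex.normSq_eq_norm_sq, ← Complex.normSq_eq_norm_sq, Complex.normSq_apply,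
    Complex.normSq_apply]
  simp
  ring

/-- Dividing a bounded holomorphic function on the upper half-plane by a Blaschke factor at one of
its zeros does not increase its bound. -/
theorem norm_mul_le_of_norm_mul_le {κ : ℂ} (hκ : 0 < κ.im) {h : ℂ → ℂ} {M : ℝ}
    (hd : DifferentiableOn ℂ h {z | 0 < z.im})
    (hM : ∀ z : ℂ, 0 < z.im → ‖(z - κ) * h z‖ ≤ M) {z : ℂ} (hz : 0 < z.im) :
    ‖(z - conj κ) * h z‖ ≤ M := by
  -- `ψ` maps the unit disc onto the half-plane with `ψ 0 = κ`; its inverse is the Blaschke factor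
  -- of `κ`. The assertion becomes Schwarz's lemma on the disc.
  set ψ : ℂ → ℂ := fun ζ => (κ - conj κ * ζ) / (1 - ζ) with hψ
  have hne : ∀ ζ ∈ Metric.ball (0 : ℂ) 1, 1 - ζ ≠ 0 := by
    intro ζ hζ h0
    rw [mem_ball_zero_iff] at hζ
    have : ζ = 1 := (sub_eq_zero.1 h0).symm
    rw [this, norm_one] at hζ
    exact lt_irrefl _ hζ
  have him : ∀ ζ ∈ Metric.ball (0 : ℂ) 1, 0 < (ψ ζ).im := by
    intro ζ hζ
    have h1 := Complex.normSq_pos.2 (hne ζ hζ)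
    have h2 : Complex.normSq ζ < 1 := by
      rw [mem_ball_zero_iff] at hζ
      rw [Complex.normSq_eq_norm_sq]
      nlinarith [norm_nonneg ζ]
    have h3 : (ψ ζ).im = κ.im * (1 - Complex.normSq ζ) / Complex.normSq (1 - ζ) := by
      rw [hψ]
      simp only [Complex.div_im, Complex.normSq_apply ζ]
      simp
      field_simp
      ring
    rw [h3]
    exact div_pos (mul_pos hκ (by linarith)) h1
  have hψd : DifferentiableOn ℂ ψ (Metric.ball 0 1) :=
    DifferentiableOn.div (by fun_prop) (by fun_prop) hne
  have hFd : DifferentiableOn ℂ (fun ζ => (ψ ζ - κ) * h (ψ ζ)) (Metric.ball 0 1) :=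
    (hψd.sub_const κ).mul (hd.comp hψd him)
  have h0 : (ψ 0 - κ) * h (ψ 0) = 0 := by simp [hψ]
  have hSch : ∀ ζ ∈ Metric.ball (0 : ℂ) 1, ‖(ψ ζ - κ) * h (ψ ζ)‖ ≤ M * ‖ζ‖ := by
    intro ζ hζ
    have := Complex.dist_le_div_mul_dist_of_mapsTo_ball (R₂ := M) hFd (fun ξ hξ => by
      simp only [h0, mem_closedBall_zero_iff]
      exact hM _ (him ξ hξ)) hζ
    simpa [h0] using this
  have hoff : ∀ w : ℂ, 0 < w.im → w ≠ κ → ‖(w - conj κ) * h w‖ ≤ M := by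
    intro w hw hwκ
    have hc := sub_conj_ne_zero hw hκ
    set ζ := (w - κ) / (w - conj κ) with hζ
    have hζn : ‖ζ‖ < 1 := by
      rw [hζ, norm_div, div_lt_one (norm_pos_iff.2 hc)]
      have := norm_sub_sq_eq_norm_sub_conj_sq w κ
      have h4 := mul_pos hw hκ
      exact lt_of_pow_lt_pow_left₀ 2 (norm_nonneg _) (by nlinarith)
    have hκc : κ - conj κ ≠ 0 := sub_conj_ne_zero hκ hκ
    have hψζ : ψ ζ = w := by
      have h1 : 1 - ζ = (κ - conj κ) / (w - conj κ) := by rw [hζ]; field_simp; ring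
      rw [hψ]
      simp only
      rw [h1, hζ]
      field_simp
      ring
    have h5 := hSch ζ (mem_ball_zero_iff.2 hζn)
    rw [hψζ] at h5
    have hwk : 0 < ‖w - κ‖ := norm_pos_iff.2 (sub_ne_zero.2 hwκ)
    have hwc : 0 < ‖w - conj κ‖ := norm_pos_iff.2 hc
    rw [hζ, norm_div, norm_mul, ← mul_div_assoc, le_div_iff₀ hwc] at h5
    rw [norm_mul]
    have : ‖w - κ‖ * (‖w - conj κ‖ * ‖h w‖) ≤ ‖w - κ‖ * M := by linarith
    exact le_of_mul_le_mul_left this hwk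
  -- At `κ` the factor cannot be cancelled, and the bound follows from nearby points by continuity.
  by_cases hzκ : z = κ
  · have hc : ContinuousAt (fun w => ‖(w - conj κ) * h w‖) z :=
      ((continuousAt_id.sub continuousAt_const).mul
        (hd.differentiableAt (Schrodinger.isOpen_upper.mem_nhds hz)).continuousAt).norm
    have h1 : Tendsto (fun w => ‖(w - conj κ) * h w‖) (𝓝[≠] z) (𝓝 ‖(z - conj κ) * h z‖) :=
      hc.tendsto.mono_left nhdsWithin_le_nhds
    refine le_of_tendsto h1 ?_
    filter_upwards [self_mem_nhdsWithin, mem_nhdsWithin_of_mem_nhds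
      (Schrodinger.isOpen_upper.mem_nhds hz)] with w hw1 hw2
    exact hoff w hw2 (by rw [← hzκ]; exact hw1)
  · exact hoff z hz hzκ

/-- A bounded holomorphic function on the upper half-plane is dominated by the finite Blaschke
products over its zeros. -/
theorem norm_le_mul_prod_blaschke (l : Multiset ℂ) (hl : ∀ κ ∈ l, 0 < κ.im) {f : ℂ → ℂ} {M : ℝ}
    (hd : DifferentiableOn ℂ f {z | 0 < z.im}) (hM : ∀ z : ℂ, 0 < z.im → ‖f z‖ ≤ M)
    (hord : ∀ κ ∈ l, (l.count κ : ℕ∞) ≤ analyticOrderAt f κ) {z : ℂ} (hz : 0 < z.im) :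
    ‖f z‖ ≤ M * (l.map fun κ => ‖(z - κ) / (z - conj κ)‖).prod := by
  have hU := Schrodinger.isOpen_upper
  induction l using Multiset.induction_on generalizing f with
  | empty => simpa using hM z hz
  | cons κ l ih =>
    have hκ : 0 < κ.im := hl κ (by simp)
    have hfκ : AnalyticAt ℂ f κ := hd.analyticAt (hU.mem_nhds hκ)
    have hord1 := hord κ (by simp)
    rw [Multiset.count_cons_self] at hord1
    have hf0 : f κ = 0 := by
      by_contra hne
      rw [(hfκ.analyticOrderAt_eq_zero).2 hne] at hord1
      simp at hord1
    set h := dslope f κ with hh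
    have hhd : DifferentiableOn ℂ h {z | 0 < z.im} :=
      (Complex.differentiableOn_dslope (hU.mem_nhds hκ)).2 hd
    have hfac : f = fun w => (w - κ) * h w := by
      ext w
      have := sub_smul_dslope f κ w
      rw [hf0, sub_zero, smul_eq_mul] at this
      exact this.symm
    have hM' : ∀ w : ℂ, 0 < w.im → ‖(w - conj κ) * h w‖ ≤ M := fun w hw =>
      norm_mul_le_of_norm_mul_le hκ hhd (fun w hw => by
        have := hM w hw
        rwa [hfac] at this) hw
    -- The induction runs on `f` with one factor `w - κ` exchanged for `w - conj κ`, which has the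
    -- same bound `M`.
    have key := ih (f := fun w => (w - conj κ) * h w) (fun κ' h' => hl κ' (by simp [h']))
      (DifferentiableOn.mul (by fun_prop) hhd) hM' ?_
    · rw [Multiset.map_cons, Multiset.prod_cons, hfac]
      have hc := sub_conj_ne_zero hz hκ
      have e : (z - κ) * h z = (z - κ) / (z - conj κ) * ((z - conj κ) * h z) := by
        field_simp
      simp only [e]
      rw [norm_mul]
      calc _ ≤ ‖(z - κ) / (z - conj κ)‖ *
            (M * (l.map fun κ => ‖(z - κ) / (z - conj κ)‖).prod) := by gcongr
        _ = _ := by ring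
    -- Dividing by `w - κ` costs one order at `κ`, just as the multiset loses one copy of `κ`, and
    -- costs nothing elsewhere.
    · intro κ' hκ'
      have hκ'im : 0 < κ'.im := hl κ' (by simp [hκ'])
      have hha : AnalyticAt ℂ h κ' := hhd.analyticAt (hU.mem_nhds hκ'im)
      have ha1 : AnalyticAt ℂ (fun w => w - κ) κ' := by fun_prop
      have ha2 : AnalyticAt ℂ (fun w => w - conj κ) κ' := by fun_prop
      have o1 : analyticOrderAt f κ' = analyticOrderAt (fun w => w - κ) κ' +
          analyticOrderAt h κ' := by
        conv_lhs => rw [hfac]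
        exact analyticOrderAt_mul ha1 hha
      have o2 : analyticOrderAt (fun w => (w - conj κ) * h w) κ' =
          analyticOrderAt (fun w => w - conj κ) κ' + analyticOrderAt h κ' :=
        analyticOrderAt_mul ha2 hha
      have ho := hord κ' (by simp [hκ'])
      rw [o2]
      refine le_trans ?_ le_add_self
      rw [o1] at ho
      by_cases hkk : κ' = κ
      · subst hkk
        have o3 : analyticOrderAt (fun w => w - κ') κ' = 1 := by
          refine (ha1.analyticOrderAt_eq_natCast (n := 1)).2 ⟨fun _ => 1, by fun_prop, by simp, ?_⟩
          simp
        rw [o3, Multiset.count_cons_self, Nat.cast_add, Nat.cast_one, add_comm] at ho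
        exact (ENat.add_le_add_iff_left (by simp)).1 ho
      · have o3 : analyticOrderAt (fun w => w - κ) κ' = 0 :=
          (ha1.analyticOrderAt_eq_zero).2 (sub_ne_zero.2 hkk)
        rw [o3, zero_add, Multiset.count_cons_of_ne hkk] at ho
        exact ho

end BlaschkeBound

/-! ### Existence, uniqueness and simplicity of a fixed point, by the maximum principle. -/

section SingleZero

variable {c : ℂ} {R ρ : ℝ} {φ : ℂ → ℂ}

/-- A function with positive real part on a circle has positive real part inside. -/
theorem re_pos_of_re_pos_on_sphere {G : ℂ → ℂ} (hR : 0 < R)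
    (hG : DifferentiableOn ℂ G (Metric.closedBall c R))
    (hpos : ∀ z ∈ Metric.sphere c R, 0 < (G z).re) {z : ℂ} (hz : z ∈ Metric.closedBall c R) :
    0 < (G z).re := by
  have hne : (Metric.sphere c R).Nonempty := NormedSpace.sphere_nonempty.2 hR.le
  have hcont : ContinuousOn (fun z => (G z).re) (Metric.sphere c R) :=
    Complex.continuous_re.comp_continuousOn (hG.continuousOn.mono Metric.sphere_subset_closedBall)
  obtain ⟨z₀, hz₀, hmin⟩ := (isCompact_sphere c R).exists_isMinOn hne hcont
  have hd : DiffContOnCl ℂ (fun z => Complex.exp (-G z)) (Metric.ball c R) := by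
    have : DifferentiableOn ℂ (fun z => Complex.exp (-G z)) (Metric.closedBall c R) := hG.neg.cexp
    exact ⟨this.mono Metric.ball_subset_closedBall, by
      rw [closure_ball c hR.ne']; exact this.continuousOn⟩
  -- The modulus of `exp (-G)` is `exp (-Re G)`, so the maximum principle bounds `Re G` below by its
  -- minimum on the circle; that minimum is attained, hence positive.
  have h := Complex.norm_le_of_forall_mem_frontier_norm_le (C := Real.exp (-(G z₀).re))
    Metric.isBounded_ball hd (fun w hw => by
      rw [frontier_ball c hR.ne'] at hw
      rw [Complex.norm_exp, Complex.neg_re]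
      exact Real.exp_le_exp.2 (neg_le_neg (hmin hw))) (by rwa [closure_ball c hR.ne'])
  rw [Complex.norm_exp, Complex.neg_re, Real.exp_le_exp, neg_le_neg_iff] at h
  exact (hpos z₀ hz₀).trans_le h

theorem div_re_pos_of_norm_sub_le {a b : ℂ} (hρ : ρ < R) (hb : ‖b‖ = R) (hab : ‖a - b‖ ≤ ρ) :
    0 < (a * conj b).re := by
  have h1 : (a * conj b).re = ((a - b) * conj b).re + ‖b‖ ^ 2 := by
    rw [← Complex.normSq_eq_norm_sq, Complex.normSq_apply]
    simp
    ring
  have h2 : |((a - b) * conj b).re| ≤ ‖a - b‖ * ‖b‖ := by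
    refine (Complex.abs_re_le_norm _).trans ?_
    rw [norm_mul, Complex.norm_conj]
  have h3 := (abs_le.1 h2).1
  have hρ0 : 0 ≤ ρ := (norm_nonneg _).trans hab
  have h4 : ‖a - b‖ * ‖b‖ ≤ ρ * R := by rw [hb]; gcongr; linarith
  rw [h1, hb]
  nlinarith

/-- A holomorphic map of a closed disc into a smaller concentric one has a fixed point. -/
theorem exists_fixedPoint (hρ : ρ < R)
    (hφd : DifferentiableOn ℂ φ (Metric.closedBall c R))
    (hφ : ∀ z ∈ Metric.closedBall c R, ‖φ z - c‖ ≤ ρ) (hR : 0 < R) :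
    ∃ a ∈ Metric.closedBall c R, a - φ a = 0 := by
  by_contra! hne
  -- Without a fixed point this quotient is holomorphic with positive real part on the circle, yet
  -- it vanishes at the centre.
  have hG : DifferentiableOn ℂ (fun z => (z - c) / (z - φ z)) (Metric.closedBall c R) :=
    DifferentiableOn.div (by fun_prop) (differentiableOn_id.sub hφd) hne
  have hpos : ∀ z ∈ Metric.sphere c R, 0 < ((z - c) / (z - φ z)).re := by
    intro z hz
    have hz' := Metric.sphere_subset_closedBall hz
    have hb : ‖z - c‖ = R := by simpa [dist_eq_norm] using hz
    have h1 := div_re_pos_of_norm_sub_le (a := z - φ z) (b := z - c) hρ hb (by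
      rw [show z - φ z - (z - c) = -(φ z - c) by ring, norm_neg]; exact hφ z hz')
    have h2 : ((z - c) / (z - φ z)).re =
        ((z - φ z) * conj (z - c)).re / Complex.normSq (z - φ z) := by
      rw [Complex.div_re]
      simp
      ring
    rw [h2]
    exact div_pos h1 (Complex.normSq_pos.2 (hne z hz'))
  have := re_pos_of_re_pos_on_sphere hR hG hpos (Metric.mem_closedBall_self hR.le)
  simp at this

/-- The fixed point of a holomorphic map of a closed disc into a smaller concentric one is unique
and it is a simple zero of `z - φ z`. -/
theorem dslope_ne_zero_of_fixedPoint (hρ : ρ < R)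
    (hφd : DifferentiableOn ℂ φ (Metric.closedBall c R))
    (hφ : ∀ z ∈ Metric.closedBall c R, ‖φ z - c‖ ≤ ρ) {a : ℂ} (ha : a ∈ Metric.ball c R) (hfix : a - φ a = 0)
    {z : ℂ} (hz : z ∈ Metric.closedBall c R) : dslope (fun z => z - φ z) a z ≠ 0 := by
  have hR : 0 < R := dist_nonneg.trans_lt (Metric.mem_ball.1 ha)
  have hR2 : ((R : ℂ)) ^ 2 ≠ 0 := by
    have : (R : ℂ) ≠ 0 := by exact_mod_cast hR.ne'
    exact pow_ne_zero 2 this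
  set K := dslope (fun z => z - φ z) a with hK
  have hKd : DifferentiableOn ℂ K (Metric.closedBall c R) :=
    (Complex.differentiableOn_dslope (Metric.closedBall_mem_nhds_of_mem ha)).2
      (differentiableOn_id.sub hφd)
  have hfac : ∀ w, w - φ w = (w - a) * K w := by
    intro w
    have := sub_smul_dslope (fun z => z - φ z) a w
    simp only [hfix, sub_zero, smul_eq_mul] at this
    exact this.symm
  -- On the circle `(w - a) conj (w - c) = R² conj (l w)`, while `l` has no zero in the closed disc
  -- because `a` is interior. So `l` stands in for the factor `w - a`, and `K / l` inherits the
  -- positive real part of `(w - φ w) conj (w - c)` on the circle.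
  set l : ℂ → ℂ := fun z => 1 - conj (a - c) * (z - c) / (R : ℂ) ^ 2 with hl
  have hlne : ∀ w ∈ Metric.closedBall c R, l w ≠ 0 := by
    intro w hw h0
    have h1 : conj (a - c) * (w - c) = (R : ℂ) ^ 2 := by
      rw [hl] at h0
      simp only at h0
      rw [sub_eq_zero, eq_div_iff hR2] at h0
      linear_combination -h0
    have h2 := congrArg norm h1
    rw [norm_mul, Complex.norm_conj, norm_pow, Complex.norm_of_nonneg hR.le] at h2
    have h3 : ‖a - c‖ < R := by simpa [dist_eq_norm] using ha
    have h4 : ‖w - c‖ ≤ R := by simpa [dist_eq_norm] using hw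
    nlinarith [norm_nonneg (a - c), norm_nonneg (w - c)]
  have hG : DifferentiableOn ℂ (fun z => K z / l z) (Metric.closedBall c R) :=
    hKd.div (by fun_prop) hlne
  have hpos : ∀ w ∈ Metric.sphere c R, 0 < (K w / l w).re := by
    intro w hw
    have hw' := Metric.sphere_subset_closedBall hw
    have hb : ‖w - c‖ = R := by simpa [dist_eq_norm] using hw
    have h1 := div_re_pos_of_norm_sub_le (a := w - φ w) (b := w - c) hρ hb (by
      rw [show w - φ w - (w - c) = -(φ w - c) by ring, norm_neg]; exact hφ w hw')
    have hcc : (w - c) * conj (w - c) = (R : ℂ) ^ 2 := by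
      rw [Complex.mul_conj, Complex.normSq_eq_norm_sq, hb]; push_cast; ring
    have h2 : (w - a) * conj (w - c) = (R : ℂ) ^ 2 * conj (l w) := by
      simp only [hl, map_sub, map_div₀, map_mul, map_one, map_pow, Complex.conj_ofReal,
        Complex.conj_conj]
      rw [mul_sub ((R : ℂ) ^ 2), mul_one, mul_div_cancel₀ _ hR2]
      simp only [map_sub] at hcc
      linear_combination hcc
    have h3 : (w - φ w) * conj (w - c) = ((R ^ 2 : ℝ) : ℂ) * (K w * conj (l w)) := by
      rw [hfac]; push_cast; linear_combination K w * h2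
    rw [h3, Complex.re_ofReal_mul] at h1
    have h4 : 0 < (K w * conj (l w)).re := pos_of_mul_pos_right h1 (by positivity)
    have h5 : (K w / l w).re = (K w * conj (l w)).re / Complex.normSq (l w) := by
      rw [Complex.div_re]
      simp
      ring
    rw [h5]
    exact div_pos h4 (Complex.normSq_pos.2 (hlne w hw'))
  have := re_pos_of_re_pos_on_sphere hR hG hpos hz
  intro h0
  simp [h0] at this

end SingleZero

namespace Schrodinger

variable {q : ℝ → ℂ} {k : ℂ}

/-! ### From the operator to the half-lines -/

/-- The pair `(u, v)` satisfies `u' = v`, `v' = q u - g` on both half-lines and `u` is square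
integrable. -/
structure IsSol (q u v g : ℝ → ℂ) : Prop where
  memLp : MemLp u 2 volume
  right : HasPrim u v
  right' : HasPrim v fun t => q t * u t - g t
  left : HasPrim (fun t => u (-t)) fun t => -v (-t)
  left' : HasPrim (fun t => -v (-t)) fun t => refl q t * u (-t) - g (-t)

theorem IsPair.exists_isSol {y g : L2} (h : IsPair q y g) :
    ∃ u v : ℝ → ℂ, (y : ℝ → ℂ) =ᵐ[volume] u ∧ IsSol q u v g := by
  obtain ⟨u, v, hy, hu, hi, hv⟩ := h
  have hv1 : HasPrim v fun t => q t * u t - g t := fun x _ =>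
    ⟨hi 0 x, by rw [← hv 0 x]; ring⟩
  have hv2 : HasPrim (fun t => -v (-t)) fun t => refl q t * u (-t) - g (-t) := by
    intro x _
    have h1 : IntervalIntegrable (fun t => refl q t * u (-t) - g (-t)) volume 0 x := by
      have := (hi 0 (-x)).comp_sub_left (c := 0)
      simpa [refl] using this
    refine ⟨h1, ?_⟩
    have h2 := intervalIntegral.integral_comp_neg (a := 0) (b := x)
      (fun t => q t * u t - g t)
    simp only [refl]
    rw [h2, neg_zero, ← hv]
    ring
  refine ⟨u, v, hy, (memLp_congr_ae hy).1 (Lp.memLp y), ?_, hv1, ?_, hv2⟩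
  · intro x hx
    have h1 := (hv1.continuousOn_uIcc le_rfl hx).intervalIntegrable (μ := volume)
    refine ⟨h1, ?_⟩
    rw [intervalIntegral.integral_eq_sub_of_hasDerivAt (fun t _ => hu t) h1]
    ring
  · intro x hx
    have h1 := (hv2.continuousOn_uIcc le_rfl hx).intervalIntegrable (μ := volume)
    refine ⟨h1, ?_⟩
    have hd : ∀ t, HasDerivAt (fun t => u (-t)) (-v (-t)) t := fun t => by
      have := (hu (-t)).scomp t (hasDerivAt_neg t)
      simpa [Function.comp_def] using this
    rw [intervalIntegral.integral_eq_sub_of_hasDerivAt (fun t _ => hd t) h1]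
    ring

theorem IsSol.congr {u v g g' : ℝ → ℂ} (h : IsSol q u v g) (hg : g =ᵐ[volume] g') :
    IsSol q u v g' where
  memLp := h.memLp
  right := h.right
  right' := h.right'.congr_ae (by filter_upwards [hg] with t ht _ using by rw [ht])
  left := h.left
  left' := h.left'.congr_ae (by
    have h1 : ∀ᵐ t : ℝ, g (-t) = g' (-t) :=
      (Measure.measurePreserving_neg (volume : Measure ℝ)).quasiMeasurePreserving.ae hg
    filter_upwards [h1] with t ht _ using by rw [ht])

theorem IsSol.reflect {u v g : ℝ → ℂ} (h : IsSol q u v g) :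
    IsSol (refl q) (fun t => u (-t)) (fun t => -v (-t)) (fun t => g (-t)) where
  memLp := h.memLp.comp_measurePreserving (Measure.measurePreserving_neg (volume : Measure ℝ))
  right := h.left
  right' := h.left'
  left := by simpa using h.right
  left' := by simpa [refl] using h.right'

theorem IsSol.integrableOn_sq {u v g : ℝ → ℂ} (h : IsSol q u v g) :
    IntegrableOn (fun t => ‖u t‖ ^ 2) (Ioi 0) :=
  ((memLp_two_iff_integrable_sq_norm h.memLp.1).1 h.memLp).integrableOn

theorem IsSol.add {u₁ v₁ g₁ u₂ v₂ g₂ : ℝ → ℂ} (h₁ : IsSol q u₁ v₁ g₁) (h₂ : IsSol q u₂ v₂ g₂) :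
    IsSol q (fun t => u₁ t + u₂ t) (fun t => v₁ t + v₂ t) (fun t => g₁ t + g₂ t) where
  memLp := h₁.memLp.add h₂.memLp
  right := h₁.right.add h₂.right
  right' := (h₁.right'.add h₂.right').congr fun t _ => by ring
  left := (h₁.left.add h₂.left).congr fun t _ => by ring
  left' := ((h₁.left'.add h₂.left').congr_left fun t _ => by ring).congr fun t _ => by ring

theorem IsSol.const_mul {u v g : ℝ → ℂ} (c : ℂ) (h : IsSol q u v g) :
    IsSol q (fun t => c * u t) (fun t => c * v t) (fun t => c * g t) where
  memLp := h.memLp.const_mul c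
  right := h.right.const_mul c
  right' := (h.right'.const_mul c).congr fun t _ => by ring
  left := (h.left.const_mul c).congr fun t _ => by ring
  left' := ((h.left'.const_mul c).congr_left fun t _ => by ring).congr fun t _ => by ring

/-- A solution of the homogeneous equation with zero Cauchy data vanishes. -/
theorem IsSol.eq_zero (hq : FullLine q) {E : ℂ} {u v : ℝ → ℂ}
    (h : IsSol q u v fun t => E * u t) (hu : u 0 = 0) (hv : v 0 = 0) : u = 0 := by
  have key : ∀ {p u v : ℝ → ℂ}, FullLine p → IsSol p u v (fun t => E * u t) → u 0 = 0 → v 0 = 0 →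
      ∀ x, 0 ≤ x → u x = 0 := fun {p u v} hp h hu hv x hx =>
    (eq_zero_of_cauchy_data (r := fun t => p t - E) h.right
      (h.right'.congr fun t _ => by ring)
      (fun x hx => (hp.halfLine.intervalIntegrable hx).sub intervalIntegrable_const) hu hv hx).1
  ext x
  rcases le_total 0 x with hx | hx
  · exact key hq h hu hv x hx
  · have := key hq.refl h.reflect (by simpa using hu) (by simpa using hv) (-x) (by linarith)
    simpa using this

/-- The Wronskian of a solution of an inhomogeneous equation with the Jost solution. -/
theorem IsSol.wronskian (hq : FullLine q) (hk : 0 ≤ k.im) {u v g : ℝ → ℂ} (h : IsSol q u v g)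
    (hint : IntegrableOn (fun t => (k ^ 2 * u t - g t) * jostF q k t) (Ioi 0)) :
    u 0 * jostG q k 0 - v 0 * jostF q k 0 =
      ∫ t in Ioi 0, (k ^ 2 * u t - g t) * jostF q k t := by
  have hq' := hq.halfLine
  have hexp : ∀ t : ℝ, 0 ≤ t → Real.exp (-k.im * t) ≤ 1 := fun t ht => by
    rw [Real.exp_le_one_iff]; nlinarith
  have hJ : 0 ≤ ∫ t in Ioi 0, ‖q t‖ := integral_nonneg fun _ => norm_nonneg _
  refine wronskian_zero_eq_integral
    (C := (1 + ‖k‖ + ∫ t in Ioi 0, ‖q t‖) * Real.exp (gam q 0)) h.right h.right' h.integrableOn_sq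
    (hasPrim_jostF hq' hk) (hasPrim_jostG hq' hk).continuousOn (fun t ht => ?_) (fun t ht => ?_)
    ?_ hint
  · refine (norm_jostF_le hq' hk ht).trans ?_
    have h1 := Real.exp_pos (gam q 0)
    have h2 := mul_le_mul_of_nonneg_left (hexp t ht) h1.le
    have h3 : 0 ≤ (‖k‖ + ∫ t in Ioi 0, ‖q t‖) * Real.exp (gam q 0) := by positivity
    linarith
  · refine (norm_jostG_le hq' hk ht).trans ?_
    have h1 := Real.exp_pos (gam q 0)
    have h3 : 0 ≤ (‖k‖ + ∫ t in Ioi 0, ‖q t‖) * Real.exp (gam q 0) := by positivity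
    have h2 := mul_le_mul_of_nonneg_left (hexp t ht) h3
    linarith
  · refine ((h.right.mul (hasPrim_jostG hq' hk)).sub
      (h.right'.mul (hasPrim_jostF hq' hk))).congr fun t _ => ?_
    ring

/-- The inhomogeneity is exactly `k² u`, so the integral in `IsSol.wronskian` vanishes and the
Cauchy data of `u` are proportional to those of the Jost solution. Real `k` is included, as needed
to exclude eigenvalues on `[0, ∞)`. -/
theorem IsSol.wronskian_eq_zero (hq : FullLine q) (hk : 0 ≤ k.im) {u v : ℝ → ℂ}
    (h : IsSol q u v fun t => k ^ 2 * u t) : u 0 * jostG q k 0 - v 0 * jostF q k 0 = 0 := by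
  have := h.wronskian hq hk (by simp)
  simpa using this

/-! ### Chains of root vectors and the order of the zero of the Wronskian. -/

/-- Chains of generalized eigenfunctions: `u j` is mapped by `H - E` to `u (j - 1)`. -/
structure IsChain (q : ℝ → ℂ) (E : ℂ) (m : ℕ) (u v : ℕ → ℝ → ℂ) : Prop where
  zero : IsSol q (u 0) (v 0) fun t => E * u 0 t
  succ : ∀ j < m, IsSol q (u (j + 1)) (v (j + 1)) fun t => E * u (j + 1) t + u j t

/-- Since `H - E` lowers the index by one, `H - E - ε` applied to `∑ ε^j u_j` telescopes to
`-ε^(m+1) u_m`. -/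
theorem IsChain.isSol_sum {E : ℂ} {m : ℕ} {u v : ℕ → ℝ → ℂ} (h : IsChain q E m u v) (ε : ℂ) :
    IsSol q (fun t => ∑ j ∈ Finset.range (m + 1), ε ^ j * u j t)
      (fun t => ∑ j ∈ Finset.range (m + 1), ε ^ j * v j t)
      (fun t => (E + ε) * (∑ j ∈ Finset.range (m + 1), ε ^ j * u j t) - ε ^ (m + 1) * u m t) := by
  induction m with
  | zero =>
    have e : (fun t => (E + ε) * (∑ j ∈ Finset.range (0 + 1), ε ^ j * u j t) - ε ^ (0 + 1) * u 0 t)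
        = fun t => E * u 0 t := by
      ext t; simp; ring
    rw [e]
    simpa using h.zero
  | succ m ih =>
    have h1 := (ih ⟨h.zero, fun j hj => h.succ j (by omega)⟩).add
      ((h.succ m (by omega)).const_mul (ε ^ (m + 1)))
    simp only [Finset.sum_range_succ _ (m + 1)]
    convert h1 using 2 with t
    ring

theorem IsChain.reflect {E : ℂ} {m : ℕ} {u v : ℕ → ℝ → ℂ} (h : IsChain q E m u v) :
    IsChain (refl q) E m (fun j t => u j (-t)) (fun j t => -v j (-t)) :=
  ⟨h.zero.reflect, fun j hj => (h.succ j hj).reflect⟩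

theorem IsChain.memLp {E : ℂ} {m : ℕ} {u v : ℕ → ℝ → ℂ} (h : IsChain q E m u v) :
    MemLp (u m) 2 volume := by
  cases m with
  | zero => exact h.zero.memLp
  | succ m => exact (h.succ m (by omega)).memLp

theorem integrableOn_exp_neg {η : ℝ} (hη : 0 < η) :
    IntegrableOn (fun t : ℝ => Real.exp (-(2 * η) * t)) (Ioi 0) :=
  integrableOn_exp_mul_Ioi (by linarith) 0

theorem norm_jostF_sq_le (hq : HalfLine q) {η : ℝ} (hη : 0 < η) (hk : η ≤ k.im) {t : ℝ}
    (ht : 0 ≤ t) : ‖jostF q k t‖ ^ 2 ≤ Real.exp (gam q 0) ^ 2 * Real.exp (-(2 * η) * t) := by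
  have h1 := norm_jostF_le hq (hη.le.trans hk) ht
  have h2 : Real.exp (-k.im * t) ≤ Real.exp (-η * t) := Real.exp_le_exp.2 (by nlinarith)
  have h3 : Real.exp (-(2 * η) * t) = Real.exp (-η * t) ^ 2 := by
    rw [← Real.exp_nat_mul]; congr 1; push_cast; ring
  rw [h3, ← mul_pow]
  refine pow_le_pow_left₀ (norm_nonneg _) (h1.trans ?_) 2
  gcongr

/-- With `ε = k² - E` the only source left is `ε^(m+1) u_m`. Its pairing with the Jost solution is
bounded by `|u_m|² + |f|²`, and for `η ≤ k.im` the decay of `f` makes this uniform in `k`. -/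
theorem IsChain.norm_wronskian_le (hq : FullLine q) {E : ℂ} {m : ℕ} {u v : ℕ → ℝ → ℂ}
    (h : IsChain q E m u v) {η : ℝ} (hη : 0 < η) :
    ∃ C : ℝ, ∀ k : ℂ, η ≤ k.im →
      ‖(∑ j ∈ Finset.range (m + 1), (k ^ 2 - E) ^ j * u j 0) * jostG q k 0 -
        (∑ j ∈ Finset.range (m + 1), (k ^ 2 - E) ^ j * v j 0) * jostF q k 0‖ ≤
      ‖k ^ 2 - E‖ ^ (m + 1) * C := by
  set B : ℝ → ℝ := fun t => ‖u m t‖ ^ 2 + Real.exp (gam q 0) ^ 2 * Real.exp (-(2 * η) * t) with hB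
  have hBi : IntegrableOn B (Ioi 0) :=
    ((memLp_two_iff_integrable_sq_norm h.memLp.1).1 h.memLp).integrableOn.add
      ((integrableOn_exp_neg hη).const_mul _)
  refine ⟨∫ t in Ioi 0, B t, fun k hk => ?_⟩
  have hk0 : 0 ≤ k.im := hη.le.trans hk
  have hle : ∀ t ∈ Ioi (0 : ℝ), ‖u m t * jostF q k t‖ ≤ B t := by
    intro t ht
    have := norm_jostF_sq_le hq.halfLine hη hk (le_of_lt ht)
    rw [norm_mul, hB]
    nlinarith [sq_nonneg (‖u m t‖ - ‖jostF q k t‖), sq_nonneg ‖u m t‖, sq_nonneg ‖jostF q k t‖]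
  have hle' : ∀ᵐ t ∂(volume.restrict (Ioi (0 : ℝ))), ‖u m t * jostF q k t‖ ≤ B t :=
    (ae_restrict_iff' measurableSet_Ioi).2 (Eventually.of_forall hle)
  have hui : IntegrableOn (fun t => u m t * jostF q k t) (Ioi 0) := by
    refine Integrable.mono' hBi (h.memLp.1.restrict.mul ?_) hle'
    exact ((hasPrim_jostF hq.halfLine hk0).continuousOn.mono
      Ioi_subset_Ici_self).aestronglyMeasurable measurableSet_Ioi
  have hs := h.isSol_sum (k ^ 2 - E)
  have e : ∀ t, (k ^ 2 * (∑ j ∈ Finset.range (m + 1), (k ^ 2 - E) ^ j * u j t) -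
      ((E + (k ^ 2 - E)) * (∑ j ∈ Finset.range (m + 1), (k ^ 2 - E) ^ j * u j t) -
        (k ^ 2 - E) ^ (m + 1) * u m t)) * jostF q k t =
      (k ^ 2 - E) ^ (m + 1) * (u m t * jostF q k t) := fun t => by ring
  have hw := hs.wronskian hq hk0 (by
    simp only [e]
    exact hui.const_mul _)
  simp only [e] at hw
  rw [hw, integral_const_mul, norm_mul, norm_pow]
  gcongr
  exact norm_integral_le_of_norm_le hBi hle'

theorem natCast_le_analyticOrderAt_of_isBigO {f : ℂ → ℂ} {z₀ : ℂ} {n : ℕ} (hf : AnalyticAt ℂ f z₀)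
    (h : f =O[𝓝 z₀] fun z => (z - z₀) ^ n) : (n : ℕ∞) ≤ analyticOrderAt f z₀ := by
  by_contra! hlt
  obtain ⟨m, hm⟩ := ENat.ne_top_iff_exists.1 (ne_top_of_lt hlt)
  rw [← hm, Nat.cast_lt] at hlt
  obtain ⟨g, hg, hg0, hfg⟩ := (hf.analyticOrderAt_eq_natCast).1 hm.symm
  obtain ⟨c, hc⟩ := h.bound
  have hev : ∀ᶠ z in 𝓝[≠] z₀, ‖g z‖ ≤ c * ‖z - z₀‖ ^ (n - m) := by
    filter_upwards [mem_nhdsWithin_of_mem_nhds hfg, mem_nhdsWithin_of_mem_nhds hc,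
      self_mem_nhdsWithin] with z h1 h2 h3
    have hz : 0 < ‖z - z₀‖ := norm_pos_iff.2 (sub_ne_zero.2 h3)
    rw [h1, smul_eq_mul, norm_mul, norm_pow, norm_pow,
      show n = m + (n - m) by omega, pow_add] at h2
    have h4 : ‖z - z₀‖ ^ m * ‖g z‖ ≤ ‖z - z₀‖ ^ m * (c * ‖z - z₀‖ ^ (m + (n - m) - m)) := by
      rw [show m + (n - m) - m = n - m by omega]
      linarith
    rw [show m + (n - m) - m = n - m by omega] at h4
    exact le_of_mul_le_mul_left h4 (by positivity)
  have hlim : Tendsto (fun z => c * ‖z - z₀‖ ^ (n - m)) (𝓝[≠] z₀) (𝓝 0) := by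
    have hcont : Continuous fun z : ℂ => c * ‖z - z₀‖ ^ (n - m) := by fun_prop
    have := (hcont.tendsto z₀).mono_left (nhdsWithin_le_nhds (s := {z₀}ᶜ))
    simpa [show n - m ≠ 0 by omega] using this
  have hg1 : Tendsto (fun z => ‖g z‖) (𝓝[≠] z₀) (𝓝 ‖g z₀‖) :=
    hg.continuousAt.norm.tendsto.mono_left nhdsWithin_le_nhds
  have := le_of_tendsto_of_tendsto hg1 hlim hev
  exact hg0 (norm_le_zero_iff.1 this)

/-- A chain of `m + 1` generalized eigenfunctions forces a zero of order `m + 1` of the Wronskian of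
the Jost solutions. -/
theorem IsChain.le_analyticOrderAt (hq : FullLine q) {κ : ℂ} (hκ : 0 < κ.im) {m : ℕ}
    {u v : ℕ → ℝ → ℂ} (h : IsChain q (κ ^ 2) m u v) (h0 : u 0 ≠ 0) :
    ((m + 1 : ℕ) : ℕ∞) ≤ analyticOrderAt (jostW q) κ := by
  refine natCast_le_analyticOrderAt_of_isBigO
    ((differentiableOn_jostW hq).analyticAt (isOpen_upper.mem_nhds hκ)) ?_
  obtain ⟨C₁, hC₁⟩ := h.norm_wronskian_le hq (half_pos hκ)
  obtain ⟨C₂, hC₂⟩ := h.reflect.norm_wronskian_le hq.refl (half_pos hκ)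
  have hnhds : ∀ᶠ k in 𝓝 κ, κ.im / 2 ≤ k.im :=
    (Complex.continuous_im.tendsto κ).eventually (eventually_ge_nhds (by linarith))
  set Y : ℂ → ℂ := fun k => ∑ j ∈ Finset.range (m + 1), (k ^ 2 - κ ^ 2) ^ j * u j 0 with hY
  set V : ℂ → ℂ := fun k => ∑ j ∈ Finset.range (m + 1), (k ^ 2 - κ ^ 2) ^ j * v j 0 with hV
  have hYc : Continuous Y := by fun_prop
  have hVc : Continuous V := by fun_prop
  have hYκ : Y κ = u 0 0 := by simp [hY, Finset.sum_range_succ']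
  have hVκ : V κ = v 0 0 := by simp [hV, Finset.sum_range_succ']
  have hε : (fun k => (k ^ 2 - κ ^ 2) ^ (m + 1)) =O[𝓝 κ] fun k => (k - κ) ^ (m + 1) := by
    have h1 : (fun k : ℂ => k ^ 2 - κ ^ 2) =O[𝓝 κ] fun k => k - κ := by
      have h2 : (fun k : ℂ => k + κ) =O[𝓝 κ] fun _ => (1 : ℂ) :=
        (Continuous.continuousAt (by fun_prop)).tendsto.isBigO_one ℂ
      have h3 := h2.mul (Asymptotics.isBigO_refl (fun k : ℂ => k - κ) (𝓝 κ))
      simp only [one_mul] at h3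
      exact h3.congr_left fun k => by ring
    exact h1.pow _
  have hA : (fun k => Y k * jostG q k 0 - V k * jostF q k 0) =O[𝓝 κ]
      fun k => (k - κ) ^ (m + 1) := by
    refine Asymptotics.IsBigO.trans (Asymptotics.IsBigO.of_bound C₁ ?_) hε
    filter_upwards [hnhds] with k hk
    rw [norm_pow, mul_comm C₁]
    exact hC₁ k hk
  have hB : (fun k => Y k * jostG (refl q) k 0 + V k * jostF (refl q) k 0) =O[𝓝 κ]
      fun k => (k - κ) ^ (m + 1) := by
    refine Asymptotics.IsBigO.trans (Asymptotics.IsBigO.of_bound C₂ ?_) hε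
    filter_upwards [hnhds] with k hk
    have := hC₂ k hk
    simp only [neg_zero, mul_neg, Finset.sum_neg_distrib, neg_mul, sub_neg_eq_add] at this
    rw [norm_pow, mul_comm C₂]
    exact this
  have hone : ∀ {f : ℂ → ℂ}, DifferentiableOn ℂ f {z | 0 < z.im} → f =O[𝓝 κ] fun _ => (1 : ℂ) :=
    fun hf => (hf.differentiableAt (isOpen_upper.mem_nhds hκ)).continuousAt.tendsto.isBigO_one ℂ
  have f₁ := hone (differentiableOn_jostF_zero hq.halfLine)
  have g₁ := hone (differentiableOn_jostG_zero hq.halfLine)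
  have f₂ := hone (differentiableOn_jostF_zero hq.refl.halfLine)
  have g₂ := hone (differentiableOn_jostG_zero hq.refl.halfLine)
  -- Cramer's rule: the two small Wronskians are linear forms in `(Y, V)` with determinant `jostW`
  -- up to sign, so `W Y` and `W V` are small too.
  have hWY : (fun k => jostW q k * Y k) =O[𝓝 κ] fun k => (k - κ) ^ (m + 1) := by
    have := (f₂.mul hA).add (f₁.mul hB)
    simp only [one_mul] at this
    refine this.congr_left fun k => ?_
    rw [jostW]; ring
  have hWV : (fun k => jostW q k * V k) =O[𝓝 κ] fun k => (k - κ) ^ (m + 1) := by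
    have := (g₁.mul hB).sub (g₂.mul hA)
    simp only [one_mul] at this
    refine this.congr_left fun k => ?_
    rw [jostW]; ring
  have hdiv : ∀ {Z : ℂ → ℂ}, Continuous Z → Z κ ≠ 0 →
      ((fun k => jostW q k * Z k) =O[𝓝 κ] fun k => (k - κ) ^ (m + 1)) →
      jostW q =O[𝓝 κ] fun k => (k - κ) ^ (m + 1) := by
    intro Z hZ hZ0 hO
    have h1 : (fun k => (Z k)⁻¹) =O[𝓝 κ] fun _ => (1 : ℂ) :=
      (hZ.continuousAt.inv₀ hZ0).tendsto.isBigO_one ℂ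
    have h2 := hO.mul h1
    simp only [mul_one] at h2
    refine h2.congr' ?_ EventuallyEq.rfl
    filter_upwards [hZ.continuousAt.eventually_ne hZ0] with k hk
    rw [mul_assoc, mul_inv_cancel₀ hk, mul_one]
  -- The values `Y κ` and `V κ` are the Cauchy data of the eigenfunction `u 0`, so one of them is
  -- nonzero and can be divided out.
  by_cases hu0 : u 0 0 = 0
  · have hv0 : v 0 0 ≠ 0 := fun hv0 => h0 (h.zero.eq_zero hq hu0 hv0)
    exact hdiv hVc (by rwa [hVκ]) hWV
  · exact hdiv hYc (by rwa [hYκ]) hWY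

end Schrodinger

/-! ### Kernels of powers of an unbounded operator. -/

namespace LinearPMap

variable {X : Type*} [AddCommGroup X] [Module ℂ X] (T : X →ₗ.[ℂ] X) (E : ℂ)

theorem kerPow_le_succ (n : ℕ) : kerPow T E n ≤ kerPow T E (n + 1) := by
  induction n with
  | zero => exact bot_le
  | succ n ih =>
    intro y hy
    obtain ⟨z, hz, h⟩ := (mem_kerPow_succ T E n y).1 hy
    exact (mem_kerPow_succ T E (n + 1) y).2 ⟨z, hz, ih h⟩

theorem kerPow_succ_eq_of_eq {n : ℕ} (h : kerPow T E (n + 1) = kerPow T E n) :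
    kerPow T E (n + 2) = kerPow T E (n + 1) := by
  ext y
  rw [mem_kerPow_succ, mem_kerPow_succ, h]

/-- Each kernel determines the next one, so once the sequence stops growing it is constant. -/
theorem rootSpace_eq_kerPow {n : ℕ} (h : kerPow T E (n + 1) ≤ kerPow T E n) :
    rootSpace T E = kerPow T E n := by
  have heq : kerPow T E (n + 1) = kerPow T E n := le_antisymm h (kerPow_le_succ T E n)
  have hadd : ∀ m, kerPow T E (n + m + 1) = kerPow T E (n + m) := by
    intro m
    induction m with
    | zero => exact heq
    | succ m ih => exact kerPow_succ_eq_of_eq T E ih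
  have hst : ∀ m, kerPow T E (n + m) = kerPow T E n := by
    intro m
    induction m with
    | zero => rfl
    | succ m ih => rw [← add_assoc, hadd, ih]
  refine le_antisymm (iSup_le fun m => ?_) (le_iSup (kerPow T E) n)
  rw [← hst m]
  exact (monotone_nat_of_le_succ (kerPow_le_succ T E)) (by omega)

/-- `T - E` maps the kernel of level `n + 1` into that of level `n`, and its own kernel embeds in
level one. By rank-nullity each level adds at most one dimension. -/
theorem rank_kerPow_le (h1 : Module.rank ℂ (kerPow T E 1) ≤ 1) (n : ℕ) :
    Module.rank ℂ (kerPow T E n) ≤ n := by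
  induction n with
  | zero => exact (rank_bot ℂ X).le.trans (by simp)
  | succ n ih =>
    set C : Submodule ℂ T.domain := (kerPow T E n).comap (T.toFun - E • T.domain.subtype) with hC
    set S : T.domain →ₗ[ℂ] X := T.toFun - E • T.domain.subtype with hS
    have hinj : Function.Injective T.domain.subtype := Subtype.val_injective
    have e1 : Module.rank ℂ (kerPow T E (n + 1)) = Module.rank ℂ C :=
      (Submodule.equivMapOfInjective _ hinj C).rank_eq.symm
    have hmap : ∀ x ∈ C, S x ∈ kerPow T E n := fun x hx => hx
    set g : C →ₗ[ℂ] kerPow T E n := S.restrict hmap with hg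
    have e2 := g.rank_range_add_rank_ker
    have e3 : Module.rank ℂ (LinearMap.range g) ≤ n := (Submodule.rank_le _).trans ih
    have e4 : Module.rank ℂ (LinearMap.ker g) ≤ 1 := by
      refine le_trans ?_ h1
      set j : LinearMap.ker g →ₗ[ℂ] kerPow T E 1 :=
        LinearMap.codRestrict _ (T.domain.subtype ∘ₗ C.subtype ∘ₗ (LinearMap.ker g).subtype)
          (fun x => by
            refine (mem_kerPow_succ T E 0 _).2 ⟨x.1.1, rfl, ?_⟩
            have hx := congrArg Subtype.val (LinearMap.mem_ker.1 x.2)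
            exact (Submodule.mem_bot ℂ).2 hx) with hj
      refine LinearMap.rank_le_of_injective j fun x y hxy => ?_
      have := congrArg Subtype.val hxy
      exact Subtype.ext (Subtype.ext (Subtype.ext this))
    rw [e1, ← e2]
    push_cast
    exact add_le_add e3 e4

end LinearPMap

/-! ### Multiplicity against order of the zero, and absence of eigenvalues on `[0, ∞)`. -/

namespace Schrodinger

open LinearPMap

variable {q : ℝ → ℂ} {k : ℂ}

theorem isPair_H (z : (H q).domain) : IsPair q z (H q z) := by
  have h : ((z : L2), H q z) ∈ (H q).graph := LinearPMap.mem_graph _ z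
  rw [H_graph] at h
  exact h

theorem exists_domain_of_isPair {y g : L2} (h : IsPair q y g) :
    ∃ z : (H q).domain, (z : L2) = y ∧ H q z = g := by
  have h' : (y, g) ∈ (H q).graph := by
    rw [H_graph]
    exact h
  exact (LinearPMap.mem_graph_iff _).1 h'

theorem isEigenvalue_iff {E : ℂ} :
    (H q).IsEigenvalue E ↔ ∃ y : L2, y ≠ 0 ∧ IsPair q y (E • y) := by
  constructor
  · rintro ⟨y, hy, h⟩
    exact ⟨y, hy, by rw [← h]; exact isPair_H y⟩
  · rintro ⟨y, hy, h⟩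
    obtain ⟨z, rfl, hz⟩ := exists_domain_of_isPair h
    exact ⟨z, hy, hz⟩

theorem mem_kerPow_one {E : ℂ} {y : L2} : y ∈ (H q).kerPow E 1 ↔ IsPair q y (E • y) := by
  rw [mem_kerPow_succ]
  constructor
  · rintro ⟨z, rfl, hz⟩
    have hz' : H q z - E • (z : L2) = 0 := (Submodule.mem_bot ℂ).1 hz
    rw [← sub_eq_zero.1 hz']
    exact isPair_H z
  · intro h
    obtain ⟨z, rfl, hz⟩ := exists_domain_of_isPair h
    exact ⟨z, rfl, (Submodule.mem_bot ℂ).2 (by rw [hz, sub_self])⟩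

theorem isSol_of_isPair_smul {E : ℂ} {y : L2} (h : IsPair q y (E • y)) :
    ∃ u v : ℝ → ℂ, (y : ℝ → ℂ) =ᵐ[volume] u ∧ IsSol q u v fun t => E * u t := by
  obtain ⟨u, v, hy, hs⟩ := h.exists_isSol
  refine ⟨u, v, hy, hs.congr ?_⟩
  filter_upwards [Lp.coeFn_smul E y, hy] with t h1 h2
  rw [h1, Pi.smul_apply, h2, smul_eq_mul]

/-- A vector in the kernel of `(H - E) ^ (m + 1)` and not in the one of `(H - E) ^ m` is the top of
a chain. -/
theorem exists_chain_of_mem_kerPow {E : ℂ} (m : ℕ) {y : L2} (hy : y ∈ (H q).kerPow E (m + 1))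
    (hy' : y ∉ (H q).kerPow E m) :
    ∃ Y : ℕ → L2, Y m = y ∧ Y 0 ≠ 0 ∧ IsPair q (Y 0) (E • Y 0) ∧
      ∀ j < m, IsPair q (Y (j + 1)) (E • Y (j + 1) + Y j) := by
  induction m generalizing y with
  | zero =>
    refine ⟨fun _ => y, rfl, fun h0 => hy' ?_, mem_kerPow_one.1 hy, by simp⟩
    exact (Submodule.mem_bot ℂ).2 h0
  | succ m ih =>
    obtain ⟨z, rfl, hz⟩ := (mem_kerPow_succ _ _ _ _).1 hy
    have hz' : H q z - E • (z : L2) ∉ (H q).kerPow E m := fun h =>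
      hy' ((mem_kerPow_succ _ _ _ _).2 ⟨z, rfl, h⟩)
    obtain ⟨Y, hYm, hY0, hYp, hYs⟩ := ih hz hz'
    refine ⟨fun j => if j = m + 1 then z else Y j, by simp, by simpa using hY0,
      by simpa using hYp, fun j hj => ?_⟩
    rcases Nat.lt_succ_iff_lt_or_eq.1 hj with h | rfl
    · have h1 : j ≠ m := by omega
      have h2 : j ≠ m + 1 := by omega
      simpa [h1, h2] using hYs j h
    · have h3 : E • (z : L2) + Y j = H q z := by rw [hYm]; abel
      have h4 : j ≠ j + 1 := by omega
      simp only [if_true, if_neg h4]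
      rw [h3]
      exact isPair_H z

theorem isChain_of_isPair {E : ℂ} {m : ℕ} {Y : ℕ → L2} (h0 : IsPair q (Y 0) (E • Y 0))
    (hs : ∀ j < m, IsPair q (Y (j + 1)) (E • Y (j + 1) + Y j)) :
    ∃ u v : ℕ → ℝ → ℂ, (Y 0 : ℝ → ℂ) =ᵐ[volume] u 0 ∧ IsChain q E m u v := by
  -- The bound on `j` sits inside the existential so that `choose` yields sequences indexed by all
  -- of `ℕ`; beyond `m` they take the value `0`.
  have key : ∀ j, ∃ u v : ℝ → ℂ, j < m + 1 → (Y j : ℝ → ℂ) =ᵐ[volume] u ∧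
      IsSol q u v (fun t => E * u t + if j = 0 then 0 else (Y (j - 1) : ℝ → ℂ) t) := by
    intro j
    by_cases hj : j < m + 1
    · cases j with
      | zero =>
        obtain ⟨u, v, hy, hsol⟩ := isSol_of_isPair_smul h0
        exact ⟨u, v, fun _ => ⟨hy, by simpa using hsol⟩⟩
      | succ j =>
        obtain ⟨u, v, hy, hsol⟩ := (hs j (by omega)).exists_isSol
        refine ⟨u, v, fun _ => ⟨hy, hsol.congr ?_⟩⟩
        filter_upwards [Lp.coeFn_add (E • Y (j + 1)) (Y j), Lp.coeFn_smul E (Y (j + 1)), hy]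
          with t h1 h2 h3
        rw [h1, Pi.add_apply, h2, Pi.smul_apply, h3, smul_eq_mul]
        simp
    · exact ⟨0, 0, fun h => absurd h hj⟩
  choose u v huv using key
  refine ⟨u, v, (huv 0 (by omega)).1, by simpa using (huv 0 (by omega)).2, fun j hj => ?_⟩
  refine (huv (j + 1) (by omega)).2.congr ?_
  filter_upwards [(huv j (by omega)).1] with t ht
  simp [ht]

theorem ne_zero_of_ae_eq {y : L2} {u : ℝ → ℂ} (h : (y : ℝ → ℂ) =ᵐ[volume] u) (hy : y ≠ 0) :
    u ≠ 0 := by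
  rintro rfl
  exact hy ((Lp.eq_zero_iff_ae_eq_zero).2 h)

theorem le_analyticOrderAt_of_mem_kerPow (hq : FullLine q) {κ : ℂ} (hκ : 0 < κ.im) {m : ℕ} {y : L2}
    (hy : y ∈ (H q).kerPow (κ ^ 2) (m + 1)) (hy' : y ∉ (H q).kerPow (κ ^ 2) m) :
    ((m + 1 : ℕ) : ℕ∞) ≤ analyticOrderAt (jostW q) κ := by
  obtain ⟨Y, -, hY0, hYp, hYs⟩ := exists_chain_of_mem_kerPow m hy hy'
  obtain ⟨u, v, hu, hc⟩ := isChain_of_isPair hYp hYs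
  exact hc.le_analyticOrderAt hq hκ (ne_zero_of_ae_eq hu hY0)

/-- Square integrable solutions of the homogeneous equation are pairwise proportional. -/
theorem rank_kerPow_one_le (hq : FullLine q) (hk : 0 ≤ k.im) :
    Module.rank ℂ ((H q).kerPow (k ^ 2) 1) ≤ 1 := by
  by_cases hall : ∀ y ∈ (H q).kerPow (k ^ 2) 1, y = 0
  · rw [(Submodule.eq_bot_iff _).2 hall]
    simp
  · push Not at hall
    obtain ⟨y₀, hy₀, hne⟩ := hall
    obtain ⟨u₀, v₀, hu₀, hs₀⟩ := isSol_of_isPair_smul (mem_kerPow_one.1 hy₀)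
    refine rank_le_one_iff.2 ⟨⟨y₀, hy₀⟩, fun ⟨y, hy⟩ => ?_⟩
    obtain ⟨u, v, hu, hs⟩ := isSol_of_isPair_smul (mem_kerPow_one.1 hy)
    have w₀ := hs₀.wronskian_eq_zero hq hk
    have w := hs.wronskian_eq_zero hq hk
    have hd := jost_cauchy_data_ne_zero hq.halfLine hk
    -- Both pairs of Cauchy data are annihilated by the same nonzero linear form, given by the Jost
    -- data, and are therefore proportional.
    have hdet : u 0 * v₀ 0 = v 0 * u₀ 0 := by
      by_cases hf : jostF q k 0 = 0
      · have hg : jostG q k 0 ≠ 0 := fun hg => hd ⟨hf, hg⟩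
        rw [hf, mul_zero, sub_zero] at w w₀
        rw [(mul_eq_zero.1 w).resolve_right hg, (mul_eq_zero.1 w₀).resolve_right hg]
        simp
      · apply mul_right_cancel₀ hf
        linear_combination u₀ 0 * w - u 0 * w₀
    have hcomb : ∀ a b : ℂ, a * u 0 + b * u₀ 0 = 0 → a * v 0 + b * v₀ 0 = 0 →
        a • y + b • y₀ = 0 := by
      intro a b h1 h2
      have hz : (fun t => a * u t + b * u₀ t) = 0 := by
        refine IsSol.eq_zero (E := k ^ 2) (v := fun t => a * v t + b * v₀ t) hq ?_ h1 h2
        refine ((hs.const_mul a).add (hs₀.const_mul b)).congr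
          (Eventually.of_forall fun t => ?_)
        ring
      rw [Lp.eq_zero_iff_ae_eq_zero]
      filter_upwards [Lp.coeFn_add (a • y) (b • y₀), Lp.coeFn_smul a y, Lp.coeFn_smul b y₀, hu,
        hu₀] with t h3 h4 h5 h6 h7
      rw [h3, Pi.add_apply, h4, h5, Pi.smul_apply, Pi.smul_apply, h6, h7, smul_eq_mul,
        smul_eq_mul]
      exact congrFun hz t
    have hfin : ∀ a b : ℂ, a ≠ 0 → a • y + b • y₀ = 0 → ∃ r : ℂ, r • y₀ = y := by
      intro a b ha h
      refine ⟨-b / a, ?_⟩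
      have h1 : a • y = -(b • y₀) := eq_neg_of_add_eq_zero_left h
      have h2 : y = a⁻¹ • (a • y) := by rw [smul_smul, inv_mul_cancel₀ ha, one_smul]
      rw [h2, h1, smul_neg, smul_smul, ← neg_smul]
      congr 1
      field_simp
    have : ∃ r : ℂ, r • y₀ = y := by
      by_cases h0 : u₀ 0 = 0
      · have h1 : v₀ 0 ≠ 0 := fun h1 =>
          ne_zero_of_ae_eq hu₀ hne (hs₀.eq_zero hq h0 h1)
        refine hfin (v₀ 0) (-v 0) h1 (hcomb _ _ ?_ (by ring))
        linear_combination hdet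
      · refine hfin (u₀ 0) (-u 0) h0 (hcomb _ _ (by ring) ?_)
        linear_combination -hdet
    obtain ⟨r, hr⟩ := this
    exact ⟨r, Subtype.ext hr⟩

/-- The algebraic multiplicity of an eigenvalue is at most the order of the corresponding zero of
the Wronskian of the Jost solutions. -/
theorem finiteDimensional_rootSpace (hq : FullLine q) {κ : ℂ} (hκ : 0 < κ.im)
    (hw : analyticOrderAt (jostW q) κ ≠ ⊤) :
    FiniteDimensional ℂ ((H q).rootSpace (κ ^ 2)) ∧
      ((H q).algMult (κ ^ 2) : ℕ∞) ≤ analyticOrderAt (jostW q) κ := by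
  obtain ⟨n, hn⟩ := ENat.ne_top_iff_exists.1 hw
  -- A vector gained at level `n + 1` would be the top of a chain forcing order at least `n + 1`,
  -- while the order is `n`.
  have hle : (H q).kerPow (κ ^ 2) (n + 1) ≤ (H q).kerPow (κ ^ 2) n := by
    intro y hy
    by_contra hy'
    have := le_analyticOrderAt_of_mem_kerPow hq hκ hy hy'
    rw [← hn, Nat.cast_le] at this
    omega
  have hroot := rootSpace_eq_kerPow _ _ hle
  have hrank : Module.rank ℂ ((H q).rootSpace (κ ^ 2)) ≤ n := by
    rw [hroot]
    exact rank_kerPow_le _ _ (rank_kerPow_one_le hq hκ.le) n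
  refine ⟨Module.rank_lt_aleph0_iff.1 (hrank.trans_lt (Cardinal.natCast_lt_aleph0)), ?_⟩
  rw [← hn, Nat.cast_le]
  exact Module.finrank_le_of_rank_le hrank

theorem jostW_eq_zero_of_isEigenvalue (hq : FullLine q) (hκ : 0 < k.im)
    (h : (H q).IsEigenvalue (k ^ 2)) : jostW q k = 0 := by
  obtain ⟨y, hy, hp⟩ := isEigenvalue_iff.1 h
  have h1 := le_analyticOrderAt_of_mem_kerPow hq hκ (m := 0) (mem_kerPow_one.2 hp)
    (fun h => hy ((Submodule.mem_bot ℂ).1 h))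
  by_contra hne
  rw [(((differentiableOn_jostW hq).analyticAt (isOpen_upper.mem_nhds hκ)).analyticOrderAt_eq_zero).2
    hne] at h1
  simp at h1

/-- There are no eigenvalues on `[0, ∞)`. -/
theorem im_ne_zero_of_isEigenvalue (hq : FullLine q) (h : (H q).IsEigenvalue (k ^ 2)) :
    k.im ≠ 0 := by
  intro hk
  obtain ⟨y, hy, hp⟩ := isEigenvalue_iff.1 h
  obtain ⟨u, v, hu, hs⟩ := isSol_of_isPair_smul hp
  have hk' : 0 ≤ k.im := hk.ge
  have w := hs.wronskian_eq_zero hq hk'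
  have hd := jost_cauchy_data_ne_zero hq.halfLine hk'
  -- An eigenfunction at real `k` must be `c` times the Jost solution on `[0, ∞)`. Its modulus there
  -- tends to `‖c‖`, so square integrability forces `c = 0`.
  obtain ⟨c, hc1, hc2⟩ : ∃ c : ℂ, u 0 = c * jostF q k 0 ∧ v 0 = c * jostG q k 0 := by
    by_cases hf : jostF q k 0 = 0
    · have hg : jostG q k 0 ≠ 0 := fun hg => hd ⟨hf, hg⟩
      refine ⟨v 0 / jostG q k 0, ?_, by field_simp⟩
      rw [hf, mul_zero, sub_zero] at w
      rw [(mul_eq_zero.1 w).resolve_right hg, hf, mul_zero]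
    · refine ⟨u 0 / jostF q k 0, by field_simp, ?_⟩
      field_simp
      linear_combination -w
  have heq : ∀ x, 0 ≤ x → u x - c * jostF q k x = 0 := fun x hx =>
    (eq_zero_of_cauchy_data (r := fun t => q t - k ^ 2)
      (hs.right.sub ((hasPrim_jostF hq.halfLine hk').const_mul c))
      ((hs.right'.sub ((hasPrim_jostG hq.halfLine hk').const_mul c)).congr fun t _ => by ring)
      (fun x hx => (hq.halfLine.intervalIntegrable hx).sub intervalIntegrable_const)
      (by rw [hc1]; ring) (by rw [hc2]; ring) hx).1
  have hnorm : ∀ x, 0 ≤ x → ‖u x‖ = ‖c‖ * ‖jostM q k x‖ := fun x hx => by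
    rw [sub_eq_zero.1 (heq x hx), norm_mul, jostF, norm_mul, norm_exp_I_mul, hk]
    simp
  have hlim : Tendsto (fun x => ‖u x‖ ^ 2) atTop (𝓝 ((‖c‖ * 1) ^ 2)) := by
    refine Tendsto.pow (Tendsto.congr' ?_ ((tendsto_norm_jostM hq.halfLine hk').const_mul ‖c‖)) 2
    filter_upwards [eventually_ge_atTop 0] with x hx using (hnorm x hx).symm
  have hc : c = 0 := by
    by_contra hc
    have hpos : 0 < ‖c‖ ^ 2 := by positivity
    obtain ⟨X, hX⟩ := eventually_atTop.1 (hlim.eventually (eventually_ge_nhds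
      (show ‖c‖ ^ 2 / 2 < (‖c‖ * 1) ^ 2 by rw [mul_one]; linarith)))
    have hi : IntegrableOn (fun t => ‖u t‖ ^ 2) (Ioi (max X 0)) :=
      hs.integrableOn_sq.mono_set (Ioi_subset_Ioi (le_max_right _ _))
    have hconst : IntegrableOn (fun _ : ℝ => ‖c‖ ^ 2 / 2) (Ioi (max X 0)) := by
      refine Integrable.mono' hi aestronglyMeasurable_const ((ae_restrict_iff'
        measurableSet_Ioi).2 (Eventually.of_forall fun t ht => ?_))
      rw [Real.norm_of_nonneg (by positivity)]
      exact hX t ((le_max_left _ _).trans (le_of_lt ht))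
    rw [integrableOn_const_iff] at hconst
    rcases hconst with h | h
    · simp [hc] at h
    · simp at h
  rw [hc, zero_mul] at hc1 hc2
  exact ne_zero_of_ae_eq hu hy (hs.eq_zero hq hc1 hc2)

theorem exists_sq_eq (E : ℂ) : ∃ k : ℂ, 0 ≤ k.im ∧ E = k ^ 2 := by
  obtain ⟨k, hk⟩ := IsAlgClosed.exists_pow_nat_eq E (n := 2) (by norm_num)
  rcases le_total 0 k.im with h | h
  · exact ⟨k, h, hk.symm⟩
  · exact ⟨-k, by simpa using h, by rw [← hk]; ring⟩

theorem exists_jostW_eq_zero_of_isEigenvalue (hq : FullLine q) {E : ℂ}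
    (h : (H q).IsEigenvalue E) : ∃ k : ℂ, 0 < k.im ∧ E = k ^ 2 ∧ jostW q k = 0 := by
  obtain ⟨k, hk, rfl⟩ := exists_sq_eq E
  have hk' : 0 < k.im := lt_of_le_of_ne hk (im_ne_zero_of_isEigenvalue hq h).symm
  exact ⟨k, hk', rfl, jostW_eq_zero_of_isEigenvalue hq hk' h⟩

end Schrodinger

/-! ### From zeros of the Wronskian to eigenfunctions, by gluing. -/

namespace Schrodinger

open LinearPMap

variable {q : ℝ → ℂ} {k : ℂ}

/-- The function on the line equal to `a` on `[0, ∞)` and to the reflection of `b` on `(-∞, 0)`. -/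
noncomputable def glue (a b : ℝ → ℂ) (x : ℝ) : ℂ := if 0 ≤ x then a x else b (-x)

theorem glue_of_nonneg {a b : ℝ → ℂ} {x : ℝ} (hx : 0 ≤ x) : glue a b x = a x := if_pos hx

theorem glue_of_neg {a b : ℝ → ℂ} {x : ℝ} (hx : x < 0) : glue a b x = b (-x) := if_neg hx.not_ge

/-- Reflection changes the sign of the derivative on the left branch, and `a 0 = b 0` excludes a
jump at the origin. -/
theorem glue_primitive {a b a' b' : ℝ → ℂ} (h : HasPrim a a') (h' : HasPrim b b')
    (h0 : a 0 = b 0) (x y : ℝ) :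
    IntervalIntegrable (glue a' fun t => -b' t) volume x y ∧
      glue a b y - glue a b x = ∫ t in x..y, glue a' (fun t => -b' t) t := by
  have key : ∀ x, IntervalIntegrable (glue a' fun t => -b' t) volume 0 x ∧
      glue a b x = glue a b 0 + ∫ t in (0 : ℝ)..x, glue a' (fun t => -b' t) t := by
    intro x
    rw [glue_of_nonneg (le_refl (0 : ℝ))]
    rcases le_or_gt 0 x with hx | hx
    · have e : ∀ t ∈ uIoc 0 x, a' t = glue a' (fun t => -b' t) t := fun t ht => by
        rw [uIoc_of_le hx] at ht
        rw [glue_of_nonneg ht.1.le]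
      refine ⟨(h x hx).1.congr e, ?_⟩
      rw [glue_of_nonneg hx, (h x hx).2]
      congr 1
      exact intervalIntegral.integral_congr_ae (Eventually.of_forall e)
    · have hx' : 0 ≤ -x := by linarith
      -- At `0` itself `glue` takes the right branch, so the two integrands agree on the left only
      -- off a null set.
      have hne : ∀ᵐ t : ℝ, t ≠ 0 := by simp [ae_iff, measure_singleton]
      have e : ∀ᵐ t : ℝ, t ∈ uIoc 0 x → -b' (-t) = glue a' (fun t => -b' t) t := by
        filter_upwards [hne] with t ht0 ht
        rw [uIoc_of_ge hx.le] at ht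
        rw [glue_of_neg (lt_of_le_of_ne ht.2 ht0)]
      have hi : IntervalIntegrable (fun t => -b' (-t)) volume 0 x := by
        have := (h' (-x) hx').1.comp_sub_left (c := 0)
        simp only [zero_sub, neg_neg, sub_zero] at this
        exact this.neg
      refine ⟨hi.congr_ae ((ae_restrict_iff' measurableSet_uIoc).2 e), ?_⟩
      rw [glue_of_neg hx, ← intervalIntegral.integral_congr_ae e, intervalIntegral.integral_neg,
        intervalIntegral.integral_comp_neg, neg_zero, h0, (h' (-x) hx').2,
        intervalIntegral.integral_symm (-x) 0]
  refine ⟨(key x).1.symm.trans (key y).1, ?_⟩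
  rw [← intervalIntegral.integral_interval_sub_left (key y).1 (key x).1, (key x).2, (key y).2]
  ring

/-- Solutions on the two half-lines with matching Cauchy data give a vector in the graph of `H`. -/
theorem exists_isPair_of_glue {E : ℂ} {f g f' g' : ℝ → ℂ} (hf : HasPrim f g)
    (hg : HasPrim g fun t => (q t - E) * f t) (hf' : HasPrim f' g')
    (hg' : HasPrim g' fun t => (refl q t - E) * f' t) (h0 : f 0 = f' 0) (h1 : g 0 = -g' 0)
    (hL : IntegrableOn (fun t => ‖f t‖ ^ 2) (Ioi 0))
    (hL' : IntegrableOn (fun t => ‖f' t‖ ^ 2) (Ioi 0)) :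
    ∃ y : L2, (y : ℝ → ℂ) =ᵐ[volume] glue f f' ∧ IsPair q y (E • y) ∧ Continuous (glue f f') := by
  set u := glue f f' with hu
  set v := glue g (fun t => -g' t) with hv
  have hup := glue_primitive hf hf' h0
  have hvp := glue_primitive hg (by simpa using hg'.const_mul (-1)) h1
  have hvc : Continuous v := by
    have : v = fun x => v 0 + ∫ t in (0 : ℝ)..x,
        glue (fun t => (q t - E) * f t) (fun t => -(-((refl q t - E) * f' t))) t := by
      ext x
      rw [← (hvp 0 x).2]
      ring
    rw [this]
    exact continuous_const.add (intervalIntegral.continuous_primitive (fun a b => (hvp a b).1) 0)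
  have hud : ∀ x, HasDerivAt u (v x) x := by
    intro x
    have : u = fun x => u 0 + ∫ t in (0 : ℝ)..x, v t := by
      ext x
      rw [← (hup 0 x).2]
      ring
    rw [this]
    exact (hvc.integral_hasStrictDerivAt 0 x).hasDerivAt.const_add _
  have huc : Continuous u := continuous_iff_continuousAt.2 fun x => (hud x).continuousAt
  have hw : glue (fun t => (q t - E) * f t) (fun t => -(-((refl q t - E) * f' t))) =
      fun t => (q t - E) * u t := by
    ext t
    rcases le_or_gt 0 t with ht | ht
    · rw [hu, glue_of_nonneg ht, glue_of_nonneg ht]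
    · rw [hu, glue_of_neg ht, glue_of_neg ht, refl, neg_neg, neg_neg]
  rw [hw] at hvp
  have hsq : Integrable (fun t => ‖u t‖ ^ 2) := by
    rw [← integrableOn_univ, ← Iio_union_Ici (a := (0 : ℝ))]
    refine IntegrableOn.union ?_ ((integrableOn_Ici_iff_integrableOn_Ioi (by simp)).2 ?_)
    · have h2 : IntegrableOn (fun t => ‖f' (-t)‖ ^ 2) (Iio 0) := by
        have := IntegrableOn.comp_neg_Iio (c := 0) (f := fun t => ‖f' t‖ ^ 2) (by simpa using hL')
        simpa using this
      exact h2.congr_fun (fun t ht => by simp only [hu, glue_of_neg (mem_Iio.1 ht)])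
        measurableSet_Iio
    · exact hL.congr_fun (fun t ht => by simp only [hu, glue_of_nonneg (mem_Ioi.1 ht).le])
        measurableSet_Ioi
  have hmem : MemLp u 2 volume :=
    (memLp_two_iff_integrable_sq_norm huc.aestronglyMeasurable).2 hsq
  refine ⟨hmem.toLp u, hmem.coeFn_toLp, ⟨u, v, hmem.coeFn_toLp, hud, ?_⟩, huc⟩
  have hae : (fun t => (q t - E) * u t) =ᵐ[volume]
      fun t => q t * u t - ((E • hmem.toLp u : L2) : ℝ → ℂ) t := by
    filter_upwards [Lp.coeFn_smul E (hmem.toLp u), hmem.coeFn_toLp] with t h2 h3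
    rw [h2, Pi.smul_apply, h3, smul_eq_mul]
    ring
  refine ⟨fun a b => (hvp a b).1.congr_ae (ae_restrict_of_ae hae), fun a b => ?_⟩
  rw [← intervalIntegral.integral_congr_ae (hae.mono fun t ht _ => ht)]
  exact (hvp a b).2

theorem integrableOn_jostF_sq (hq : HalfLine q) (hk : 0 < k.im) :
    IntegrableOn (fun t => ‖jostF q k t‖ ^ 2) (Ioi 0) := by
  refine Integrable.mono' ((integrableOn_exp_neg hk).const_mul (Real.exp (gam q 0) ^ 2)) ?_
    ((ae_restrict_iff' measurableSet_Ioi).2 (Eventually.of_forall fun t ht => ?_))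
  · exact (((hasPrim_jostF hq hk.le).continuousOn.norm.pow 2).mono
      Ioi_subset_Ici_self).aestronglyMeasurable measurableSet_Ioi
  · rw [Real.norm_of_nonneg (by positivity)]
    exact norm_jostF_sq_le hq hk le_rfl (le_of_lt ht)

/-- A zero of the Wronskian of the Jost solutions in the upper half-plane gives an eigenvalue. -/
theorem isEigenvalue_of_jostW_eq_zero (hq : FullLine q) (hk : 0 < k.im) (hw : jostW q k = 0) :
    (H q).IsEigenvalue (k ^ 2) := by
  have hr := hq.halfLine
  have hl := hq.refl.halfLine
  have hdr := jost_cauchy_data_ne_zero hr hk.le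
  have hdl := jost_cauchy_data_ne_zero hl hk.le
  rw [jostW] at hw
  -- Vanishing of the Wronskian means proportional Cauchy data; the minus sign in the derivative
  -- comes from the reflection.
  obtain ⟨c, hc1, hc2⟩ : ∃ c : ℂ, c * jostF q k 0 = jostF (refl q) k 0 ∧
      c * jostG q k 0 = -jostG (refl q) k 0 := by
    by_cases hf : jostF q k 0 = 0
    · have hg : jostG q k 0 ≠ 0 := fun hg => hdr ⟨hf, hg⟩
      refine ⟨-jostG (refl q) k 0 / jostG q k 0, ?_, by field_simp⟩
      rw [hf, mul_zero, add_zero] at hw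
      rw [(mul_eq_zero.1 hw).resolve_right hg, hf, mul_zero]
    · refine ⟨jostF (refl q) k 0 / jostF q k 0, by field_simp, ?_⟩
      field_simp
      linear_combination hw
  have hc : c ≠ 0 := by
    rintro rfl
    rw [zero_mul] at hc1 hc2
    exact hdl ⟨hc1.symm, neg_eq_zero.1 hc2.symm⟩
  obtain ⟨y, hy, hp, hcont⟩ := exists_isPair_of_glue (q := q) (E := k ^ 2)
    ((hasPrim_jostF hr hk.le).const_mul c)
    (((hasPrim_jostG hr hk.le).const_mul c).congr fun t _ => by ring)
    (hasPrim_jostF hl hk.le) (hasPrim_jostG hl hk.le) hc1 hc2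
    (by
      simp only [norm_mul, mul_pow]
      exact (integrableOn_jostF_sq hr hk).const_mul _)
    (integrableOn_jostF_sq hl hk)
  refine isEigenvalue_iff.2 ⟨y, fun hy0 => ?_, hp⟩
  have h1 : glue (fun t => c * jostF q k t) (jostF (refl q) k) =ᵐ[volume] fun _ => 0 :=
    hy.symm.trans ((Lp.eq_zero_iff_ae_eq_zero).1 hy0)
  have h2 := (hcont.ae_eq_iff_eq volume continuous_const).1 h1
  have h3 : jostF q k 0 = 0 := by
    have := congrFun h2 0
    rw [glue_of_nonneg le_rfl] at this
    exact (mul_eq_zero.1 this).resolve_left hc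
  have h4 : ∀ t, 0 ≤ t → jostM q k t = 0 := by
    intro t ht
    have := congrFun h2 t
    rw [glue_of_nonneg ht, jostF] at this
    exact (mul_eq_zero.1 ((mul_eq_zero.1 this).resolve_left hc)).resolve_left
      (Complex.exp_ne_zero _)
  have h5 : Tendsto (fun x => ‖jostM q k x‖) atTop (𝓝 0) :=
    tendsto_const_nhds.congr' ((eventually_ge_atTop 0).mono fun x hx => by simp [h4 x hx])
  exact one_ne_zero (tendsto_nhds_unique (tendsto_norm_jostM hr hk.le) h5)

/-! ### The Blaschke product -/

theorem norm_le_of_jostW_eq_zero (hq : FullLine q) (hk : 0 ≤ k.im) (hw : jostW q k = 0) :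
    ‖k‖ ≤ constA q + ‖∫ t, q t‖ := by
  have h := norm_jostW_sub_le hq hk
  rw [hw, zero_sub] at h
  have h1 : ‖2 * Complex.I * k‖ ≤ ‖-(2 * Complex.I * k) + ∫ t, q t‖ + ‖∫ t, q t‖ := by
    rw [← norm_neg (2 * Complex.I * k)]
    simpa using norm_sub_le (-(2 * Complex.I * k) + ∫ t, q t) (∫ t, q t)
  rw [norm_mul, norm_mul, Complex.norm_I, Complex.norm_ofNat] at h1
  linarith [norm_nonneg k]

theorem constA_nonneg : 0 ≤ constA q := by
  refine mul_nonneg (mul_nonneg ?_ ?_) (Real.exp_nonneg _)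
  · exact integral_nonneg fun _ => norm_nonneg _
  · exact integral_nonneg fun _ => by positivity

/-- The zeros of the Wronskian lie in a disc of this radius. -/
noncomputable def radius (q : ℝ → ℂ) : ℝ := constA q + ‖∫ t, q t‖

theorem radius_nonneg : 0 ≤ radius q := add_nonneg constA_nonneg (norm_nonneg _)

/-- A point of the upper half-plane where the Wronskian does not vanish. -/
noncomputable def basePoint (q : ℝ → ℂ) : ℂ := ((radius q + 1 : ℝ) : ℂ) * Complex.I

theorem basePoint_im : (basePoint q).im = radius q + 1 := by simp [basePoint]

theorem basePoint_im_pos : 0 < (basePoint q).im := by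
  rw [basePoint_im]; linarith [radius_nonneg (q := q)]

theorem norm_basePoint : ‖basePoint q‖ = radius q + 1 := by
  rw [basePoint, norm_mul, Complex.norm_I, mul_one,
    Complex.norm_of_nonneg (by linarith [radius_nonneg (q := q)])]

theorem jostW_basePoint_ne_zero (hq : FullLine q) : jostW q (basePoint q) ≠ 0 := by
  intro h
  have := norm_le_of_jostW_eq_zero hq basePoint_im_pos.le h
  rw [norm_basePoint, radius] at this
  linarith

theorem analyticOrderAt_jostW_ne_top (hq : FullLine q) {κ : ℂ} (hκ : 0 < κ.im) :
    analyticOrderAt (jostW q) κ ≠ ⊤ := by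
  intro htop
  have hA : AnalyticOnNhd ℂ (jostW q) {z | 0 < z.im} :=
    (differentiableOn_jostW hq).analyticOnNhd isOpen_upper
  have hconn : IsPreconnected {z : ℂ | 0 < z.im} := (convex_halfSpace_im_gt 0).isPreconnected
  have := hA.eqOn_zero_of_preconnected_of_eventuallyEq_zero hconn hκ
    (analyticOrderAt_eq_top.1 htop) (basePoint_im_pos (q := q))
  exact jostW_basePoint_ne_zero hq this

theorem add_I_ne_zero (hk : 0 < k.im) : k + Complex.I ≠ 0 := by
  intro h
  have := congrArg Complex.im h
  simp at this
  linarith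

/-- The Wronskian, normalized to a bounded function on the upper half-plane. -/
noncomputable def boundedW (q : ℝ → ℂ) (k : ℂ) : ℂ := jostW q k * (k + Complex.I)⁻¹

theorem differentiableOn_boundedW (hq : FullLine q) :
    DifferentiableOn ℂ (boundedW q) {z | 0 < z.im} :=
  (differentiableOn_jostW hq).mul
    (DifferentiableOn.inv (by fun_prop) fun _ hk => add_I_ne_zero hk)

theorem norm_boundedW_le (hq : FullLine q) (hk : 0 < k.im) : ‖boundedW q k‖ ≤ 2 + radius q := by
  have h := norm_jostW_sub_le hq hk.le
  have h1 : ‖jostW q k‖ ≤ 2 * ‖k‖ + radius q := by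
    have e : jostW q k = (jostW q k - 2 * Complex.I * k + ∫ t, q t) + 2 * Complex.I * k
      - ∫ t, q t := by ring
    have e2 : ‖2 * Complex.I * k‖ = 2 * ‖k‖ := by
      rw [norm_mul, norm_mul, Complex.norm_I, Complex.norm_ofNat, mul_one]
    rw [e, radius]
    refine (norm_sub_le _ _).trans ?_
    have := norm_add_le (jostW q k - 2 * Complex.I * k + ∫ t, q t) (2 * Complex.I * k)
    rw [e2] at this
    linarith
  have hsq : ‖k + Complex.I‖ ^ 2 = ‖k‖ ^ 2 + 2 * k.im + 1 := by
    rw [← Complex.normSq_eq_norm_sq, ← Complex.normSq_eq_norm_sq, Complex.normSq_apply,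
      Complex.normSq_apply]
    simp
    ring
  have h2 : ‖k‖ ≤ ‖k + Complex.I‖ :=
    le_of_sq_le_sq (by rw [hsq]; linarith) (norm_nonneg _)
  have h3 : 1 ≤ ‖k + Complex.I‖ :=
    le_of_sq_le_sq (by rw [hsq]; nlinarith [sq_nonneg ‖k‖]) (norm_nonneg _)
  have h4 : 0 < ‖k + Complex.I‖ := by linarith
  rw [boundedW, norm_mul, norm_inv, ← div_eq_mul_inv, div_le_iff₀ h4]
  nlinarith [radius_nonneg (q := q)]

theorem boundedW_basePoint_ne_zero (hq : FullLine q) : boundedW q (basePoint q) ≠ 0 :=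
  mul_ne_zero (jostW_basePoint_ne_zero hq) (inv_ne_zero (add_I_ne_zero basePoint_im_pos))

theorem algMult_le_analyticOrderAt_boundedW (hq : FullLine q) {κ : ℂ} (hκ : 0 < κ.im) :
    ((H q).algMult (κ ^ 2) : ℕ∞) ≤ analyticOrderAt (boundedW q) κ := by
  have h1 : AnalyticAt ℂ (jostW q) κ :=
    (differentiableOn_jostW hq).analyticAt (isOpen_upper.mem_nhds hκ)
  have h2 : AnalyticAt ℂ (fun k => (k + Complex.I)⁻¹) κ :=
    AnalyticAt.inv (by fun_prop) (add_I_ne_zero hκ)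
  refine (finiteDimensional_rootSpace hq hκ (analyticOrderAt_jostW_ne_top hq hκ)).2.trans ?_
  have h3 : analyticOrderAt (boundedW q) κ = analyticOrderAt (jostW q) κ +
      analyticOrderAt (fun k => (k + Complex.I)⁻¹) κ := analyticOrderAt_mul h1 h2
  rw [h3]
  exact le_self_add

theorem im_index_pos (j : Index q) : 0 < (j.1 : ℂ).im := j.1.2.1

theorem norm_index_le (hq : FullLine q) (j : Index q) : ‖(j.1 : ℂ)‖ ≤ radius q :=
  norm_le_of_jostW_eq_zero hq (im_index_pos j).le
    (jostW_eq_zero_of_isEigenvalue hq (im_index_pos j) j.1.2.2)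

theorem norm_factor_sq (hk : 0 < k.im) (j : Index q) :
    ‖factor q k j‖ ^ 2 = 1 - 4 * k.im * (j.1 : ℂ).im / ‖k - conj (j.1 : ℂ)‖ ^ 2 := by
  have hc : 0 < ‖k - conj (j.1 : ℂ)‖ := norm_pos_iff.2 (sub_conj_ne_zero hk (im_index_pos j))
  rw [factor, norm_div, div_pow, norm_sub_sq_eq_norm_sub_conj_sq]
  field_simp

theorem norm_factor_le_one (hk : 0 < k.im) (j : Index q) : ‖factor q k j‖ ≤ 1 := by
  have h := norm_factor_sq hk j
  have h1 := im_index_pos j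
  have : 0 ≤ 4 * k.im * (j.1 : ℂ).im / ‖k - conj (j.1 : ℂ)‖ ^ 2 := by positivity
  exact le_of_sq_le_sq (by rw [h]; linarith) zero_le_one

/-- The bound for finite Blaschke products, applied to `boundedW` at the base point. The same
positive left side serves every finite set `s`. -/
theorem le_prod_norm_factor (hq : FullLine q) (s : Finset (Index q)) :
    ‖boundedW q (basePoint q)‖ ≤
      (2 + radius q) * ∏ j ∈ s, ‖factor q (basePoint q) j‖ := by
  classical
  have h := norm_le_mul_prod_blaschke (s.val.map fun j => (j.1 : ℂ)) (fun κ hκ => by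
      obtain ⟨j, -, rfl⟩ := Multiset.mem_map.1 hκ
      exact im_index_pos j) (differentiableOn_boundedW hq) (fun z hz => norm_boundedW_le hq hz)
      (fun κ hκ => ?_) (basePoint_im_pos (q := q))
  · rwa [Multiset.map_map] at h
  · obtain ⟨j, -, rfl⟩ := Multiset.mem_map.1 hκ
    refine le_trans ?_ (algMult_le_analyticOrderAt_boundedW hq (im_index_pos j))
    rw [Nat.cast_le, Multiset.count_map]
    have h1 : (s.val.filter fun i => (j.1 : ℂ) = i.1).card =
        (s.filter fun i => (j.1 : ℂ) = i.1).card := rfl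
    rw [h1]
    -- The indices in `s` lying over one momentum are at most its algebraic multiplicity in number,
    -- which is at most the order of the zero.
    have h2 : (s.filter fun i => (j.1 : ℂ) = i.1) ⊆
        (Finset.univ : Finset (Fin ((H q).algMult ((j.1 : ℂ) ^ 2)))).image
          (fun a => (⟨j.1, a⟩ : Index q)) := by
      rintro ⟨κ, a⟩ hi
      have hκ : j.1 = κ := Subtype.ext (Finset.mem_filter.1 hi).2
      subst hκ
      simp
    exact (Finset.card_le_card h2).trans (Finset.card_image_le.trans (by simp))

/-- At the base point `1 - |b_j|²` is at least a constant times `Im k_j`, because all `k_j` lie in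
one disc. It is at most `-2 log |b_j|`, and the sums of these logarithms are bounded through
`le_prod_norm_factor`. -/
theorem summable_im_index (hq : FullLine q) : Summable fun j : Index q => (j.1 : ℂ).im := by
  set k₀ := basePoint q with hk₀
  set r := radius q with hr
  have hr0 : 0 ≤ r := radius_nonneg
  have hb : 0 < ‖boundedW q k₀‖ := norm_pos_iff.2 (boundedW_basePoint_ne_zero hq)
  set δ := ‖boundedW q k₀‖ / (2 + r) with hδ
  have hδ0 : 0 < δ := by positivity
  -- The numerator bounds `‖k₀ - conj k_j‖²`; the denominator is half of the factor `4 Im k₀` in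
  -- `norm_factor_sq`.
  set D := (2 * r + 1) ^ 2 / (2 * (r + 1)) with hD
  have hterm : ∀ j : Index q, (j.1 : ℂ).im ≤ D * (-Real.log ‖factor q k₀ j‖) ∧
      0 < ‖factor q k₀ j‖ := by
    intro j
    have him := im_index_pos j
    have hpos : 0 < ‖factor q k₀ j‖ := by
      have := le_prod_norm_factor hq {j}
      rw [Finset.prod_singleton] at this
      by_contra hle
      have h0 : ‖factor q k₀ j‖ = 0 := le_antisymm (not_lt.1 hle) (norm_nonneg _)
      rw [← hk₀, h0, mul_zero] at this
      linarith
    refine ⟨?_, hpos⟩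
    have hlog := Real.log_le_sub_one_of_pos (pow_pos hpos 2)
    rw [Real.log_pow, norm_factor_sq basePoint_im_pos j, basePoint_im, ← hr] at hlog
    push_cast at hlog
    have hc : 0 < ‖k₀ - conj (j.1 : ℂ)‖ :=
      norm_pos_iff.2 (sub_conj_ne_zero basePoint_im_pos him)
    have hc2 : ‖k₀ - conj (j.1 : ℂ)‖ ≤ 2 * r + 1 := by
      refine (norm_sub_le _ _).trans ?_
      rw [Complex.norm_conj, hk₀, norm_basePoint]
      have := norm_index_le hq j
      linarith
    have h1 : 4 * (r + 1) * (j.1 : ℂ).im / (2 * r + 1) ^ 2 ≤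
        4 * (r + 1) * (j.1 : ℂ).im / ‖k₀ - conj (j.1 : ℂ)‖ ^ 2 := by
      gcongr
    have h2 : 4 * (r + 1) * (j.1 : ℂ).im / (2 * r + 1) ^ 2 ≤ 2 * -Real.log ‖factor q k₀ j‖ := by
      linarith
    rw [div_le_iff₀ (by positivity)] at h2
    rw [hD, div_mul_eq_mul_div, le_div_iff₀ (by positivity)]
    linarith
  refine summable_of_sum_le (c := D * (-Real.log δ)) (fun j => (im_index_pos j).le) fun s => ?_
  have hprod := le_prod_norm_factor hq s
  have hδle : δ ≤ ∏ j ∈ s, ‖factor q k₀ j‖ := by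
    rw [hδ, div_le_iff₀ (by positivity)]
    linarith
  calc ∑ j ∈ s, (j.1 : ℂ).im ≤ ∑ j ∈ s, D * (-Real.log ‖factor q k₀ j‖) :=
        Finset.sum_le_sum fun j _ => (hterm j).1
    _ = D * -Real.log (∏ j ∈ s, ‖factor q k₀ j‖) := by
        rw [← Finset.mul_sum, Finset.sum_neg_distrib, Real.log_prod fun j _ => (hterm j).2.ne']
    _ ≤ D * (-Real.log δ) := by
        have := Real.log_le_log hδ0 hδle
        have hD0 : 0 ≤ D := by positivity
        gcongr

/-- The numerator of `factor - 1` is `-2i Im k_j` and the denominator has modulus at least `η`.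
Uniformity on `η ≤ k.im` gives locally uniform convergence of the product. -/
theorem norm_factor_sub_one_le {η : ℝ} (hη : 0 < η) (hk : η ≤ k.im) (j : Index q) :
    ‖factor q k j - 1‖ ≤ 2 / η * (j.1 : ℂ).im := by
  have him := im_index_pos j
  have hc := sub_conj_ne_zero (hη.trans_le hk) him
  have e : factor q k j - 1 = (conj (j.1 : ℂ) - j.1) / (k - conj (j.1 : ℂ)) := by
    rw [factor]; field_simp; ring
  have h1 : ‖conj (j.1 : ℂ) - j.1‖ = 2 * (j.1 : ℂ).im := by
    have : conj (j.1 : ℂ) - j.1 = ((-(2 * (j.1 : ℂ).im) : ℝ) : ℂ) * Complex.I := by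
      apply Complex.ext <;> simp
      ring
    rw [this, norm_mul, Complex.norm_I, mul_one, Complex.norm_real, norm_neg,
      Real.norm_of_nonneg (by positivity)]
  have h2 : η ≤ ‖k - conj (j.1 : ℂ)‖ := by
    refine le_trans ?_ (Complex.im_le_norm _)
    simp
    linarith
  rw [e, norm_div, h1, div_mul_eq_mul_div]
  gcongr

theorem summable_factor_sub_one (hq : FullLine q) (hk : 0 < k.im) :
    Summable fun j : Index q => ‖factor q k j - 1‖ :=
  Summable.of_nonneg_of_le (fun _ => norm_nonneg _)
    (fun j => norm_factor_sub_one_le hk le_rfl j) ((summable_im_index hq).mul_left _)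

theorem norm_blaschke_le_one (hq : FullLine q) (hk : 0 < k.im) : ‖blaschke q k‖ ≤ 1 := by
  have hm : Multipliable fun j : Index q => factor q k j := by
    have := multipliable_one_add_of_summable (summable_factor_sub_one hq hk)
    simpa using this
  refine le_of_tendsto hm.hasProd.norm (Eventually.of_forall fun s => ?_)
  exact Finset.prod_le_one (fun _ _ => norm_nonneg _) fun j _ => norm_factor_le_one hk j

theorem differentiableOn_blaschke (hq : FullLine q) :
    DifferentiableOn ℂ (blaschke q) {z | 0 < z.im} := by
  intro k hk
  have hk' : 0 < k.im := hk
  set U : Set ℂ := {z | k.im / 2 < z.im} with hU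
  have hUo : IsOpen U := isOpen_lt continuous_const Complex.continuous_im
  have hη : 0 < k.im / 2 := half_pos hk'
  have hfd : ∀ j : Index q, DifferentiableOn ℂ (fun z => factor q z j) U := fun j =>
    DifferentiableOn.div (by fun_prop) (by fun_prop) fun z hz =>
      sub_conj_ne_zero (hη.trans hz) (im_index_pos j)
  have h := Summable.hasProdLocallyUniformlyOn_one_add
    (f := fun (j : Index q) z => factor q z j - 1) hUo
    ((summable_im_index hq).mul_left (2 / (k.im / 2)))
    (Eventually.of_forall fun j z hz => norm_factor_sub_one_le hη (le_of_lt hz) j)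
    (fun j => ((hfd j).sub_const 1).continuousOn)
  have hd : DifferentiableOn ℂ (fun z => ∏' j : Index q, (1 + (factor q z j - 1))) U := by
    refine h.differentiableOn ?_ hUo
    refine Eventually.of_forall fun s => ?_
    refine DifferentiableOn.fun_finsetProd fun j _ => ?_
    simpa using hfd j
  have hkU : k ∈ U := by rw [hU]; exact half_lt_self hk'
  have := (hd.differentiableAt (hUo.mem_nhds hkU)).differentiableWithinAt (s := {z : ℂ | 0 < z.im})
  simpa [blaschke] using! this

theorem hardyNorm_blaschke_le (hq : FullLine q) : hardyNorm (blaschke q) ≤ 1 := by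
  refine iSup₂_le fun k hk => ?_
  rw [← ofReal_norm, ← ENNReal.ofReal_one]
  exact ENNReal.ofReal_le_ofReal (norm_blaschke_le_one hq hk)

/-! ### Counting the eigenvalues -/

/-- At a zero of `W` the real part of `q₀ - 2ik` is `Re q₀ + 2 Im k`, which exceeds `A`. -/
theorem not_isEigenvalue_of_lt (hq : FullLine q) (hA : constA q < (∫ x, q x).re) (E : ℂ) :
    ¬ (H q).IsEigenvalue E := by
  intro hE
  obtain ⟨k, hk, -, hw⟩ := exists_jostW_eq_zero_of_isEigenvalue hq hE
  have h := norm_jostW_sub_le hq hk.le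
  rw [hw] at h
  have h1 := (Complex.re_le_norm _).trans h
  simp at h1
  linarith

theorem exists_unique_zero (hq : FullLine q) (hA : constA q < (-∫ x, q x).re) :
    ∃ κ : ℂ, 0 < κ.im ∧ jostW q κ = 0 ∧ analyticOrderAt (jostW q) κ ≤ 1 ∧
      ∀ k : ℂ, 0 < k.im → jostW q k = 0 → k = κ := by
  set c : ℂ := (∫ x, q x) / (2 * Complex.I) with hc
  set φ : ℂ → ℂ := fun z => z - jostW q z / (2 * Complex.I) with hφ
  set ρ := constA q / 2 with hρdef
  have hcim : c.im = (-∫ x, q x).re / 2 := by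
    have : c = -(Complex.I * (∫ x, q x)) / 2 := by
      rw [hc]
      have := Complex.I_ne_zero
      field_simp
      linear_combination (∫ x, q x) * Complex.I_sq
    rw [this]
    simp
  have hρ0 : 0 ≤ ρ := by have := constA_nonneg (q := q); positivity
  have hρc : ρ < c.im := by rw [hcim, hρdef]; linarith
  -- `R` exceeds `ρ` but not the height of `c`, so the closed disc stays in the upper half-plane and
  -- `φ` maps it strictly inside itself.
  obtain ⟨R, hρR, hRc⟩ := exists_between hρc
  have hR : 0 < R := hρ0.trans_lt hρR
  have hφc : ∀ z : ℂ, 0 < z.im → ‖φ z - c‖ ≤ ρ := by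
    intro z hz
    have h := norm_jostW_sub_le hq hz.le
    have e : φ z - c = -(jostW q z - 2 * Complex.I * z + ∫ x, q x) / (2 * Complex.I) := by
      rw [hφ, hc]
      have := Complex.I_ne_zero
      field_simp
      ring
    rw [e, norm_div, norm_neg, norm_mul, Complex.norm_I, Complex.norm_ofNat, mul_one, hρdef]
    gcongr
  have hball : ∀ z ∈ Metric.closedBall c R, 0 < z.im := by
    intro z hz
    have h1 : ‖z - c‖ ≤ R := by simpa [dist_eq_norm] using hz
    have h2 := (abs_le.1 ((Complex.abs_im_le_norm (z - c)).trans h1)).1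
    rw [Complex.sub_im] at h2
    linarith
  have hφd : DifferentiableOn ℂ φ (Metric.closedBall c R) :=
    differentiableOn_id.sub (((differentiableOn_jostW hq).mono hball).div_const _)
  have hφB : ∀ z ∈ Metric.closedBall c R, ‖φ z - c‖ ≤ ρ := fun z hz => hφc z (hball z hz)
  have hfix : ∀ z, z - φ z = jostW q z / (2 * Complex.I) := fun z => by rw [hφ]; ring
  have h2I : (2 * Complex.I) ≠ 0 := by simp
  have hzero : ∀ z, jostW q z = 0 → z - φ z = 0 := fun z hz => by rw [hfix, hz, zero_div]
  -- Every zero in the half-plane is a value of `φ` and so lies in the disc; uniqueness there is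
  -- uniqueness everywhere.
  have hmem : ∀ z, 0 < z.im → z - φ z = 0 → z ∈ Metric.ball c R := fun z hz h => by
    have h1 := hφc z hz
    rw [← sub_eq_zero.1 h] at h1
    rw [mem_ball_iff_norm]
    exact h1.trans_lt hρR
  obtain ⟨κ, hκ, hκfix⟩ := exists_fixedPoint hρR hφd hφB hR
  have hκim := hball κ hκ
  have hds := fun z hz => dslope_ne_zero_of_fixedPoint (z := z) hρR hφd hφB
    (hmem κ hκim hκfix) hκfix hz
  have hWκ : jostW q κ = 0 := by
    rw [hfix] at hκfix
    exact (div_eq_zero_iff.1 hκfix).resolve_right h2I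
  refine ⟨κ, hκim, hWκ, ?_, fun k hk hw => ?_⟩
  · have hWa : AnalyticAt ℂ (jostW q) κ :=
      (differentiableOn_jostW hq).analyticAt (isOpen_upper.mem_nhds hκim)
    have hd := hds κ hκ
    rw [dslope_same] at hd
    have hfun : (fun z => z - φ z) = fun z => jostW q z / (2 * Complex.I) := funext hfix
    rw [hfun, deriv_div_const] at hd
    have hd' : deriv (jostW q) κ ≠ 0 := fun h0 => hd (by rw [h0, zero_div])
    refine (hWa.analyticOrderAt_eq_one_of_zero_deriv_ne_zero hWκ hd').le
  · by_contra hne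
    have hkb := Metric.ball_subset_closedBall (hmem k hk (hzero k hw))
    have h1 := sub_smul_dslope (fun z => z - φ z) κ k
    simp only [hzero k hw, hκfix, sub_zero, smul_eq_mul] at h1
    rcases mul_eq_zero.1 h1 with h2 | h2
    · exact hne (sub_eq_zero.1 h2)
    · exact hds k hkb h2

/-- Multiplicity is at most the order of the simple zero and at least one by the eigenvector. Finite
dimension matters for the lower bound, since `algMult` is `0` for an infinite-dimensional root
space. -/
theorem exists_unique_eigenvalue (hq : FullLine q) (hA : constA q < (-∫ x, q x).re) :
    ∃ κ : ℂ, 0 < κ.im ∧ (∀ E : ℂ, (H q).IsEigenvalue E ↔ E = κ ^ 2) ∧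
      (H q).algMult (κ ^ 2) = 1 := by
  obtain ⟨κ, hκ, hw, hord, huniq⟩ := exists_unique_zero hq hA
  have hev := isEigenvalue_of_jostW_eq_zero hq hκ hw
  refine ⟨κ, hκ, fun E => ⟨fun hE => ?_, fun hE => hE ▸ hev⟩, ?_⟩
  · obtain ⟨k, hk, rfl, hwk⟩ := exists_jostW_eq_zero_of_isEigenvalue hq hE
    rw [huniq k hk hwk]
  · obtain ⟨hfd, hle⟩ := finiteDimensional_rootSpace hq hκ (analyticOrderAt_jostW_ne_top hq hκ)
    refine le_antisymm (by exact_mod_cast hle.trans hord) ?_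
    obtain ⟨y, hy, hp⟩ := isEigenvalue_iff.1 hev
    have hmem : y ∈ (H q).rootSpace (κ ^ 2) :=
      (le_iSup ((H q).kerPow (κ ^ 2)) 1) (mem_kerPow_one.2 hp)
    have : Nontrivial ((H q).rootSpace (κ ^ 2)) :=
      ⟨⟨⟨y, hmem⟩, 0, fun h => hy (congrArg Subtype.val h)⟩⟩
    exact Module.finrank_pos

end Schrodinger

theorem proposition1p1 (q : ℝ → ℂ) (hq : AEStronglyMeasurable q volume)
    (hint : Integrable (fun x : ℝ => (1 + |x|) * ‖q x‖) volume) :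
    ((∀ κ ∈ Schrodinger.momenta q,
          FiniteDimensional ℂ ((Schrodinger.H q).rootSpace (κ ^ 2))) ∧
        (∀ k : ℂ, 0 < k.im →
          Summable (fun j : Schrodinger.Index q => ‖Schrodinger.factor q k j - 1‖)) ∧
        Schrodinger.MemHardy (Schrodinger.blaschke q) ∧
        Schrodinger.hardyNorm (Schrodinger.blaschke q) ≤ 1) ∧
      (Schrodinger.constA q < (∫ x, q x).re →
        ∀ E : ℂ, ¬ (Schrodinger.H q).IsEigenvalue E) ∧
      (Schrodinger.constA q < (-∫ x, q x).re →
        ∃ κ : ℂ, 0 < κ.im ∧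
          (∀ E : ℂ, (Schrodinger.H q).IsEigenvalue E ↔ E = κ ^ 2) ∧
          (Schrodinger.H q).algMult (κ ^ 2) = 1) := by
  have hf := Schrodinger.FullLine.of_weight hq hint
  have hn := Schrodinger.hardyNorm_blaschke_le hf
  exact ⟨⟨fun κ hκ => (Schrodinger.finiteDimensional_rootSpace hf hκ.1
        (Schrodinger.analyticOrderAt_jostW_ne_top hf hκ.1)).1,
      fun k hk => Schrodinger.summable_factor_sub_one hf hk,
      ⟨Schrodinger.differentiableOn_blaschke hf, hn.trans_lt ENNReal.one_lt_top⟩, hn⟩,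
    Schrodinger.not_isEigenvalue_of_lt hf, Schrodinger.exists_unique_eigenvalue hf⟩
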